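/- Let $n\in\mathbb N$ and $m\in\{2,\dots,n-1\}$. In each round of the overlapping cycles shuffle on $n$ cards with parameter $m$ an independent fair coin is flipped; on Heads the $m$th card of the deck is moved to the top, on Tails the $n$th card is moved to the top. Positions are numbered $1,\dots,n$ from the top, cards are named after their initial positions, and $i_t$ denotes the position of card $i$ after $t$ rounds. For $x\in\{1,\dots,n\}$ let $p(x)=x$ if $x\le m$ and $p(x)=x+(x-m)$ if $x>m$. For $\omega\in\mathbb R$ put $$\|\omega\|=\min\{|a|+|b|\sqrt n : a\in\mathbb R,\ b\in\mathbb Z,\ \omega\equiv a+bm \bmod (2n-m+1)\},$$ for $z\in\mathbb Z$ put $|z|_M=\min\{|a| : a\in\mathbb Z,\ z\equiv a \bmod (2n-m+1)\}$, and for $\ell>0$ put $$\gamma=\gamma(\ell,n,m)=\left|\left\{\kappa\in\mathbb Z_{\ge0} : |\kappa m|_M<\ell,\ \kappa<\tfrac{\ell}{\sqrt n}\right\}\right|.$$ **Theorem.** For every $\epsilon\in(0,\frac12)$ there exist constants $C,D>0$, depending only on $\epsilon$, such that the following holds for all $n\in\mathbb N$ and $m\in\{2,\dots,n-1\}$ with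 $\epsilon<\frac mn<1-\epsilon$. Let $\ell\in\mathbb R$ with $\ell>C\sqrt n$. Let $i,j,k$ be cards with $$\|p(i)-p(j)\|,\ \|p(i)-p(k)\|,\ \|p(j)-p(k)\|>199\ell,$$ and let $f_i,f_j,f_k$ be positions with $$\|p(i)-p(f_i)\|,\ \|p(j)-p(f_j)\|,\ \|p(k)-p(f_k)\|<\tfrac{\ell}{10},\qquad \|p(f_i)-p(f_j)\|,\ \|p(f_i)-p(f_k)\|,\ \|p(f_j)-p(f_k)\|>199\ell.$$ Let $T$ be an integer with $\ell^2<T<\ell^2+4n$ and $T-\left\lfloor\frac{T}{2n}\right\rfloor m\equiv0 \bmod (2n-m+1)$. Then $$\mathbb P\big((i_{2T},j_{2T},k_{2T})=(f_i,f_j,f_k)\big)\ \ge\ \frac{D\,\gamma^3 n^{3/2}}{\ell^6}.$$ -/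

import Mathlib

namespace OverlappingCycles

/-- The permutation of the positions caused by moving the card in position `r` to the top of a deck
of `n` cards, for `1 ≤ r ≤ n`: the cycle `(1, 2, …, r)`. Position `x` of the deck (`1 ≤ x ≤ n`)
is the element of `Fin n` of value `x - 1`. -/
def moveToTop (n r : ℕ) : Equiv.Perm (Fin n) :=
  if h : r - 1 < n then Fin.cycleRange ⟨r - 1, h⟩ else 1

/-- The effect of `moveToTop`, in terms of the positions `1, …, n`. -/
theorem moveToTop_position (n r : ℕ) (h1 : 1 ≤ r) (h2 : r ≤ n) (x : Fin n) :
    ((moveToTop n r x : Fin n) : ℕ) + 1 =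
      if (x : ℕ) + 1 < r then (x : ℕ) + 1 + 1
      else if (x : ℕ) + 1 = r then 1 else (x : ℕ) + 1 := by
  have h : r - 1 < n := by omega
  have hn : NeZero n := ⟨by omega⟩
  rw [moveToTop, dif_pos h]
  rcases lt_trichotomy ((x : ℕ)) (r - 1) with hx | hx | hx
  · have hlt : x < (⟨r - 1, h⟩ : Fin n) := hx
    rw [Fin.coe_cycleRange_of_lt hlt, if_pos (by omega)]
  · have heq : x = (⟨r - 1, h⟩ : Fin n) := Fin.ext hx
    rw [Fin.cycleRange_of_eq heq, if_neg (by omega), if_pos (by omega)]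
    simp
  · have hgt : (⟨r - 1, h⟩ : Fin n) < x := hx
    rw [Fin.cycleRange_of_gt hgt, if_neg (by omega), if_neg (by omega)]

/-- One round of the overlapping cycles shuffle with parameters `n` and `m`. The coin `true` is
Heads (the `m`th card is moved to the top), `false` is Tails (the `n`th card is moved to the top). -/
def round (n m : ℕ) (coin : Bool) : Equiv.Perm (Fin n) :=
  if coin then moveToTop n m else moveToTop n n

/-- The state of the deck after `t` rounds with the coins `c 0, …, c (t - 1)`: the permutation which
sends each card, named after its initial position, to its current position. -/
def shuffle (n m : ℕ) : (t : ℕ) → (Fin t → Bool) → Equiv.Perm (Fin n)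
  | 0, _ => 1
  | t + 1, c => round n m (c (Fin.last t)) * shuffle n m t (fun r => c r.castSucc)

/-- The probability that after `t` rounds the cards `i, j, k` are in the positions `fi, fj, fk`
respectively. The coins are independent and fair, that is, uniform on `{Heads, Tails}^t`. -/
noncomputable def hitProb (n m t : ℕ) (i j k fi fj fk : Fin n) : ℝ :=
  (ProbabilityTheory.uniformOn (Set.univ : Set (Fin t → Bool))).real
    {c | shuffle n m t c i = fi ∧ shuffle n m t c j = fj ∧ shuffle n m t c k = fk}

/-- The function `p` on positions: `p x = x` if `x ≤ m`, and `p x = x + (x - m)` if `x > m`,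
where `x` runs through `1, …, n`. -/
def p (n m : ℕ) (x : Fin n) : ℤ :=
  if (x : ℤ) + 1 ≤ m then (x : ℤ) + 1 else ((x : ℤ) + 1) + (((x : ℤ) + 1) - m)

/-- The norm `‖ω‖ = min {|a| + |b| √n : a ∈ ℝ, b ∈ ℤ, ω ≡ a + b m mod (2n - m + 1)}`. -/
noncomputable def wnorm (n m : ℕ) (ω : ℝ) : ℝ :=
  sInf {r : ℝ | ∃ (a : ℝ) (b q : ℤ),
    ω = a + b * m + q * (2 * (n : ℝ) - m + 1) ∧ r = |a| + |(b : ℝ)| * √(n : ℝ)}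

/-- The distance `‖p(x) - p(y)‖` between two positions. -/
noncomputable def wdist (n m : ℕ) (x y : Fin n) : ℝ :=
  wnorm n m ((p n m x : ℝ) - (p n m y : ℝ))

/-- `|z|_M = min {|a| : a ∈ ℤ, z ≡ a mod (2n - m + 1)}`, for an integer `z`. -/
noncomputable def absM (n m : ℕ) (z : ℤ) : ℕ :=
  sInf {r : ℕ | ∃ a : ℤ, z ≡ a [ZMOD (2 * (n : ℤ) - m + 1)] ∧ r = a.natAbs}

/-- `γ(ℓ, n, m)`, the number of natural numbers `κ` (zero included) such that `|κ m|_M < ℓ` and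
`κ < ℓ / √n`. -/
noncomputable def gam (l : ℝ) (n m : ℕ) : ℕ :=
  Set.ncard {κ : ℕ | (absM n m ((κ : ℤ) * m) : ℝ) < l ∧ (κ : ℝ) < l / √(n : ℝ)}

end OverlappingCycles

/-! In the coordinate `g` a card advances by 1 per round on average, except at position `m`. In `t`
rounds it moves by `t + A - n V - (n - m) Z`, where `A` and `Z` are the sums of the coin signs it
meets beyond position `m` and in position `m`, and `V` is its number of visits to `m`. As `V` and
`Z` have the same parity, modulo `2n - m + 1` this is a drift depending on `t` plus some `a + b m`,
with `a` and `b` controlled by `A` and `Z`. In about `l ^ 2` rounds `A` has order `l` and `Z` has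
order `l / √n`, which is the geometry of the norm. So a card spreads over a box of residues. Each
residue of the box has at least `γ` representations in a doubled rectangle, so the box has at most a
constant times `l ^ 2 / (γ √n)` elements. The claim becomes: the three cards hit a given triple with
probability at least a constant divided by the cube of the size of the box. The congruence for `T`
makes the drift of `2T` rounds small.

Steering (`exists_near_steer`): the cards come within `r l` of any prescribed triple at distance of
order `l` with probability bounded below. Each card is alone beyond `m` for a positive fraction of
the time and visits `m` regularly, so every linear functional of the six displacements has quadratic
variation of the order of the time (`exists_Tot_incr_ge`). With a fourth moment bound this gives a
positive chance to move in any given direction (`exists_direction`), and repeated moves towards a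
target reach it (`exists_steer`).

Regularity (`exists_regularity`): if `0 ≤ F ≤ 1`, the expectation of `F` after a small multiple of
`l ^ 2` rounds changes little when one card is moved by `r l`. This is a coupling of two decks that
differ in one card. They use the same coins until the values of `Z` agree (`abs_Ex_sub_le`). Then
the copies are at a plain distance in `g`, and a mirror coupling makes them meet
(`abs_Ex_sub_le_of_gap`).

Conclusion: let `Bad` be the triples near the expected one which are hit from `x` in `T` rounds with
too small a probability. By regularity, the probability to enter `Bad` in the last rounds is almost
constant on balls of radius `r l`; by steering, every such ball is reached first; so this
probability is small from every intermediate triple. Summing over these triples and reversing the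
time bounds the size of `Bad` (`card_filter_tr_lt_le`). The same holds backwards from `f`, as a
reflection of the positions reverses the shuffle. Hence at least half of the triples near the middle
are good for both halves of the path, and summing over them gives the bound (`le_tr_of_bad`,
`exists_le_tr`). -/

namespace OverlappingCycles

open Finset

/-! ### Expectations for finite random dynamics -/

section Averages

variable {ι σ τ : Type*} [Fintype ι]

/-- The average of `F` after one step of the random dynamics `st`, from `x`. -/
noncomputable def avg (st : ι → σ → σ) (F : σ → ℝ) (x : σ) : ℝ :=
  (∑ i, F (st i x)) / Fintype.card ι

/-- The expectation of `F` after `t` steps of the random dynamics `st`. -/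
noncomputable def Ex (st : ι → σ → σ) : ℕ → (σ → ℝ) → σ → ℝ
  | 0, F => F
  | t + 1, F => avg st (Ex st t F)

@[simp] theorem Ex_zero (st : ι → σ → σ) (F : σ → ℝ) (x : σ) : Ex st 0 F x = F x := rfl

theorem Ex_succ (st : ι → σ → σ) (t : ℕ) (F : σ → ℝ) (x : σ) :
    Ex st (t + 1) F x = avg st (Ex st t F) x := rfl

theorem avg_bool (st : Bool → σ → σ) (F : σ → ℝ) (x : σ) :
    avg st F x = (F (st true x) + F (st false x)) / 2 := by
  simp [avg]

theorem avg_bool_prod (st : Bool × Bool → σ → σ) (F : σ → ℝ) (x : σ) :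
    avg st F x = (F (st (true, true) x) + F (st (true, false) x) + F (st (false, true) x)
      + F (st (false, false) x)) / 4 := by
  simp only [avg, Fintype.sum_prod_type, Fintype.sum_bool, Fintype.card_prod, Fintype.card_bool]
  push_cast
  ring

theorem avg_mono (st : ι → σ → σ) {F G : σ → ℝ} (x : σ) (h : ∀ i, F (st i x) ≤ G (st i x)) :
    avg st F x ≤ avg st G x := by
  unfold avg
  exact div_le_div_of_nonneg_right (Finset.sum_le_sum fun i _ => h i) (Nat.cast_nonneg _)

theorem avg_congr (st : ι → σ → σ) {F G : σ → ℝ} (x : σ) (h : ∀ i, F (st i x) = G (st i x)) :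
    avg st F x = avg st G x := by
  unfold avg
  rw [Finset.sum_congr rfl fun i _ => h i]

theorem avg_add (st : ι → σ → σ) (F G : σ → ℝ) (x : σ) :
    avg st (fun y => F y + G y) x = avg st F x + avg st G x := by
  simp [avg, Finset.sum_add_distrib, add_div]

theorem avg_sub (st : ι → σ → σ) (F G : σ → ℝ) (x : σ) :
    avg st (fun y => F y - G y) x = avg st F x - avg st G x := by
  simp [avg, Finset.sum_sub_distrib, sub_div]

theorem avg_mul (st : ι → σ → σ) (a : ℝ) (F : σ → ℝ) (x : σ) :
    avg st (fun y => a * F y) x = a * avg st F x := by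
  simp only [avg, ← Finset.mul_sum, mul_div_assoc]

theorem avg_sum {κ : Type*} (s : Finset κ) (st : ι → σ → σ) (F : κ → σ → ℝ) (x : σ) :
    avg st (fun y => ∑ k ∈ s, F k y) x = ∑ k ∈ s, avg st (F k) x := by
  simp only [avg]
  rw [Finset.sum_comm, Finset.sum_div]

theorem avg_const [Nonempty ι] (st : ι → σ → σ) (a : ℝ) (x : σ) : avg st (fun _ => a) x = a := by
  have : (Fintype.card ι : ℝ) ≠ 0 := by exact_mod_cast Fintype.card_ne_zero
  simp [avg, this]

theorem Ex_add (st : ι → σ → σ) (t : ℕ) (F G : σ → ℝ) (x : σ) :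
    Ex st t (fun y => F y + G y) x = Ex st t F x + Ex st t G x := by
  induction t generalizing x with
  | zero => rfl
  | succ t ih => rw [Ex_succ, Ex_succ, Ex_succ, ← avg_add]; exact avg_congr _ _ fun i => ih _

theorem Ex_sub (st : ι → σ → σ) (t : ℕ) (F G : σ → ℝ) (x : σ) :
    Ex st t (fun y => F y - G y) x = Ex st t F x - Ex st t G x := by
  induction t generalizing x with
  | zero => rfl
  | succ t ih => rw [Ex_succ, Ex_succ, Ex_succ, ← avg_sub]; exact avg_congr _ _ fun i => ih _

theorem Ex_mul (st : ι → σ → σ) (t : ℕ) (a : ℝ) (F : σ → ℝ) (x : σ) :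
    Ex st t (fun y => a * F y) x = a * Ex st t F x := by
  induction t generalizing x with
  | zero => rfl
  | succ t ih => rw [Ex_succ, Ex_succ, ← avg_mul]; exact avg_congr _ _ fun i => ih _

theorem Ex_sum {κ : Type*} (s : Finset κ) (st : ι → σ → σ) (t : ℕ) (F : κ → σ → ℝ) (x : σ) :
    Ex st t (fun y => ∑ k ∈ s, F k y) x = ∑ k ∈ s, Ex st t (F k) x := by
  induction t generalizing x with
  | zero => rfl
  | succ t ih =>
    simp only [Ex_succ]
    rw [← avg_sum]; exact avg_congr _ _ fun i => ih _

theorem Ex_const [Nonempty ι] (st : ι → σ → σ) (t : ℕ) (a : ℝ) (x : σ) :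
    Ex st t (fun _ => a) x = a := by
  induction t generalizing x with
  | zero => rfl
  | succ t ih => rw [Ex_succ, avg_congr st x (G := fun _ => a) fun i => ih _, avg_const]

theorem Ex_mono_inv (st : ι → σ → σ) {I : σ → Prop} (hI : ∀ x, I x → ∀ i, I (st i x))
    {F G : σ → ℝ} (h : ∀ x, I x → F x ≤ G x) (t : ℕ) {x : σ} (hx : I x) :
    Ex st t F x ≤ Ex st t G x := by
  induction t generalizing x with
  | zero => exact h x hx
  | succ t ih => exact avg_mono _ _ fun i => ih (hI x hx i)

theorem Ex_mono (st : ι → σ → σ) {F G : σ → ℝ} (h : ∀ x, F x ≤ G x) (t : ℕ) (x : σ) :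
    Ex st t F x ≤ Ex st t G x :=
  Ex_mono_inv (I := fun _ => True) st (fun _ _ _ => trivial) (fun x _ => h x) t trivial

theorem Ex_nonneg [Nonempty ι] (st : ι → σ → σ) {F : σ → ℝ} (h : ∀ x, 0 ≤ F x) (t : ℕ) (x : σ) :
    0 ≤ Ex st t F x := by
  rw [← Ex_const st t 0 x]; exact Ex_mono st h t x

theorem Ex_add_time (st : ι → σ → σ) (s t : ℕ) (F : σ → ℝ) (x : σ) :
    Ex st (s + t) F x = Ex st s (Ex st t F) x := by
  induction s generalizing x with
  | zero => simp
  | succ s ih =>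
    rw [show s + 1 + t = s + t + 1 by omega, Ex_succ, Ex_succ]; exact avg_congr _ _ fun i => ih _

theorem Ex_succ' (st : ι → σ → σ) (t : ℕ) (F : σ → ℝ) (x : σ) :
    Ex st (t + 1) F x = Ex st t (avg st F) x := Ex_add_time st t 1 F x

/-- The index of `Φ` is the number of steps still to go. Moment and tail bounds are obtained by
exhibiting a `Φ` which does not increase in mean as this time runs down. -/
theorem Ex_le_of_inv (st : ι → σ → σ) {I : σ → Prop} (hI : ∀ x, I x → ∀ i, I (st i x))
    {Φ : ℕ → σ → ℝ} (h : ∀ t x, I x → avg st (Φ t) x ≤ Φ (t + 1) x) (t : ℕ) {x : σ} (hx : I x) :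
    Ex st t (Φ 0) x ≤ Φ t x := by
  induction t generalizing x with
  | zero => exact le_rfl
  | succ t ih => exact (avg_mono _ _ fun i => ih (hI x hx i)).trans (h t x hx)

theorem Ex_comp (st : ι → σ → σ) (st' : ι → τ → τ) (π : σ → τ) (h : ∀ i x, π (st i x) = st' i (π x))
    (t : ℕ) (F : τ → ℝ) (x : σ) : Ex st t (fun y => F (π y)) x = Ex st' t F (π x) := by
  induction t generalizing x with
  | zero => rfl
  | succ t ih =>
    rw [Ex_succ, Ex_succ, avg, avg]
    simp only [ih, h]

/-- Reversal of the dynamics, for dynamics which a map `ρ` conjugates to its inverse. -/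
theorem Ex_reverse [DecidableEq σ] (st : ι → σ → σ) (ρ : σ → σ) (hρ : ∀ x, ρ (ρ x) = x)
    (h : ∀ i x, st i (ρ (st i x)) = ρ x) (t : ℕ) (x y : σ) :
    Ex st t (fun z => if z = y then (1 : ℝ) else 0) x =
      Ex st t (fun z => if z = ρ x then (1 : ℝ) else 0) (ρ y) := by
  have key : ∀ i z x, st i z = ρ x ↔ z = ρ (st i x) := by
    intro i z x
    constructor
    · intro e
      have h1 := h i z
      rw [e, hρ] at h1
      rw [h1, hρ]
    · rintro rfl
      exact h i x
  induction t generalizing x with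
  | zero =>
    simp only [Ex_zero]
    by_cases e : x = y
    · simp [e]
    · have : ¬ ρ y = ρ x := fun e' => e (by rw [← hρ x, ← e', hρ])
      simp [e, this]
  | succ t ih =>
    rw [Ex_succ, Ex_succ']
    have : (avg st fun z => if z = ρ x then (1 : ℝ) else 0) =
        fun z => ∑ i, (1 / (Fintype.card ι : ℝ)) * (if z = ρ (st i x) then (1 : ℝ) else 0) := by
      funext z
      simp only [avg, key, ← Finset.mul_sum]
      ring
    rw [this, Ex_sum]
    simp only [Ex_mul, ← Finset.mul_sum, avg, ih]
    ring

/-- Chapman–Kolmogorov, pointwise. -/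
theorem Ex_point [Fintype σ] [DecidableEq σ] (st : ι → σ → σ) (t : ℕ) (F : σ → ℝ) (x : σ) :
    Ex st t F x = ∑ z, Ex st t (fun w => if w = z then (1 : ℝ) else 0) x * F z := by
  have : F = fun w => ∑ z, F z * (if w = z then (1 : ℝ) else 0) := by
    funext w; simp
  conv_lhs => rw [this]
  rw [Ex_sum]
  exact Finset.sum_congr rfl fun z _ => by rw [Ex_mul, mul_comm]

end Averages

/-! ### The coordinate `g` of a position -/

/-- The sign of a coin: `-1` for Heads, `1` for Tails. -/
def sg (c : Bool) : ℤ := if c then -1 else 1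

/-- The unwrapped coordinate of a position: `x` for the positions `x ≤ m`, and `p x` minus the
modulus `2n - m + 1` for the positions `x > m`. -/
def g (n m : ℕ) (x : Fin n) : ℤ :=
  if (x : ℤ) + 1 ≤ m then (x : ℤ) + 1 else 2 * ((x : ℤ) + 1) - 2 * n - 1

/-- The reflection of the positions which reverses the time. -/
def sig (n m : ℕ) (x : Fin n) : Fin n :=
  if h : (if (x : ℕ) + 1 ≤ m then m - 1 - (x : ℕ) else n + m - 1 - x) < n then ⟨_, h⟩ else x

/-- One round of the shuffle, for three cards. -/
def step (n m : ℕ) (c : Bool) (x : Fin 3 → Fin n) : Fin 3 → Fin n := fun a => round n m c (x a)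

section Coordinate

variable {n m : ℕ}

theorem g_le (x : Fin n) : g n m x ≤ m := by
  unfold g; split_ifs <;> omega

theorem le_g (hm : m < n) (x : Fin n) : 2 * (m : ℤ) - 2 * n + 1 ≤ g n m x := by
  unfold g; split_ifs <;> omega

theorem g_ne_zero (x : Fin n) : g n m x ≠ 0 := by
  unfold g; split_ifs <;> omega

theorem g_odd (x : Fin n) (h : g n m x < 0) : g n m x % 2 = 1 := by
  unfold g at *; split_ifs at * <;> omega

theorem g_injective : Function.Injective (g n m) := by
  intro x y h
  unfold g at h
  ext
  split_ifs at h <;> omega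

theorem exists_g_pos (hm : m < n) {v : ℤ} (h1 : 1 ≤ v) (h2 : v ≤ m) : ∃ x : Fin n, g n m x = v :=
  ⟨⟨(v - 1).toNat, by omega⟩, by unfold g; simp only; rw [if_pos] <;> omega⟩

theorem exists_g_neg {v : ℤ} (h1 : 2 * (m : ℤ) - 2 * n + 1 ≤ v) (h2 : v < 0)
    (h3 : v % 2 = 1) : ∃ x : Fin n, g n m x = v :=
  ⟨⟨((v + 2 * n + 1) / 2 - 1).toNat, by omega⟩, by unfold g; simp only; rw [if_neg] <;> omega⟩

/-- A card beyond `m` moves by 0 or 2, a card before `m` by 1, and a card in position `m` jumps to 1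
or to the lowest value. Thus only cards in or beyond position `m` use the coin. -/
theorem g_round (hm2 : 2 ≤ m) (hm : m < n) (c : Bool) (x : Fin n) :
    g n m (round n m c x) =
      if g n m x < 0 then g n m x + 1 + sg c
      else if g n m x < m then g n m x + 1 else m + 1 - n - sg c * ((n : ℤ) - m) := by
  have hx := x.2
  cases c
  · have h := moveToTop_position n n (by omega) le_rfl x
    have : round n m false x = moveToTop n n x := by simp [round]
    rw [this]
    unfold g sg
    simp only [Bool.false_eq_true, if_false]
    split_ifs at * <;> omega
  · have h := moveToTop_position n m (by omega) hm.le x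
    have : round n m true x = moveToTop n m x := by simp [round]
    rw [this]
    unfold g sg
    simp only [if_true]
    split_ifs at * <;> omega

theorem g_sig (x : Fin n) (hm2 : 2 ≤ m) (hm : m < n) :
    g n m (sig n m x) = if g n m x < 0 then -2 * ((n : ℤ) - m) - g n m x else m + 1 - g n m x := by
  have hx := x.2
  have h : (if (x : ℕ) + 1 ≤ m then m - 1 - (x : ℕ) else n + m - 1 - x) < n := by
    split_ifs <;> omega
  unfold sig
  rw [dif_pos h]
  unfold g
  simp only
  split_ifs <;> omega

theorem sig_sig (hm2 : 2 ≤ m) (hm : m < n) (x : Fin n) : sig n m (sig n m x) = x := by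
  apply g_injective
  have h1 := g_le (m := m) x
  have h2 := le_g hm x
  have h3 := g_ne_zero (m := m) x
  rw [g_sig _ hm2 hm, g_sig _ hm2 hm]
  split_ifs <;> omega

/-- The reflection reverses the order within the first `m` positions and within the others, and so
conjugates each round to its inverse. This is the hypothesis of `Ex_reverse`. -/
theorem round_sig_round (hm2 : 2 ≤ m) (hm : m < n) (c : Bool) (x : Fin n) :
    round n m c (sig n m (round n m c x)) = sig n m x := by
  apply g_injective
  have h1 := g_le (m := m) x
  have h2 := le_g hm x
  have h3 := g_ne_zero (m := m) x
  have h4 := @g_odd n m x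
  rw [g_round hm2 hm, g_sig _ hm2 hm, g_sig _ hm2 hm, g_round hm2 hm]
  cases c <;> simp only [sg, Bool.false_eq_true, if_false, if_true] <;> split_ifs <;> omega

theorem step_injective {c : Bool} {x : Fin 3 → Fin n} (h : Function.Injective x) :
    Function.Injective (step n m c x) :=
  fun _ _ e => h ((round n m c).injective e)

theorem Ex_step_reverse (hm2 : 2 ≤ m) (hm : m < n) (t : ℕ) (x y : Fin 3 → Fin n) :
    Ex (step n m) t (fun z => if z = y then (1 : ℝ) else 0) x =
      Ex (step n m) t (fun z => if z = (fun a => sig n m (x a)) then (1 : ℝ) else 0)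
        (fun a => sig n m (y a)) := by
  refine Ex_reverse (step n m) (fun z a => sig n m (z a)) ?_ ?_ t x y
  · intro z; funext a; exact sig_sig hm2 hm _
  · intro c z; funext a; exact round_sig_round hm2 hm c _

theorem p_eq_g (x : Fin n) : p n m x = g n m x ∨ p n m x = g n m x + (2 * (n : ℤ) - m + 1) := by
  unfold p g; split_ifs <;> omega

end Coordinate

/-- Both sides are expanded at the last coin, which is where the recursion of `shuffle` acts. -/
theorem Ex_step_eq_sum (n m t : ℕ) (F : (Fin 3 → Fin n) → ℝ) (x : Fin 3 → Fin n) :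
    Ex (step n m) t F x =
      (∑ c : Fin t → Bool, F (fun a => shuffle n m t c (x a))) / 2 ^ t := by
  induction t generalizing F with
  | zero => simp [shuffle]
  | succ t ih =>
    rw [Ex_succ', ih]
    have := (Fin.snocEquiv (fun _ : Fin (t + 1) => Bool)).sum_comp
      (fun c => F (fun a => shuffle n m (t + 1) c (x a)))
    rw [← this, Fintype.sum_prod_type]
    simp only [avg_bool, shuffle, Fin.snocEquiv_apply, Fin.snoc_last, Fin.snoc_castSucc,
      Fintype.sum_bool, Equiv.Perm.mul_apply]
    rw [← Finset.sum_add_distrib, pow_succ, ← Finset.sum_div]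
    unfold step
    field_simp

theorem hitProb_eq (n m t : ℕ) (i j k fi fj fk : Fin n) :
    hitProb n m t i j k fi fj fk =
      Ex (step n m) t (fun z => if z = ![fi, fj, fk] then (1 : ℝ) else 0) ![i, j, k] := by
  classical
  rw [Ex_step_eq_sum, hitProb, MeasureTheory.measureReal_def, ProbabilityTheory.uniformOn_univ]
  have h : ∀ c : Fin t → Bool, ((fun a => shuffle n m t c (![i, j, k] a)) = ![fi, fj, fk]) ↔
      (shuffle n m t c i = fi ∧ shuffle n m t c j = fj ∧ shuffle n m t c k = fk) := by
    intro c
    rw [funext_iff, Fin.forall_fin_succ, Fin.forall_fin_succ, Fin.forall_fin_succ]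
    simp
  simp only [h]
  rw [Finset.sum_boole, MeasureTheory.Measure.count_apply (Set.toFinite _).measurableSet,
    ← Set.coe_toFinset {c : Fin t → Bool | _}, Set.encard_coe_eq_coe_finsetCard]
  simp

end OverlappingCycles

/-! ### Visits to position `m`, and the time a card spends alone beyond it -/

namespace OverlappingCycles

open Finset

section Totals

variable {ι σ : Type*} [Fintype ι]

/-- The expected total reward `w` over the first `t` steps. -/
noncomputable def Tot (st : ι → σ → σ) (t : ℕ) (w : σ → ℝ) (x : σ) : ℝ :=
  ∑ s ∈ range t, Ex st s w x

@[simp] theorem Tot_zero (st : ι → σ → σ) (w : σ → ℝ) (x : σ) : Tot st 0 w x = 0 := by simp [Tot]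

theorem Tot_succ (st : ι → σ → σ) (t : ℕ) (w : σ → ℝ) (x : σ) :
    Tot st (t + 1) w x = w x + avg st (Tot st t w) x := by
  unfold Tot
  rw [Finset.sum_range_succ', avg_sum, add_comm]
  rfl

theorem Tot_add (st : ι → σ → σ) (s t : ℕ) (w : σ → ℝ) (x : σ) :
    Tot st (s + t) w x = Tot st s w x + Ex st s (Tot st t w) x := by
  unfold Tot
  rw [Finset.sum_range_add, Ex_sum]
  congr 1
  exact Finset.sum_congr rfl fun i _ => Ex_add_time _ _ _ _ _

theorem Tot_nonneg [Nonempty ι] (st : ι → σ → σ) (t : ℕ) {w : σ → ℝ} (h : ∀ x, 0 ≤ w x) (x : σ) :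
    0 ≤ Tot st t w x := Finset.sum_nonneg fun _ _ => Ex_nonneg _ h _ _

theorem Tot_mono_time [Nonempty ι] (st : ι → σ → σ) {s t : ℕ} (hst : s ≤ t) {w : σ → ℝ}
    (h : ∀ x, 0 ≤ w x) (x : σ) : Tot st s w x ≤ Tot st t w x :=
  Finset.sum_le_sum_of_subset_of_nonneg (Finset.range_mono hst) fun _ _ _ => Ex_nonneg _ h _ _

theorem Tot_mono (st : ι → σ → σ) (t : ℕ) {w w' : σ → ℝ} (h : ∀ x, w x ≤ w' x) (x : σ) :
    Tot st t w x ≤ Tot st t w' x := Finset.sum_le_sum fun _ _ => Ex_mono _ h _ _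

theorem Tot_const [Nonempty ι] (st : ι → σ → σ) (t : ℕ) (a : ℝ) (x : σ) :
    Tot st t (fun _ => a) x = t * a := by simp [Tot, Ex_const]

/-- If every state satisfying `I` has expected total reward at least `w₀` in `L` steps, then the
expected total reward in `N * L` steps is at least `N * w₀`. -/
theorem Tot_mul_ge [Nonempty ι] (st : ι → σ → σ) {I : σ → Prop} (hI : ∀ x, I x → ∀ i, I (st i x))
    {w : σ → ℝ} {L : ℕ} {w₀ : ℝ} (h : ∀ x, I x → w₀ ≤ Tot st L w x) (N : ℕ) {x : σ} (hx : I x) :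
    N * w₀ ≤ Tot st (N * L) w x := by
  induction N generalizing x with
  | zero => simp
  | succ N ih =>
    rw [show (N + 1) * L = L + N * L by ring, Tot_add]
    have h1 := Ex_mono_inv st hI (fun y hy => ih hy) L hx
    rw [Ex_const] at h1
    have := h x hx
    push_cast
    linarith

end Totals

/-- The nonnegative part of `g`. -/
def gp (n m : ℕ) (x : Fin n) : ℤ := max (g n m x) 0

/-- Card `a` visits position `m`. -/
noncomputable def vis (n m : ℕ) (a : Fin 3) (x : Fin 3 → Fin n) : ℝ :=
  if g n m (x a) = m then 1 else 0

section Visits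

variable {n m : ℕ}

theorem gp_nonneg (x : Fin n) : 0 ≤ gp n m x := le_max_right _ _

theorem gp_le (x : Fin n) : gp n m x ≤ m := max_le (g_le x) (by positivity)

/-- The nonnegative part of `g` grows by at most 1 per round and falls to at most 1 at a visit.
Hence visits are at least about `m` rounds apart, on every path. -/
theorem gp_round (hm2 : 2 ≤ m) (hm : m < n) (c : Bool) (x : Fin n) :
    gp n m (round n m c x) + (if g n m x = m then (m : ℤ) else 0) ≤ gp n m x + 1 := by
  unfold gp
  have h1 := g_le (m := m) x
  have h3 := g_ne_zero (m := m) x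
  have h4 := @g_odd n m x
  rw [g_round hm2 hm]
  cases c <;> simp only [sg, Bool.false_eq_true, if_false, if_true] <;> split_ifs <;> omega

theorem vis_nonneg (a : Fin 3) (x : Fin 3 → Fin n) : 0 ≤ vis n m a x := by
  unfold vis; split_ifs <;> norm_num

/-- The bound `(t + g⁺) / m` for the number of visits to position `m` in `t` rounds. -/
noncomputable def vb (n m t : ℕ) (x : Fin n) : ℝ := (t + gp n m x) / m

theorem vb_nonneg (t : ℕ) (x : Fin n) : 0 ≤ vb n m t x := by
  have : (0 : ℝ) ≤ gp n m x := by exact_mod_cast gp_nonneg x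
  unfold vb; positivity

theorem vb_le (hm2 : 2 ≤ m) (t : ℕ) (x : Fin n) : vb n m t x ≤ t / m + 1 := by
  have h : (gp n m x : ℝ) ≤ m := by exact_mod_cast gp_le x
  have hm0 : (0 : ℝ) < m := by positivity
  unfold vb
  rw [div_add_one hm0.ne']
  gcongr

theorem vb_step (hm2 : 2 ≤ m) (hm : m < n) (t : ℕ) (c : Bool) (a : Fin 3) (x : Fin 3 → Fin n) :
    vb n m t (step n m c x a) + vis n m a x ≤ vb n m (t + 1) (x a) := by
  have hm0 : (0 : ℝ) < m := by positivity
  have h : (gp n m (round n m c (x a)) : ℝ) + (if g n m (x a) = m then (m : ℝ) else 0)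
      ≤ gp n m (x a) + 1 := by
    have := gp_round hm2 hm c (x a)
    split_ifs at this ⊢ <;> exact_mod_cast this
  have e : vis n m a x = (if g n m (x a) = m then (m : ℝ) else 0) / m := by
    unfold vis; split_ifs <;> simp [hm0.ne']
  rw [e]
  unfold vb step
  rw [← add_div]
  apply div_le_div_of_nonneg_right _ hm0.le
  push_cast
  linarith

theorem Tot_vis_le (hm2 : 2 ≤ m) (hm : m < n) (t : ℕ) (a : Fin 3) (x : Fin 3 → Fin n) :
    Tot (step n m) t (vis n m a) x ≤ vb n m t (x a) := by
  induction t generalizing x with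
  | zero => simpa using vb_nonneg 0 (x a)
  | succ t ih =>
    rw [Tot_succ]
    have h : avg (step n m) (Tot (step n m) t (vis n m a)) x ≤
        avg (step n m) (fun _ => vb n m (t + 1) (x a) - vis n m a x) x :=
      avg_mono _ _ fun c => (ih _).trans (by linarith [vb_step hm2 hm t c a x])
    rw [avg_const] at h
    linarith

/-- The mean of `g` increases by 1 in each round, except at a visit, where the mean change is `1 -
n`. Summation counts the visits. -/
theorem Tot_vis_eq (hm2 : 2 ≤ m) (hm : m < n) (t : ℕ) (a : Fin 3) (x : Fin 3 → Fin n) :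
    n * Tot (step n m) t (vis n m a) x =
      t + g n m (x a) - Ex (step n m) t (fun y => (g n m (y a) : ℝ)) x := by
  induction t generalizing x with
  | zero => simp
  | succ t ih =>
    rw [Tot_succ, mul_add, ← avg_mul, avg_congr _ _ (G := fun y => (t : ℝ) + g n m (y a) -
      Ex (step n m) t (fun y => (g n m (y a) : ℝ)) y) fun c => ih _, avg_sub, Ex_succ]
    have : n * vis n m a x + avg (step n m) (fun y => (t : ℝ) + g n m (y a)) x =
        ((t + 1 : ℕ) : ℝ) + g n m (x a) := by
      rw [avg_bool]
      unfold step vis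
      have h1 := g_le (m := m) (x a)
      rw [g_round hm2 hm, g_round hm2 hm]
      simp only [sg, if_true, Bool.false_eq_true, if_false]
      by_cases h2 : g n m (x a) < 0
      · rw [if_pos h2, if_pos h2, if_neg (by omega)]; push_cast; ring
      · by_cases h3 : g n m (x a) < m
        · rw [if_neg h2, if_neg h2, if_pos h3, if_pos h3, if_neg (by omega)]; push_cast; ring
        · have h4 : g n m (x a) = m := by omega
          rw [if_neg h2, if_neg h2, if_neg h3, if_neg h3, if_pos h4, h4]; push_cast; ring
    linarith

theorem le_Tot_vis (hm2 : 2 ≤ m) (hm : m < n) (t : ℕ) (a : Fin 3) (x : Fin 3 → Fin n) :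
    (t : ℝ) / n - 2 ≤ Tot (step n m) t (vis n m a) x := by
  have hn : (0 : ℝ) < n := by exact_mod_cast (by omega : 0 < n)
  have h := Tot_vis_eq hm2 hm t a x
  have h1 : Ex (step n m) t (fun y => (g n m (y a) : ℝ)) x ≤ Ex (step n m) t (fun _ => (m : ℝ)) x :=
    Ex_mono _ (fun y => by exact_mod_cast g_le (y a)) _ _
  rw [Ex_const] at h1
  have h2 : (2 * (m : ℝ) - 2 * n + 1) ≤ g n m (x a) := by exact_mod_cast le_g hm (x a)
  have hm0 : (0 : ℝ) ≤ m := by positivity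
  rw [sub_le_iff_le_add, div_le_iff₀ hn]
  nlinarith

/-- Card `a` is alone in the positions beyond `m`, deep enough, and no card is in position `m`. -/
def Priv (n m : ℕ) (a : Fin 3) (x : Fin 3 → Fin n) : Prop :=
  2 * g n m (x a) < -((n : ℤ) - m) ∧ ∀ b, b ≠ a → 0 < g n m (x b) ∧ g n m (x b) < m

/-- Card `a` is alone in the positions beyond `m`, deep enough. -/
def WeakPriv (n m : ℕ) (a : Fin 3) (x : Fin 3 → Fin n) : Prop :=
  2 * g n m (x a) < -((n : ℤ) - m) ∧ ∀ b, b ≠ a → 0 < g n m (x b)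

/-- A lower bound for the probability that all visitors of position `m` in `t` rounds make the
prescribed choices. -/
noncomputable def obey (n m t : ℕ) (x : Fin 3 → Fin n) : ℝ := (1 / 2 : ℝ) ^ (∑ a, vb n m t (x a))

theorem obey_le_one (t : ℕ) (x : Fin 3 → Fin n) : obey n m t x ≤ 1 :=
  Real.rpow_le_one (by norm_num) (by norm_num) (Finset.sum_nonneg fun _ _ => vb_nonneg _ _)

theorem obey_step (hm2 : 2 ≤ m) (hm : m < n) (t : ℕ) (c : Bool) (x : Fin 3 → Fin n) :
    obey n m (t + 1) x ≤ obey n m t (step n m c x) := by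
  apply Real.rpow_le_rpow_of_exponent_ge (by norm_num) (by norm_num)
  exact Finset.sum_le_sum fun a _ => by linarith [vb_step hm2 hm t c a x, vis_nonneg (m := m) a x]

/-- A visit uses up one unit of the exponent in `obey`. The resulting factor 2 pays for prescribing
the visitor's coin. -/
theorem obey_step_vis (hm2 : 2 ≤ m) (hm : m < n) (t : ℕ) (c : Bool) (x : Fin 3 → Fin n) (b : Fin 3)
    (hb : g n m (x b) = m) : 2 * obey n m (t + 1) x ≤ obey n m t (step n m c x) := by
  have h : ∑ a, vb n m t (step n m c x a) + 1 ≤ ∑ a, vb n m (t + 1) (x a) := by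
    have h1 : (1 : ℝ) ≤ ∑ a, vis n m a x := by
      have : (1 : ℝ) = vis n m b x := by simp [vis, hb]
      rw [this]
      exact Finset.single_le_sum (f := fun a => vis n m a x) (fun a _ => vis_nonneg a x)
        (Finset.mem_univ b)
    have h2 : ∑ a, vb n m t (step n m c x a) + ∑ a, vis n m a x ≤ ∑ a, vb n m (t + 1) (x a) := by
      rw [← Finset.sum_add_distrib]
      exact Finset.sum_le_sum fun a _ => vb_step hm2 hm t c a x
    linarith
  have h3 : obey n m (t + 1) x ≤ (1 / 2 : ℝ) ^ (∑ a, vb n m t (step n m c x a) + 1) :=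
    Real.rpow_le_rpow_of_exponent_ge (by norm_num) (by norm_num) h
  rw [Real.rpow_add (by norm_num), Real.rpow_one] at h3
  unfold obey at *
  linarith

open Classical in
/-- From any state, all the cards are in the first `m` positions after a while, with probability
bounded from below. -/
theorem obey_sub_le_all_pos (hm2 : 2 ≤ m) (hm : m < n) (t : ℕ) (k : ℤ) {x : Fin 3 → Fin n}
    (hk : ∀ a, g n m (x a) < 0 → 1 - g n m (x a) ≤ 2 * k) :
    obey n m t x - (2 : ℝ) ^ k * (3 / 4) ^ t ≤
      Ex (step n m) t (fun y => if ∀ a, 0 < g n m (y a) then (1 : ℝ) else 0) x := by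
  induction t generalizing x k with
  | zero =>
    rw [Ex_zero]
    have h1 := obey_le_one (m := m) 0 x
    split_ifs with h
    · have : (0 : ℝ) < 2 ^ k := by positivity
      simp; linarith
    · have hk1 : (1 : ℝ) ≤ 2 ^ k := by
        apply one_le_zpow₀ (by norm_num)
        by_contra h'
        apply h
        intro a
        have := hk a
        have := g_ne_zero (m := m) (x a)
        omega
      simp; linarith
  | succ t ih =>
    rw [Ex_succ, avg_bool]
    have hH : ∀ a, g n m (step n m true x a) < 0 → 1 - g n m (step n m true x a) ≤ 2 * k := by
      intro a
      have h1 := g_le (m := m) (x a)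
      have := hk a
      unfold step
      rw [g_round hm2 hm]
      simp only [sg, if_true]
      split_ifs <;> intros <;> omega
    have h0 := ih k hH
    have hq : (2 : ℝ) ^ k * (3 / 4) ^ (t + 1) = 3 / 4 * ((2 : ℝ) ^ k * (3 / 4) ^ t) := by ring
    have hq0 : (0 : ℝ) < (2 : ℝ) ^ k * (3 / 4) ^ t := by positivity
    -- A visitor is told to take Heads, which keeps it in front; only that branch counts. Without
    -- visitors both coins are allowed and Tails lowers `k` by 1, so the error `2 ^ k` is multiplied
    -- by `(1 + 1 / 2) / 2 = 3 / 4` on average.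
    by_cases hv : ∃ b, g n m (x b) = m
    · obtain ⟨b, hb⟩ := hv
      have h1 := obey_step_vis hm2 hm t true x b hb
      have h2 : 0 ≤ Ex (step n m) t
          (fun y => if ∀ a, 0 < g n m (y a) then (1 : ℝ) else 0) (step n m false x) :=
        Ex_nonneg _ (fun y => by split_ifs <;> norm_num) _ _
      linarith
    · push Not at hv
      have hT : ∀ a, g n m (step n m false x a) < 0 →
          1 - g n m (step n m false x a) ≤ 2 * (k - 1) := by
        intro a
        have h1 := g_le (m := m) (x a)
        have := hk a
        have := hv a
        unfold step
        rw [g_round hm2 hm]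
        simp only [sg, Bool.false_eq_true, if_false]
        split_ifs <;> intros <;> omega
      have h1 := ih (k - 1) hT
      have h2 := obey_step hm2 hm t true x
      have h3 := obey_step hm2 hm t false x
      rw [zpow_sub_one₀ (by norm_num)] at h1
      linarith

open Classical in
/-- Card `a` stays alone beyond position `m` with probability bounded from below. -/
theorem obey_le_weakPriv_of_neg (hm2 : 2 ≤ m) (hm : m < n) (a : Fin 3) (s : ℕ) {x : Fin 3 → Fin n}
    (ha : g n m (x a) < 0) (hs : 2 * (g n m (x a) + 2 * s) < -((n : ℤ) - m))
    (hb : ∀ b, b ≠ a → 0 < g n m (x b)) :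
    obey n m s x ≤ Ex (step n m) s (fun y => if WeakPriv n m a y then (1 : ℝ) else 0) x := by
  induction s generalizing x with
  | zero =>
    rw [Ex_zero, if_pos ⟨by simpa using hs, hb⟩]
    exact obey_le_one _ _
  | succ s ih =>
    rw [Ex_succ, avg_bool]
    have hnn : ∀ c, 0 ≤ Ex (step n m) s (fun y => if WeakPriv n m a y then (1 : ℝ) else 0)
        (step n m c x) := fun c => Ex_nonneg _ (fun y => by split_ifs <;> norm_num) _ _
    have key : ∀ c, (c = true ∨ ∀ b, g n m (x b) ≠ m) → obey n m s (step n m c x) ≤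
        Ex (step n m) s (fun y => if WeakPriv n m a y then (1 : ℝ) else 0) (step n m c x) := by
      intro c hc
      have hga : g n m (step n m c x a) = g n m (x a) + 1 + sg c := by
        unfold step; rw [g_round hm2 hm, if_pos ha]
      have hsg : sg c ≤ 1 := by cases c <;> simp [sg]
      apply ih
      · push_cast at hs; omega
      · push_cast at hs; omega
      · intro b hba
        have h1 := hb b hba
        have h2 := g_le (m := m) (x b)
        unfold step
        rw [g_round hm2 hm, if_neg (by omega)]
        split_ifs with h3
        · omega
        · rcases hc with rfl | hc
          · simp [sg]
          · exact absurd (by omega) (hc b)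
    by_cases hv : ∃ b, g n m (x b) = m
    · obtain ⟨b, hb⟩ := hv
      have h1 := obey_step_vis hm2 hm s true x b hb
      linarith [key true (Or.inl rfl), hnn false]
    · push Not at hv
      linarith [key true (Or.inl rfl), key false (Or.inr hv), obey_step hm2 hm s true x,
        obey_step hm2 hm s false x]

open Classical in
-- Card `a` takes Tails when it reaches position `m`, every other visitor takes Heads. Beyond `m`
-- card `a` gains at most 2 per round, so it stays deep for about `(n - m) / 2` rounds whatever the
-- other coins are.
theorem obey_le_weakPriv_of_pos (hm2 : 2 ≤ m) (hm : m < n) (hnm : m + 2 ≤ n) (a : Fin 3) (s : ℕ)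
    {x : Fin 3 → Fin n} (hx : Function.Injective x) (hpos : ∀ b, 0 < g n m (x b))
    (hs : m - g n m (x a) + 1 ≤ s) (hs' : 2 * ((s : ℤ) - (m - g n m (x a))) ≤ (n : ℤ) - m) :
    obey n m s x ≤ Ex (step n m) s (fun y => if WeakPriv n m a y then (1 : ℝ) else 0) x := by
  induction s generalizing x with
  | zero => have := g_le (m := m) (x a); push_cast at hs; omega
  | succ s ih =>
    rw [Ex_succ, avg_bool]
    have hnn : ∀ c, 0 ≤ Ex (step n m) s (fun y => if WeakPriv n m a y then (1 : ℝ) else 0)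
        (step n m c x) := fun c => Ex_nonneg _ (fun y => by split_ifs <;> norm_num) _ _
    by_cases ha : g n m (x a) = m
    · have h1 := obey_step_vis hm2 hm s false x a ha
      have h2 : obey n m s (step n m false x) ≤
          Ex (step n m) s (fun y => if WeakPriv n m a y then (1 : ℝ) else 0)
            (step n m false x) := by
        have hga : g n m (step n m false x a) = 2 * m + 1 - 2 * n := by
          unfold step; rw [g_round hm2 hm, if_neg (by omega), if_neg (by omega)]
          simp [sg]; ring
        apply obey_le_weakPriv_of_neg hm2 hm
        · omega
        · push_cast at hs'; omega
        · intro b hba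
          have h4 := hpos b
          have h5 := g_le (m := m) (x b)
          have h6 : g n m (x b) ≠ m := fun e => hba (hx (g_injective (e.trans ha.symm)))
          unfold step
          rw [g_round hm2 hm, if_neg (by omega), if_pos (by omega)]
          omega
      linarith [hnn true]
    · have key : ∀ c, (c = true ∨ ∀ b, g n m (x b) ≠ m) → obey n m s (step n m c x) ≤
          Ex (step n m) s (fun y => if WeakPriv n m a y then (1 : ℝ) else 0) (step n m c x) := by
        intro c hc
        have hla := g_le (m := m) (x a)
        have hpa := hpos a
        have hga : g n m (step n m c x a) = g n m (x a) + 1 := by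
          unfold step; rw [g_round hm2 hm, if_neg (by omega), if_pos (by omega)]
        apply ih (step_injective hx)
        · intro b
          have h1 := hpos b
          have h2 := g_le (m := m) (x b)
          unfold step
          rw [g_round hm2 hm, if_neg (by omega)]
          split_ifs with h3
          · omega
          · rcases hc with rfl | hc
            · simp [sg]
            · exact absurd (by omega) (hc b)
        · push_cast at hs; omega
        · push_cast at hs'; omega
      by_cases hv : ∃ b, g n m (x b) = m
      · obtain ⟨b, hb⟩ := hv
        have h1 := obey_step_vis hm2 hm s true x b hb
        linarith [key true (Or.inl rfl), hnn false]
      · push Not at hv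
        linarith [key true (Or.inl rfl), key false (Or.inr hv), obey_step hm2 hm s true x,
          obey_step hm2 hm s false x]

open Classical in
-- The two notions of being alone differ only in rounds with a visit to `m`, and there are few of
-- these.
theorem weakPriv_le (a : Fin 3) (x : Fin 3 → Fin n) :
    (if WeakPriv n m a x then (1 : ℝ) else 0) ≤
      (if Priv n m a x then (1 : ℝ) else 0) + ∑ b, vis n m b x := by
  have h0 : 0 ≤ ∑ b, vis n m b x := Finset.sum_nonneg fun b _ => vis_nonneg b x
  by_cases h1 : WeakPriv n m a x
  · by_cases h2 : Priv n m a x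
    · rw [if_pos h1, if_pos h2]; linarith
    · rw [if_pos h1, if_neg h2, zero_add]
      have : ∃ b, g n m (x b) = m := by
        by_contra h
        push Not at h
        exact h2 ⟨h1.1, fun b hb => ⟨h1.2 b hb, lt_of_le_of_ne (g_le _) (h b)⟩⟩
      obtain ⟨b, hb⟩ := this
      have : (1 : ℝ) = vis n m b x := by simp [vis, hb]
      rw [this]
      exact Finset.single_le_sum (f := fun a => vis n m a x) (fun a _ => vis_nonneg a x)
        (Finset.mem_univ b)
  · rw [if_neg h1]
    split_ifs <;> linarith

theorem obey_ge (hm2 : 2 ≤ m) (t : ℕ) (x : Fin 3 → Fin n) :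
    (1 / 2 : ℝ) ^ (3 * ((t : ℝ) / m + 1)) ≤ obey n m t x := by
  apply Real.rpow_le_rpow_of_exponent_ge (by norm_num) (by norm_num)
  calc ∑ a, vb n m t (x a) ≤ ∑ _a : Fin 3, ((t : ℝ) / m + 1) :=
        Finset.sum_le_sum fun a _ => vb_le hm2 t (x a)
    _ = 3 * ((t : ℝ) / m + 1) := by
        rw [Finset.sum_const, Finset.card_univ, Fintype.card_fin, nsmul_eq_mul]; norm_num

open Classical in
-- There are `(n - m) / 2` suitable times, each with probability bounded below, which is a positive
-- fraction of `n`. The visits subtracted number `O(1)`.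
theorem Tot_priv_of_pos (hm2 : 2 ≤ m) (hm : m < n) (hnm : m + 2 ≤ n) (a : Fin 3)
    {x : Fin 3 → Fin n} (hx : Function.Injective x) (hpos : ∀ b, 0 < g n m (x b)) :
    (((n : ℝ) - m - 1) / 2) * (1 / 2 : ℝ) ^ (3 * ((n : ℝ) / m + 1)) - 3 * ((n : ℝ) / m + 1) ≤
      Tot (step n m) n (fun y => if Priv n m a y then (1 : ℝ) else 0) x := by
  set q : ℝ := (1 / 2 : ℝ) ^ (3 * ((n : ℝ) / m + 1)) with hq
  have hm0 : (0 : ℝ) < m := by positivity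
  have h1 : Tot (step n m) n (fun y => if WeakPriv n m a y then (1 : ℝ) else 0) x ≤
      Tot (step n m) n (fun y => if Priv n m a y then (1 : ℝ) else 0) x +
        3 * ((n : ℝ) / m + 1) := by
    have h2 := Tot_mono (step n m) n (weakPriv_le (m := m) a) x
    have h3 : Tot (step n m) n (fun y => (if Priv n m a y then (1 : ℝ) else 0) +
        ∑ b, vis n m b y) x = Tot (step n m) n (fun y => if Priv n m a y then (1 : ℝ) else 0) x +
        ∑ b, Tot (step n m) n (vis n m b) x := by
      unfold Tot
      rw [Finset.sum_comm, ← Finset.sum_add_distrib]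
      exact Finset.sum_congr rfl fun s _ => by
        rw [Ex_add, Ex_sum Finset.univ (step n m) s (fun b => vis n m b)]
    have h4 : ∑ b, Tot (step n m) n (vis n m b) x ≤ ∑ _b : Fin 3, ((n : ℝ) / m + 1) :=
      Finset.sum_le_sum fun b _ => (Tot_vis_le hm2 hm n b x).trans (vb_le hm2 n (x b))
    rw [Finset.sum_const, Finset.card_univ, Fintype.card_fin, nsmul_eq_mul] at h4
    push_cast at h4
    linarith
  have hl := g_le (m := m) (x a)
  have hp := hpos a
  set s₀ : ℕ := (m - g n m (x a) + 1).toNat with hs₀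
  set w : ℕ := (n - m) / 2 with hw
  have h5 : (w : ℝ) * q ≤ Tot (step n m) n (fun y => if WeakPriv n m a y then (1 : ℝ) else 0) x := by
    calc (w : ℝ) * q = ∑ _s ∈ Ico s₀ (s₀ + w), q := by simp
      _ ≤ ∑ s ∈ Ico s₀ (s₀ + w),
          Ex (step n m) s (fun y => if WeakPriv n m a y then (1 : ℝ) else 0) x := by
        apply Finset.sum_le_sum
        intro s hs
        rw [Finset.mem_Ico] at hs
        have hsn : s ≤ n := by omega
        refine le_trans ?_ (obey_le_weakPriv_of_pos hm2 hm hnm a s hx hpos (by omega) (by omega))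
        refine le_trans ?_ (obey_ge hm2 s x)
        apply Real.rpow_le_rpow_of_exponent_ge (by norm_num) (by norm_num)
        have : (s : ℝ) ≤ n := by exact_mod_cast hsn
        gcongr
      _ ≤ _ := by
        apply Finset.sum_le_sum_of_subset_of_nonneg
        · intro s hs
          rw [Finset.mem_Ico] at hs
          rw [Finset.mem_range]
          omega
        · intro s _ _
          exact Ex_nonneg _ (fun y => by split_ifs <;> norm_num) _ _
  have h6 : ((n : ℝ) - m - 1) / 2 ≤ w := by
    have : (n : ℝ) ≤ m + 2 * w + 1 := by exact_mod_cast (by omega : n ≤ m + 2 * w + 1)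
    linarith
  have hq0 : 0 < q := by positivity
  nlinarith

open Classical in
theorem Tot_priv_ge_of_large (hm2 : 2 ≤ m) (hm : m < n) (hnm : m + 2 ≤ n) (a : Fin 3)
    {x : Fin 3 → Fin n} (hx : Function.Injective x) {u : ℝ} (hu : 0 ≤ u)
    (h1 : u ≤ (((n : ℝ) - m - 1) / 2) * (1 / 2 : ℝ) ^ (3 * ((n : ℝ) / m + 1)) -
      3 * ((n : ℝ) / m + 1)) :
    ((1 / 2 : ℝ) ^ (3 * (4 * (n : ℝ) / m + 1)) - (2 * (3 / 4) ^ 4) ^ n) * u ≤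
      Tot (step n m) (5 * n) (fun y => if Priv n m a y then (1 : ℝ) else 0) x := by
  have hnn : ∀ y : Fin 3 → Fin n, 0 ≤ (if Priv n m a y then (1 : ℝ) else 0) :=
    fun y => by split_ifs <;> norm_num
  -- In `4 n` rounds all cards come to the front: at most `n` Tails are needed, and `2 * (3 / 4) ^ 4
  -- < 1` makes the error exponentially small. The last `n` rounds supply the reward.
  rw [show 5 * n = 4 * n + n by ring, Tot_add]
  have h2 := Tot_nonneg (step n m) (4 * n) hnn x
  have h3 : Ex (step n m) (4 * n)
      (fun y => u * (if ∀ a, 0 < g n m (y a) then (1 : ℝ) else 0)) x ≤ Ex (step n m) (4 * n)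
        (Tot (step n m) n (fun y => if Priv n m a y then (1 : ℝ) else 0)) x := by
    apply Ex_mono_inv (I := Function.Injective) _ (fun y hy c => step_injective hy) _ _ hx
    intro y hy
    split_ifs with h
    · rw [mul_one]; exact h1.trans (Tot_priv_of_pos hm2 hm hnm a hy h)
    · rw [mul_zero]; exact Tot_nonneg _ _ hnn _
  rw [Ex_mul] at h3
  have h4 := obey_sub_le_all_pos hm2 hm (4 * n) n (x := x) (fun a _ => by
    have := le_g hm (x a); omega)
  have h5 := obey_ge hm2 (4 * n) x
  have h6 : ((2 : ℝ) * (3 / 4) ^ 4) ^ n = (2 : ℝ) ^ (n : ℤ) * (3 / 4) ^ (4 * n) := by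
    rw [mul_pow, ← pow_mul, zpow_natCast]
  rw [h6]
  push_cast at h5
  nlinarith

open Classical in
/-- The expected time in which a given card is alone beyond position `m` is a positive fraction of
the time. -/
theorem exists_Tot_priv_ge {ε : ℝ} (hε : 0 < ε) : ∃ c : ℝ, 0 < c ∧ ∃ N : ℕ, ∀ n m : ℕ, N ≤ n → 2 ≤ m →
    m < n → ε * n ≤ m → ε * n ≤ (n : ℝ) - m → ∀ (a : Fin 3) (x : Fin 3 → Fin n),
    Function.Injective x → c * n ≤
      Tot (step n m) (5 * n) (fun y => if Priv n m a y then (1 : ℝ) else 0) x := by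
  set q : ℝ := (1 / 2 : ℝ) ^ (3 * (1 / ε + 1)) with hq
  set q' : ℝ := (1 / 2 : ℝ) ^ (3 * (4 / ε + 1)) with hq'
  have hq0 : 0 < q := by positivity
  have hq0' : 0 < q' := by positivity
  obtain ⟨N₁, hN₁⟩ := exists_pow_lt_of_lt_one (half_pos hq0')
    (show (2 : ℝ) * (3 / 4) ^ 4 < 1 by norm_num)
  obtain ⟨N₂, hN₂⟩ := exists_nat_ge ((q / 2 + 3 * (1 / ε + 1)) / (ε * q / 4))
  obtain ⟨N₃, hN₃⟩ := exists_nat_ge (2 / ε)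
  refine ⟨q' / 2 * (ε * q / 4), by positivity, N₁ + N₂ + N₃ + 1, ?_⟩
  intro n m hn hm2 hm h1 h2 a x hx
  have hm0 : (0 : ℝ) < m := by positivity
  have hn0 : (0 : ℝ) < n := by exact_mod_cast (by omega : 0 < n)
  have hnm' : (n : ℝ) / m ≤ 1 / ε := by
    rw [div_le_div_iff₀ hm0 hε]; linarith
  have hNn2 : (N₂ : ℝ) ≤ n := by exact_mod_cast (by omega : N₂ ≤ n)
  have hNn3 : (N₃ : ℝ) ≤ n := by exact_mod_cast (by omega : N₃ ≤ n)
  have hε2 : 2 ≤ ε * n := by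
    have := hN₃.trans hNn3
    rw [div_le_iff₀ hε] at this
    linarith
  have hnm : m + 2 ≤ n := by
    have : (m : ℝ) + 2 ≤ n := by linarith
    exact_mod_cast this
  have hpow : ((2 : ℝ) * (3 / 4) ^ 4) ^ n ≤ q' / 2 :=
    (pow_le_pow_of_le_one (by norm_num) (by norm_num) (by omega)).trans hN₁.le
  have hqn : q ≤ (1 / 2 : ℝ) ^ (3 * ((n : ℝ) / m + 1)) := by
    apply Real.rpow_le_rpow_of_exponent_ge (by norm_num) (by norm_num); linarith
  have hqn' : q' ≤ (1 / 2 : ℝ) ^ (3 * (4 * (n : ℝ) / m + 1)) := by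
    apply Real.rpow_le_rpow_of_exponent_ge (by norm_num) (by norm_num)
    have : 4 * (n : ℝ) / m = 4 * ((n : ℝ) / m) := by ring
    have : 4 / ε = 4 * (1 / ε) := by ring
    linarith
  have hbig : q / 2 + 3 * (1 / ε + 1) ≤ ε * q / 4 * n := by
    have := hN₂.trans hNn2
    rw [div_le_iff₀ (by positivity)] at this
    linarith
  have hu : ε * q / 4 * n ≤ (((n : ℝ) - m - 1) / 2) * (1 / 2 : ℝ) ^ (3 * ((n : ℝ) / m + 1)) -
      3 * ((n : ℝ) / m + 1) := by
    have h3 : ((ε * n - 1) / 2) * q ≤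
        (((n : ℝ) - m - 1) / 2) * (1 / 2 : ℝ) ^ (3 * ((n : ℝ) / m + 1)) := by
      apply mul_le_mul (by linarith) hqn hq0.le (by linarith)
    nlinarith
  refine le_trans ?_ (Tot_priv_ge_of_large hm2 hm hnm a hx (by positivity) hu)
  have hX : 0 ≤ ε * q / 4 * n := by positivity
  calc q' / 2 * (ε * q / 4) * n = (q' / 2) * (ε * q / 4 * n) := by ring
    _ ≤ _ := mul_le_mul_of_nonneg_right (by linarith) hX

end Visits
end OverlappingCycles

/-! ### Moments and quadratic variation of the displacements -/

namespace OverlappingCycles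

open Finset

/-- The state of three cards, with the accumulated displacements: `A` is the sum of the signs of the
coins flipped while the card was beyond position `m`, and `Z` of those flipped while it was in
position `m`. -/
@[ext] structure Aug (n : ℕ) where
  pos : Fin 3 → Fin n
  A : Fin 3 → ℤ
  Z : Fin 3 → ℤ

/-- One round, with the accumulated displacements. -/
def astep (n m : ℕ) (c : Bool) (y : Aug n) : Aug n where
  pos := step n m c y.pos
  A a := y.A a + if g n m (y.pos a) < 0 then sg c else 0
  Z a := y.Z a + if g n m (y.pos a) = m then sg c else 0

section Moments

variable {n m : ℕ}

theorem Ex_astep (t : ℕ) (F : (Fin 3 → Fin n) → ℝ) (y : Aug n) :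
    Ex (astep n m) t (fun z => F z.pos) y = Ex (step n m) t F y.pos :=
  Ex_comp (astep n m) (step n m) Aug.pos (fun _ _ => rfl) t F y

theorem Ex_A_sq (a : Fin 3) (α : ℝ) (t : ℕ) (y : Aug n) :
    Ex (astep n m) t (fun z => ((z.A a : ℝ) - α) ^ 2) y ≤ ((y.A a : ℝ) - α) ^ 2 + t := by
  refine le_trans (le_of_eq ?_) (Ex_le_of_inv (I := fun _ => True) (astep n m)
    (fun _ _ _ => trivial) (Φ := fun t y => ((y.A a : ℝ) - α) ^ 2 + t) ?_ t trivial)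
  · simp
  · intro t x _
    rw [avg_bool]
    by_cases h : g n m (x.pos a) < 0 <;> simp [astep, sg, h]
    nlinarith

theorem Ex_Z_sq (hm2 : 2 ≤ m) (hm : m < n) (a : Fin 3) (α : ℝ) (t : ℕ) (y : Aug n) :
    Ex (astep n m) t (fun z => ((z.Z a : ℝ) - α) ^ 2) y ≤
      ((y.Z a : ℝ) - α) ^ 2 + vb n m t (y.pos a) := by
  refine le_trans (Ex_mono _ (G := fun z => ((z.Z a : ℝ) - α) ^ 2 + vb n m 0 (z.pos a))
    (fun z => by linarith [vb_nonneg (m := m) 0 (z.pos a)]) t y)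
    (Ex_le_of_inv (I := fun _ => True) (astep n m)
    (fun _ _ _ => trivial) (Φ := fun t y => ((y.Z a : ℝ) - α) ^ 2 + vb n m t (y.pos a)) ?_ t trivial)
  intro t x _
  rw [avg_bool]
  have h1 := vb_step hm2 hm t true a x.pos
  have h2 := vb_step hm2 hm t false a x.pos
  by_cases h : g n m (x.pos a) = m <;> simp [astep, sg, vis, h] at * <;> nlinarith

/-- The coefficient of the sign of the next coin in the increment of
`∑ a, (u a * A a + √n * w a * Z a)`. -/
noncomputable def incr (n m : ℕ) (u w : Fin 3 → ℝ) (x : Fin 3 → Fin n) : ℝ :=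
  ∑ a, ((if g n m (x a) < 0 then u a else 0) + √(n : ℝ) * w a * vis n m a x)

/-- A linear functional of the accumulated displacements. -/
noncomputable def lin (u w : Fin 3 → ℝ) (d : ℝ) (y : Aug n) : ℝ :=
  ∑ a, (u a * y.A a + √(n : ℝ) * w a * y.Z a) - d

theorem lin_astep (u w : Fin 3 → ℝ) (d : ℝ) (c : Bool) (y : Aug n) :
    lin u w d (astep n m c y) = lin u w d y + sg c * incr n m u w y.pos := by
  unfold lin incr astep vis
  rw [Finset.mul_sum, sub_add_eq_add_sub, ← Finset.sum_add_distrib]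
  congr 1
  apply Finset.sum_congr rfl
  intro a _
  simp only
  split_ifs <;> push_cast <;> ring

theorem Ex_lin (u w : Fin 3 → ℝ) (d : ℝ) (t : ℕ) (y : Aug n) :
    Ex (astep n m) t (lin u w d) y = lin u w d y := by
  induction t generalizing y with
  | zero => rfl
  | succ t ih =>
    rw [Ex_succ, avg_bool, ih, ih, lin_astep, lin_astep]
    simp [sg]
    ring

theorem Ex_lin_sq (u w : Fin 3 → ℝ) (d : ℝ) (t : ℕ) (y : Aug n) :
    Ex (astep n m) t (fun z => lin u w d z ^ 2) y =
      lin u w d y ^ 2 + Tot (step n m) t (fun x => incr n m u w x ^ 2) y.pos := by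
  induction t generalizing y with
  | zero => simp
  | succ t ih =>
    rw [Ex_succ, avg_bool, ih, ih, lin_astep, lin_astep, Tot_succ, avg_bool]
    simp only [sg, astep, if_true, Bool.false_eq_true, if_false]
    push_cast
    ring

/-- An upper bound for the quadratic variation of `lin` in `t` rounds. -/
noncomputable def qv (n m t : ℕ) (x : Fin 3 → Fin n) : ℝ := 6 * t + 6 * n * ∑ a, vb n m t (x a)

theorem qv_nonneg (t : ℕ) (x : Fin 3 → Fin n) : 0 ≤ qv n m t x := by
  have : 0 ≤ ∑ a, vb n m t (x a) := Finset.sum_nonneg fun _ _ => vb_nonneg _ _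
  unfold qv; positivity

theorem incr_sq_le {u w : Fin 3 → ℝ} (huw : ∑ a, (u a ^ 2 + w a ^ 2) = 1) (x : Fin 3 → Fin n) :
    incr n m u w x ^ 2 ≤ 6 + 6 * n * ∑ a, vis n m a x := by
  have hn : √(n : ℝ) ^ 2 = n := Real.sq_sqrt (by positivity)
  have h1 : ∀ a, (if g n m (x a) < 0 then u a else 0) ^ 2 ≤ u a ^ 2 := by
    intro a; split_ifs <;> nlinarith
  have h2 : ∀ a, (√(n : ℝ) * w a * vis n m a x) ^ 2 ≤ n * vis n m a x := by
    intro a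
    have hw : w a ^ 2 ≤ 1 := by
      rw [← huw]
      have := Finset.single_le_sum (f := fun a => u a ^ 2 + w a ^ 2)
        (fun a _ => by positivity) (Finset.mem_univ a)
      nlinarith [sq_nonneg (u a)]
    have hv : vis n m a x ^ 2 = vis n m a x := by unfold vis; split_ifs <;> simp
    rw [mul_pow, mul_pow, hn, hv]
    have := vis_nonneg (m := m) a x
    have h0 : (0 : ℝ) ≤ n := by positivity
    have : 0 ≤ (n : ℝ) * vis n m a x := by positivity
    nlinarith
  have hu : ∑ a, u a ^ 2 ≤ 1 := by
    rw [← huw]; exact Finset.sum_le_sum fun a _ => by nlinarith [sq_nonneg (w a)]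
  unfold incr
  simp only [Fin.sum_univ_three] at hu ⊢
  set a0 := (if g n m (x 0) < 0 then u 0 else 0)
  set a1 := (if g n m (x 1) < 0 then u 1 else 0)
  set a2 := (if g n m (x 2) < 0 then u 2 else 0)
  set b0 := √(n : ℝ) * w 0 * vis n m 0 x
  set b1 := √(n : ℝ) * w 1 * vis n m 1 x
  set b2 := √(n : ℝ) * w 2 * vis n m 2 x
  have hc : (a0 + b0 + (a1 + b1) + (a2 + b2)) ^ 2 ≤
      6 * (a0 ^ 2 + a1 ^ 2 + a2 ^ 2 + b0 ^ 2 + b1 ^ 2 + b2 ^ 2) := by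
    linarith [sq_nonneg (a0 - a1), sq_nonneg (a0 - a2), sq_nonneg (a1 - a2), sq_nonneg (b0 - b1),
      sq_nonneg (b0 - b2), sq_nonneg (b1 - b2), sq_nonneg (a0 - b0), sq_nonneg (a0 - b1),
      sq_nonneg (a0 - b2), sq_nonneg (a1 - b0), sq_nonneg (a1 - b1), sq_nonneg (a1 - b2),
      sq_nonneg (a2 - b0), sq_nonneg (a2 - b1), sq_nonneg (a2 - b2)]
  linarith [h1 0, h1 1, h1 2, h2 0, h2 1, h2 2]

theorem qv_step (hm2 : 2 ≤ m) (hm : m < n) {u w : Fin 3 → ℝ}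
    (huw : ∑ a, (u a ^ 2 + w a ^ 2) = 1) (t : ℕ) (c : Bool) (x : Fin 3 → Fin n) :
    qv n m t (step n m c x) + incr n m u w x ^ 2 ≤ qv n m (t + 1) x := by
  have h1 := incr_sq_le (m := m) huw x
  have h2 : ∑ a, vb n m t (step n m c x a) + ∑ a, vis n m a x ≤ ∑ a, vb n m (t + 1) (x a) := by
    rw [← Finset.sum_add_distrib]
    exact Finset.sum_le_sum fun a _ => vb_step hm2 hm t c a x
  have h3 : (0 : ℝ) ≤ n := by positivity
  have := mul_le_mul_of_nonneg_left h2 h3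
  unfold qv
  push_cast
  nlinarith

/-- The function `D ^ 4 + 6 D ^ 2 q + 3 q ^ 2` is the fourth moment of `D` plus a centred Gaussian
of variance `q`. When `D` moves by `± h` and `q` drops by at least `h ^ 2`, its mean does not
increase; the balance is `-2 h ^ 4`. -/
theorem Ex_lin_four (hm2 : 2 ≤ m) (hm : m < n) {u w : Fin 3 → ℝ}
    (huw : ∑ a, (u a ^ 2 + w a ^ 2) = 1) (d : ℝ) (t : ℕ) (y : Aug n) :
    Ex (astep n m) t (fun z => lin u w d z ^ 4) y ≤
      lin u w d y ^ 4 + 6 * lin u w d y ^ 2 * qv n m t y.pos + 3 * qv n m t y.pos ^ 2 := by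
  refine le_trans (Ex_mono _ (G := fun z => lin u w d z ^ 4 +
    6 * lin u w d z ^ 2 * qv n m 0 z.pos + 3 * qv n m 0 z.pos ^ 2)
    (fun z => ?_) t y)
    (Ex_le_of_inv (I := fun _ => True) (astep n m) (fun _ _ _ => trivial)
      (Φ := fun t z => lin u w d z ^ 4 + 6 * lin u w d z ^ 2 * qv n m t z.pos +
        3 * qv n m t z.pos ^ 2) ?_ t trivial)
  · have := qv_nonneg (m := m) 0 z.pos
    have : 0 ≤ 6 * lin u w d z ^ 2 * qv n m 0 z.pos := by positivity
    nlinarith [sq_nonneg (qv n m 0 z.pos)]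
  · intro t z _
    set q := qv n m (t + 1) z.pos
    set h := incr n m u w z.pos
    set D := lin u w d z
    have hq : ∀ c, qv n m t (astep n m c z).pos ≤ q - h ^ 2 := fun c => by
      have := qv_step hm2 hm huw t c z.pos
      change qv n m t (step n m c z.pos) ≤ _
      linarith
    have hq0 : ∀ c, 0 ≤ qv n m t (astep n m c z).pos := fun c => qv_nonneg _ _
    have key : ∀ c, lin u w d (astep n m c z) ^ 4 +
        6 * lin u w d (astep n m c z) ^ 2 * qv n m t (astep n m c z).pos +
        3 * qv n m t (astep n m c z).pos ^ 2 ≤ (D + sg c * h) ^ 4 +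
        6 * (D + sg c * h) ^ 2 * (q - h ^ 2) + 3 * (q - h ^ 2) ^ 2 := by
      intro c
      rw [lin_astep]
      have h1 := mul_le_mul_of_nonneg_left (hq c)
        (show 0 ≤ 6 * (D + sg c * h) ^ 2 by positivity)
      have h2 := pow_le_pow_left₀ (hq0 c) (hq c) 2
      linarith
    rw [avg_bool]
    have k1 := key true
    have k2 := key false
    simp only [sg, if_true, Bool.false_eq_true, if_false] at k1 k2
    push_cast at k1 k2
    have hqq := (hq0 true).trans (hq true)
    have : 0 ≤ h ^ 4 := by positivity
    nlinarith

theorem qv_le (hm2 : 2 ≤ m) {ε : ℝ} (hε : 0 < ε) (h1 : ε * n ≤ m) {t : ℕ} (ht : n ≤ t)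
    (x : Fin 3 → Fin n) : qv n m t x ≤ (24 + 18 / ε) * t := by
  have hm0 : (0 : ℝ) < m := by positivity
  have h2 : ∑ a, vb n m t (x a) ≤ ∑ _a : Fin 3, ((t : ℝ) / m + 1) :=
    Finset.sum_le_sum fun a _ => vb_le hm2 t (x a)
  rw [Finset.sum_const, Finset.card_univ, Fintype.card_fin, nsmul_eq_mul] at h2
  have h3 : (n : ℝ) * (t / m) ≤ t / ε := by
    rw [← mul_div_assoc, div_le_div_iff₀ hm0 hε]
    have : (0 : ℝ) ≤ t := by positivity
    nlinarith
  have h4 : (n : ℝ) ≤ t := by exact_mod_cast ht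
  have h5 : (0 : ℝ) ≤ n := by positivity
  have := mul_le_mul_of_nonneg_left h2 h5
  unfold qv
  push_cast at this
  have e : (24 + 18 / ε) * (t : ℝ) = 24 * t + 18 * (t / ε) := by ring
  rw [e]
  nlinarith

open Classical in
-- While card `a` is alone beyond `m` and nobody is in position `m`, the coin acts on `A a` only.
-- This detects the coefficient `u a`.
theorem priv_le_incr_sq (u w : Fin 3 → ℝ) (a : Fin 3) (hm : m < n) (x : Fin 3 → Fin n) :
    u a ^ 2 * (if Priv n m a x then (1 : ℝ) else 0) ≤ incr n m u w x ^ 2 := by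
  split_ifs with h
  · have h0 : incr n m u w x = u a := by
      unfold incr
      rw [Finset.sum_eq_single a]
      · have := h.1
        rw [if_pos (by omega)]
        unfold vis
        rw [if_neg (by omega)]; ring
      · intro b _ hb
        have := h.2 b hb
        rw [if_neg (by omega)]
        unfold vis
        rw [if_neg (by omega)]; ring
      · simp
    rw [h0, mul_one]
  · rw [mul_zero]; exact sq_nonneg _

/-- At a visit of card `a` the increment is `√n * w a` plus a combination of the `u b`, and `(s + e)
^ 2 ≥ s ^ 2 / 2 - e ^ 2`. This detects the coefficient `w a`, with an error that does not grow with
`n`. -/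
theorem vis_le_incr_sq (u w : Fin 3 → ℝ) (a : Fin 3) {x : Fin 3 → Fin n}
    (hx : Function.Injective x) :
    (n * w a ^ 2 / 2 - 3 * ∑ b, u b ^ 2) * vis n m a x ≤ incr n m u w x ^ 2 := by
  by_cases h : g n m (x a) = m
  · have hv : vis n m a x = 1 := by simp [vis, h]
    have hb : ∀ b, b ≠ a → vis n m b x = 0 := by
      intro b hb
      unfold vis
      rw [if_neg fun e => hb (hx (g_injective (e.trans h.symm)))]
    have hn : √(n : ℝ) ^ 2 = n := Real.sq_sqrt (by positivity)
    set e := ∑ b, (if g n m (x b) < 0 then u b else 0) with he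
    have h0 : incr n m u w x = e + √(n : ℝ) * w a := by
      unfold incr
      rw [Finset.sum_add_distrib]
      congr 1
      rw [Finset.sum_eq_single a (fun b _ hba => by rw [hb b hba, mul_zero]) (by simp), hv, mul_one]
    have h1 : e ^ 2 ≤ 3 * ∑ b, u b ^ 2 := by
      have h2 : ∀ a, (if g n m (x a) < 0 then u a else 0) ^ 2 ≤ u a ^ 2 := by
        intro a; split_ifs <;> nlinarith
      have h3 := h2 0
      have h4 := h2 1
      have h5 := h2 2
      rw [he]
      simp only [Fin.sum_univ_three]
      set a0 := (if g n m (x 0) < 0 then u 0 else 0)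
      set a1 := (if g n m (x 1) < 0 then u 1 else 0)
      set a2 := (if g n m (x 2) < 0 then u 2 else 0)
      nlinarith [sq_nonneg (a0 - a1), sq_nonneg (a0 - a2), sq_nonneg (a1 - a2)]
    rw [h0, hv]
    nlinarith [sq_nonneg (2 * e + √(n : ℝ) * w a)]
  · simp only [vis, h, if_false, mul_zero]
    positivity

/-- The quadratic variation of every linear functional of the displacements grows linearly. -/
theorem exists_Tot_incr_ge {ε : ℝ} (hε : 0 < ε) : ∃ c : ℝ, 0 < c ∧ ∃ N : ℕ, ∀ n m : ℕ, N ≤ n →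
    2 ≤ m → m < n → ε * n ≤ m → ε * n ≤ (n : ℝ) - m → ∀ (u w : Fin 3 → ℝ),
    ∑ a, (u a ^ 2 + w a ^ 2) = 1 → ∀ (t : ℕ) (x : Fin 3 → Fin n), 5 * n ≤ t →
    Function.Injective x → c * t ≤ Tot (step n m) t (fun x => incr n m u w x ^ 2) x := by
  classical
  obtain ⟨c, hc, N, hN⟩ := exists_Tot_priv_ge hε
  -- In a block of `5 n` rounds the private time yields at least `c n U / 3` and the visits at least
  -- `n W / 2` up to a constant, with `U + W = 1`. Adding the two gives `μ n / 4` per block, and the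
  -- incomplete last block costs at most a factor 2.
  set μ : ℝ := min (1 / 2) (c / 3) with hμ
  have hμ0 : 0 < μ := by positivity
  obtain ⟨N', hN'⟩ := exists_nat_ge ((3 * (5 / ε + 1)) / (μ / 2))
  refine ⟨μ / 40, by positivity, N + N' + 1, ?_⟩
  intro n m hn hm2 hm h1 h2 u w huw t x ht hx
  have hm0 : (0 : ℝ) < m := by positivity
  have hn0 : (0 : ℝ) < n := by exact_mod_cast (by omega : 0 < n)
  have hNn : (N' : ℝ) ≤ n := by exact_mod_cast (by omega : N' ≤ n)
  set U := ∑ b, u b ^ 2 with hU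
  set W := ∑ b, w b ^ 2 with hW
  have hUW : U + W = 1 := by rw [hU, hW, ← Finset.sum_add_distrib, huw]
  have hU0 : 0 ≤ U := by positivity
  have hW0 : 0 ≤ W := by positivity
  have hbig : 3 * (5 / ε + 1) ≤ μ / 2 * n := by
    have := hN'.trans hNn
    rw [div_le_iff₀ (by positivity)] at this
    linarith
  have block : ∀ x : Fin 3 → Fin n, Function.Injective x →
      μ * n / 4 ≤ Tot (step n m) (5 * n) (fun x => incr n m u w x ^ 2) x := by
    intro x hx
    set R := Tot (step n m) (5 * n) (fun x => incr n m u w x ^ 2) x with hR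
    have k1 : ∀ a, u a ^ 2 * (c * n) ≤ R := by
      intro a
      have h3 := mul_le_mul_of_nonneg_left (hN n m (by omega) hm2 hm h1 h2 a x hx) (sq_nonneg (u a))
      refine h3.trans ?_
      unfold Tot at hR ⊢
      rw [Finset.mul_sum, hR]
      apply Finset.sum_le_sum
      intro s _
      rw [← Ex_mul]
      exact Ex_mono _ (fun y => priv_le_incr_sq u w a hm y) _ _
    have k2 : ∀ a, 3 * (n * w a ^ 2 / 2) - 3 * U * (5 / ε + 1) ≤ R := by
      intro a
      have h3 : (n * w a ^ 2 / 2 - 3 * U) * Tot (step n m) (5 * n) (vis n m a) x ≤ R := by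
        unfold Tot at hR ⊢
        rw [Finset.mul_sum, hR]
        apply Finset.sum_le_sum
        intro s _
        rw [← Ex_mul]
        exact Ex_mono_inv (I := Function.Injective) _ (fun y hy c => step_injective hy)
          (fun y hy => vis_le_incr_sq u w a hy) _ hx
      have h4 := le_Tot_vis hm2 hm (5 * n) a x
      have h5 := (Tot_vis_le hm2 hm (5 * n) a x).trans (vb_le hm2 (5 * n) (x a))
      have h6 : ((5 * n : ℕ) : ℝ) / n - 2 = 3 := by push_cast; field_simp; norm_num
      have h7 : ((5 * n : ℕ) : ℝ) / m ≤ 5 / ε := by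
        push_cast
        rw [div_le_div_iff₀ hm0 hε]; linarith
      rw [h6] at h4
      have h8 : 0 ≤ n * w a ^ 2 / 2 := by positivity
      nlinarith
    have s1 : U * (c * n) ≤ 3 * R := by
      rw [hU, Fin.sum_univ_three]
      linarith [k1 0, k1 1, k1 2]
    have s2 : n * W / 2 - 3 * U * (5 / ε + 1) ≤ R := by
      rw [hW, Fin.sum_univ_three]
      linarith [k2 0, k2 1, k2 2]
    have m1 : μ ≤ 1 / 2 := min_le_left _ _
    have m2 : μ ≤ c / 3 := min_le_right _ _
    have e1 : μ * (U * n) ≤ c / 3 * (U * n) := mul_le_mul_of_nonneg_right m2 (by positivity)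
    have e2 : μ * (W * n) ≤ 1 / 2 * (W * n) := mul_le_mul_of_nonneg_right m1 (by positivity)
    have e3 : U * (3 * (5 / ε + 1)) ≤ 3 * (5 / ε + 1) := by
      have : 0 ≤ 3 * (5 / ε + 1) := by positivity
      nlinarith
    have e4 : μ * (U * n) + μ * (W * n) = μ * n := by rw [← mul_add, ← add_mul, hUW, one_mul]
    linarith
  have hnn : ∀ y : Fin 3 → Fin n, 0 ≤ incr n m u w y ^ 2 := fun y => sq_nonneg _
  set K := t / (5 * n) with hK
  have hKt : K * (5 * n) ≤ t := Nat.div_mul_le_self t (5 * n)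
  have h3 := Tot_mul_ge (step n m) (I := Function.Injective) (fun y hy c => step_injective hy)
    block K hx
  have h4 := Tot_mono_time (step n m) hKt hnn x
  have h5 : t < (K + 1) * (5 * n) := by
    have := Nat.lt_div_mul_add (a := t) (b := 5 * n) (by omega)
    rw [← hK] at this
    linarith
  have h6 : 1 ≤ K := by
    rw [hK]; exact (Nat.one_le_div_iff (by omega)).2 ht
  have h7 : (t : ℝ) ≤ 10 * K * n := by
    have : t ≤ 10 * K * n := by nlinarith
    exact_mod_cast this
  have : μ * t ≤ μ * (10 * K * n) := mul_le_mul_of_nonneg_left h7 hμ0.le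
  linarith

end Moments
end OverlappingCycles

/-! ### Steering the displacements to a target -/

namespace OverlappingCycles

open Finset

section Steering

variable {n m : ℕ}

/-- The squared distance from the displacements to a target. -/
noncomputable def dist2 (α ζ : Fin 3 → ℝ) (y : Aug n) : ℝ :=
  ∑ a, ((y.A a - α a) ^ 2 + n * (y.Z a - ζ a) ^ 2)

theorem dist2_nonneg (α ζ : Fin 3 → ℝ) (y : Aug n) : 0 ≤ dist2 α ζ y :=
  Finset.sum_nonneg fun _ _ => by positivity

theorem Ex_dist2 (hm2 : 2 ≤ m) (hm : m < n) {ε : ℝ} (hε : 0 < ε) (h1 : ε * n ≤ m) {t : ℕ}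
    (ht : n ≤ t) (y : Aug n) :
    Ex (astep n m) t (dist2 (fun a => y.A a) (fun a => y.Z a)) y ≤ (24 + 18 / ε) * t := by
  unfold dist2
  rw [Ex_sum]
  simp only [Ex_add, Ex_mul]
  calc ∑ a, (Ex (astep n m) t (fun z => ((z.A a : ℝ) - y.A a) ^ 2) y +
        n * Ex (astep n m) t (fun z => ((z.Z a : ℝ) - y.Z a) ^ 2) y)
      ≤ ∑ a, ((t : ℝ) + n * vb n m t (y.pos a)) := by
        apply Finset.sum_le_sum
        intro a _
        have h2 := Ex_A_sq (m := m) a (y.A a) t y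
        have h3 := Ex_Z_sq hm2 hm a (y.Z a) t y
        rw [sub_self] at h2 h3
        have : (n : ℝ) * Ex (astep n m) t (fun z => ((z.Z a : ℝ) - y.Z a) ^ 2) y ≤
            n * vb n m t (y.pos a) := mul_le_mul_of_nonneg_left (by linarith) (by positivity)
        linarith
    _ ≤ qv n m t y.pos := by
        rw [Finset.sum_add_distrib, ← Finset.mul_sum]
        have : 0 ≤ ∑ a, vb n m t (y.pos a) := Finset.sum_nonneg fun _ _ => vb_nonneg _ _
        have h4 : 0 ≤ (n : ℝ) * ∑ a, vb n m t (y.pos a) := by positivity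
        unfold qv
        rw [Finset.sum_const, Finset.card_univ, Fintype.card_fin, nsmul_eq_mul]
        push_cast
        have : (0 : ℝ) ≤ t := by positivity
        linarith
    _ ≤ _ := qv_le hm2 hε h1 ht _

theorem lin_sq_le {u w : Fin 3 → ℝ} (huw : ∑ a, (u a ^ 2 + w a ^ 2) = 1) (y z : Aug n) :
    lin u w (lin u w 0 y) z ^ 2 ≤ dist2 (fun a => y.A a) (fun a => y.Z a) z := by
  have e : lin u w (lin u w 0 y) z =
      ∑ a, (u a * (z.A a - y.A a) + w a * (√(n : ℝ) * (z.Z a - y.Z a))) := by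
    unfold lin
    rw [sub_zero, ← Finset.sum_sub_distrib]
    exact Finset.sum_congr rfl fun a _ => by ring
  have e2 : dist2 (fun a => (y.A a : ℝ)) (fun a => (y.Z a : ℝ)) z =
      ∑ a, ((z.A a - y.A a : ℝ) ^ 2 + (√(n : ℝ) * (z.Z a - y.Z a)) ^ 2) := by
    unfold dist2
    exact Finset.sum_congr rfl fun a _ => by rw [mul_pow, Real.sq_sqrt (by positivity)]
  have h3 := Finset.sum_mul_sq_le_sq_mul_sq (Finset.univ : Finset (Fin 3 × Bool))
    (fun i => if i.2 then u i.1 else w i.1)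
    (fun i => if i.2 then (z.A i.1 - y.A i.1 : ℝ) else √(n : ℝ) * (z.Z i.1 - y.Z i.1))
  simp only [Fintype.sum_prod_type, Fintype.sum_bool, if_true, Bool.false_eq_true,
    if_false] at h3
  rw [huw, one_mul] at h3
  rw [e, e2]
  exact h3

/-- Since `D ^ 2 / l - D ^ 4 / l ^ 3 ≤ |D|` for `l = Λ r`, the first term is at most the positive
part of `D`. Removing the part where `D` is small and the part where the whole displacement is large
leaves at most `C r` times the indicator of the desired event. Taking means turns moment bounds into
a bound for its probability. -/
theorem truncation_le {D N₂ r Λ C k I : ℝ} (hΛ : 0 < Λ * r) (hC : 0 < C) (hr : 0 < r) (hk : 0 < k)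
    (hD : D ^ 2 ≤ N₂) (hI : 0 ≤ I) (h : k / 8 * r ≤ D → N₂ ≤ C ^ 2 * r ^ 2 → 1 ≤ I) :
    (D ^ 2 / (Λ * r) - D ^ 4 / (Λ * r) ^ 3 + D) / 2 - k / 8 * r - N₂ / (C * r) ≤ C * r * I := by
  set l := Λ * r with hl
  have hN0 : 0 ≤ N₂ := (sq_nonneg D).trans hD
  have habs : D ^ 2 / l - D ^ 4 / l ^ 3 ≤ |D| := by
    have e : D ^ 2 / l - D ^ 4 / l ^ 3 = D ^ 2 * (l ^ 2 - D ^ 2) / l ^ 3 := by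
      field_simp
    rw [e, div_le_iff₀ (by positivity), ← sq_abs D]
    have hb0 : 0 ≤ |D| := abs_nonneg D
    generalize |D| = b at hb0
    rcases le_total b l with h | h
    · have e1 : b * (l ^ 2 - b ^ 2) ≤ l ^ 3 := by
        have : b * (l ^ 2 - b ^ 2) ≤ b * l ^ 2 :=
          mul_le_mul_of_nonneg_left (by nlinarith) hb0
        have : b * l ^ 2 ≤ l * l ^ 2 := mul_le_mul_of_nonneg_right h (by positivity)
        linarith
      have := mul_le_mul_of_nonneg_left e1 hb0
      linarith
    · have e1 : l ^ 2 - b ^ 2 ≤ 0 := by nlinarith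
      have : b ^ 2 * (l ^ 2 - b ^ 2) ≤ 0 := mul_nonpos_of_nonneg_of_nonpos (by positivity) e1
      have : 0 ≤ b * l ^ 3 := by positivity
      linarith
  have hind : 0 ≤ C * r * I := by positivity
  have hNdiv : 0 ≤ N₂ / (C * r) := by positivity
  have hkr : 0 ≤ k / 8 * r := by positivity
  rcases le_total D 0 with h0 | h0
  · rw [abs_of_nonpos h0] at habs; linarith
  rw [abs_of_nonneg h0] at habs
  by_cases hlt : D ≤ k / 8 * r
  · linarith
  push Not at hlt
  by_cases hN3 : N₂ ≤ C ^ 2 * r ^ 2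
  · have h1 : D ≤ C * r := by
      apply (pow_le_pow_iff_left₀ h0 (by positivity) two_ne_zero).1
      rw [mul_pow]
      exact hD.trans hN3
    have h2 : C * r * 1 ≤ C * r * I := mul_le_mul_of_nonneg_left (h hlt.le hN3) (by positivity)
    linarith
  · push Not at hN3
    have h3 : D ≤ N₂ / (C * r) := by
      rw [le_div_iff₀ (by positivity)]
      nlinarith [sq_nonneg (D - C * r)]
    linarith

/-- With probability bounded from below, the displacements move in a given direction by a distance
comparable with the square root of the time, and not further. -/
theorem exists_direction {ε : ℝ} (hε : 0 < ε) : ∃ c C p : ℝ, 0 < c ∧ 20 ≤ C ∧ 0 < p ∧ ∃ N : ℕ,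
    ∀ n m : ℕ, N ≤ n → 2 ≤ m → m < n → ε * n ≤ m → ε * n ≤ (n : ℝ) - m →
    ∀ (u w : Fin 3 → ℝ), ∑ a, (u a ^ 2 + w a ^ 2) = 1 → ∀ (t : ℕ) (y : Aug n), 5 * n ≤ t →
    Function.Injective y.pos → ∀ P : Aug n → Prop, (∀ z, c * √t ≤ lin u w (lin u w 0 y) z →
      dist2 (fun a => y.A a) (fun a => y.Z a) z ≤ C ^ 2 * t → P z) → ∀ [DecidablePred P],
    p ≤ Ex (astep n m) t (fun z => if P z then (1 : ℝ) else 0) y := by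
  obtain ⟨c, hc, N, hN⟩ := exists_Tot_incr_ge hε
  set Q : ℝ := 24 + 18 / ε with hQ
  have hQ0 : 0 < Q := by positivity
  -- With this scale the second moment contributes at least `k r` and the fourth moment takes away
  -- at most half of it.
  set Λ : ℝ := √(6 * Q ^ 2 / c) with hΛ
  have hΛ2 : Λ ^ 2 = 6 * Q ^ 2 / c := Real.sq_sqrt (by positivity)
  have hΛ0 : 0 < Λ := Real.sqrt_pos.2 (by positivity)
  set k : ℝ := c / (2 * Λ) with hk
  have hk0 : 0 < k := by positivity
  -- The second entry makes the tail term at most `k r / 8`, so that `k r / 4` remains in all. The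
  -- first entry gives `C ^ 2 ≥ 400`, used for the reach of the steering.
  set C : ℝ := max 20 (8 * Q / k) with hC
  have hC20 : 20 ≤ C := le_max_left _ _
  have hCQ : 8 * Q / k ≤ C := le_max_right _ _
  have hC0 : 0 < C := by linarith
  refine ⟨k / 8, C, k / 4 / C, by positivity, hC20, by positivity, N + 1, ?_⟩
  intro n m hn hm2 hm h1 h2 u w huw t y ht hy P hP _
  have hn0 : (0 : ℝ) < n := by exact_mod_cast (by omega : 0 < n)
  have ht0 : (0 : ℝ) < t := by exact_mod_cast (by omega : 0 < t)
  set r := √(t : ℝ) with hr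
  have hr2 : r ^ 2 = t := Real.sq_sqrt ht0.le
  have hr0 : 0 < r := Real.sqrt_pos.2 ht0
  set d := lin u w 0 y with hd
  have hdy : lin u w d y = 0 := by rw [hd]; unfold lin; ring
  set N2 : Aug n → ℝ := dist2 (fun a => (y.A a : ℝ)) (fun a => (y.Z a : ℝ)) with hN2
  have hcs : ∀ z, lin u w d z ^ 2 ≤ N2 z := fun z => lin_sq_le huw y z
  have key : ∀ z, (lin u w d z ^ 2 / (Λ * r) - lin u w d z ^ 4 / (Λ * r) ^ 3 + lin u w d z) / 2 -
      k / 8 * r - N2 z / (C * r) ≤ C * r * (if P z then (1 : ℝ) else 0) := by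
    intro z
    apply truncation_le (by positivity) hC0 hr0 hk0 (hcs z)
    · split_ifs <;> norm_num
    · intro h3 h4
      rw [if_pos (hP z h3 (by rwa [hr2] at h4))]
  have hEx := Ex_mono (astep n m) key t y
  have e1 : (fun z => (lin u w d z ^ 2 / (Λ * r) - lin u w d z ^ 4 / (Λ * r) ^ 3 + lin u w d z) / 2 -
      k / 8 * r - N2 z / (C * r)) = fun z => (1 / (2 * (Λ * r)) * lin u w d z ^ 2 -
      1 / (2 * (Λ * r) ^ 3) * lin u w d z ^ 4 + 1 / 2 * lin u w d z) - k / 8 * r -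
      1 / (C * r) * N2 z := by
    funext z; field_simp
  rw [e1, Ex_sub, Ex_sub, Ex_const, Ex_add, Ex_sub, Ex_mul, Ex_mul, Ex_mul, Ex_mul, Ex_mul,
    Ex_lin, hdy, Ex_lin_sq, hdy] at hEx
  have h4 := Ex_lin_four hm2 hm huw d t y
  rw [hdy] at h4
  have hq := qv_le hm2 hε h1 (show n ≤ t by omega) y.pos
  have hq0 := qv_nonneg (m := m) t y.pos
  have h4' : Ex (astep n m) t (fun z => lin u w d z ^ 4) y ≤ 3 * (Q * t) ^ 2 := by
    have := pow_le_pow_left₀ hq0 hq 2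
    linarith
  have h2' := hN n m (by omega) hm2 hm h1 h2 u w huw t y.pos ht hy
  have hd2 := Ex_dist2 hm2 hm hε h1 (show n ≤ t by omega) y
  have b1 : 1 / (2 * (Λ * r)) * (c * t) ≤ 1 / (2 * (Λ * r)) *
      (0 ^ 2 + Tot (step n m) t (fun x => incr n m u w x ^ 2) y.pos) :=
    mul_le_mul_of_nonneg_left (by linarith) (by positivity)
  have b2 : 1 / (2 * (Λ * r) ^ 3) * Ex (astep n m) t (fun z => lin u w d z ^ 4) y ≤
      1 / (2 * (Λ * r) ^ 3) * (3 * (Q * t) ^ 2) :=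
    mul_le_mul_of_nonneg_left h4' (by positivity)
  have b3 : 1 / (C * r) * Ex (astep n m) t N2 y ≤ 1 / (C * r) * (Q * t) :=
    mul_le_mul_of_nonneg_left hd2 (by positivity)
  have v1 : 1 / (2 * (Λ * r)) * (c * t) = k * r := by
    rw [hk, ← hr2]; field_simp
  have v2 : 1 / (2 * (Λ * r) ^ 3) * (3 * (Q * t) ^ 2) = k * r / 2 := by
    have : Q ^ 2 = c * Λ ^ 2 / 6 := by rw [hΛ2]; field_simp
    rw [mul_pow Q, this, hk, ← hr2]; field_simp; norm_num
  have v3 : 1 / (C * r) * (Q * t) ≤ k / 8 * r := by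
    rw [← hr2]
    have : 8 * Q ≤ C * k := by rwa [div_le_iff₀ hk0] at hCQ
    have e : 1 / (C * r) * (Q * r ^ 2) = Q * r / C := by field_simp
    rw [e, div_le_iff₀ hC0]
    nlinarith
  have hfin : k / 4 * r ≤ C * r * Ex (astep n m) t (fun z => if P z then (1 : ℝ) else 0) y := by
    linarith
  rw [div_le_iff₀ hC0]
  have : r * (k / 4) ≤ r * (Ex (astep n m) t (fun z => if P z then (1 : ℝ) else 0) y * C) := by
    linarith
  exact le_of_mul_le_mul_left this hr0

open Classical in
/-- In one stage, the distance to the target decreases unless it is small. -/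
theorem exists_stage {ε : ℝ} (hε : 0 < ε) : ∃ C K p : ℝ, 20 ≤ C ∧ 0 < K ∧ 0 < p ∧ ∃ N : ℕ,
    ∀ n m : ℕ, N ≤ n → 2 ≤ m → m < n → ε * n ≤ m → ε * n ≤ (n : ℝ) - m →
    ∀ (α ζ : Fin 3 → ℝ) (t : ℕ) (y : Aug n), 5 * n ≤ t → Function.Injective y.pos →
    p ≤ Ex (astep n m) t (fun z => if dist2 α ζ z ≤ max (K ^ 2 * t) (dist2 α ζ y - C ^ 2 * t)
      then (1 : ℝ) else 0) y := by
  obtain ⟨c, C, p, hc, hC, hp, N, hN⟩ := exists_direction hε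
  refine ⟨C, C ^ 2 / c + C, p, hC, by positivity, hp, N + 1, ?_⟩
  intro n m hn hm2 hm h1 h2 α ζ t y ht hy
  have hn0 : (0 : ℝ) < n := by exact_mod_cast (by omega : 0 < n)
  have hr2 : √(t : ℝ) ^ 2 = t := Real.sq_sqrt (by positivity)
  have hr0 : 0 ≤ √(t : ℝ) := Real.sqrt_nonneg _
  have hs2 : √(n : ℝ) ^ 2 = n := Real.sq_sqrt (by positivity)
  set r := √(dist2 α ζ y) with hr
  have hrr : r ^ 2 = dist2 α ζ y := Real.sq_sqrt (dist2_nonneg _ _ _)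
  have hrn : 0 ≤ r := Real.sqrt_nonneg _
  -- The unit vector pointing from the present displacements to the target, in the Euclidean norm
  -- which weights `Z` by `√n`; any unit vector serves at the target itself.
  obtain ⟨u, w, huw, hru, hrw⟩ : ∃ u w : Fin 3 → ℝ, ∑ a, (u a ^ 2 + w a ^ 2) = 1 ∧
      (∀ a, r * u a = α a - y.A a) ∧ (∀ a, r * w a = √(n : ℝ) * (ζ a - y.Z a)) := by
    rcases hrn.eq_or_lt with h0 | h0
    · have hz : dist2 α ζ y = 0 := by rw [← hrr, ← h0]; ring
      unfold dist2 at hz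
      rw [Finset.sum_eq_zero_iff_of_nonneg (fun a _ => by positivity)] at hz
      refine ⟨fun a => if a = 0 then 1 else 0, fun _ => 0, by simp, ?_, ?_⟩
      · intro a
        have h3 := hz a (Finset.mem_univ a)
        have h4 : ((y.A a : ℝ) - α a) ^ 2 = 0 := by
          have : 0 ≤ (n : ℝ) * (y.Z a - ζ a) ^ 2 := by positivity
          nlinarith [sq_nonneg ((y.A a : ℝ) - α a)]
        have h5 : (y.A a : ℝ) - α a = 0 := by simpa using h4
        rw [← h0]; linarith
      · intro a
        have h3 := hz a (Finset.mem_univ a)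
        have h4 : (n : ℝ) * ((y.Z a : ℝ) - ζ a) ^ 2 = 0 := by
          have : 0 ≤ (n : ℝ) * (y.Z a - ζ a) ^ 2 := by positivity
          nlinarith [sq_nonneg ((y.A a : ℝ) - α a)]
        have h5 : (y.Z a : ℝ) - ζ a = 0 := by
          rcases mul_eq_zero.1 h4 with h | h
          · exact absurd h hn0.ne'
          · simpa using h
        rw [show ζ a - y.Z a = 0 by linarith]; simp
    · refine ⟨fun a => (α a - y.A a) / r, fun a => √(n : ℝ) * (ζ a - y.Z a) / r, ?_, ?_, ?_⟩
      · have : ∀ a, ((α a - y.A a) / r) ^ 2 + (√(n : ℝ) * (ζ a - y.Z a) / r) ^ 2 =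
            ((y.A a - α a) ^ 2 + n * (y.Z a - ζ a) ^ 2) / r ^ 2 := by
          intro a
          rw [div_pow, div_pow, mul_pow, hs2]; ring
        simp only [this]
        rw [← Finset.sum_div, div_eq_one_iff_eq (by positivity), hrr]
        rfl
      · intro a; field_simp
      · intro a; field_simp
  refine hN n m (by omega) hm2 hm h1 h2 u w huw t y ht hy _ ?_
  intro z hz1 hz2
  set D := lin u w (lin u w 0 y) z with hD
  have hexp : dist2 α ζ z = r ^ 2 - 2 * (r * D) +
      dist2 (fun a => (y.A a : ℝ)) (fun a => (y.Z a : ℝ)) z := by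
    have e : r * D = ∑ a, ((α a - y.A a) * (z.A a - y.A a) +
        n * ((ζ a - y.Z a) * (z.Z a - y.Z a))) := by
      rw [hD]; unfold lin
      rw [sub_zero, ← Finset.sum_sub_distrib, Finset.mul_sum]
      apply Finset.sum_congr rfl
      intro a _
      calc _ = (r * u a) * (z.A a - y.A a) + √(n : ℝ) * (r * w a) * (z.Z a - y.Z a) := by ring
        _ = _ := by rw [hru, hrw, ← hs2, Real.sqrt_sq (Real.sqrt_nonneg _)]; ring
    rw [hrr, e]
    unfold dist2
    rw [Finset.mul_sum, ← Finset.sum_sub_distrib, ← Finset.sum_add_distrib]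
    exact Finset.sum_congr rfl fun a _ => by ring
  rw [hexp, ← hrr]
  -- The squared distance changes by `-2 r D + |z - y| ^ 2`. Far away, `r D ≥ C ^ 2 t` outweighs the
  -- last term, which is at most `C ^ 2 t`, and leaves a gain of `C ^ 2 t`. Close by, `D ≥ 0`
  -- suffices.
  rcases le_total (C ^ 2 / c * √(t : ℝ)) r with h | h
  · apply le_max_of_le_right
    have h3 : C ^ 2 * t ≤ r * (c * √(t : ℝ)) := by
      have : C ^ 2 / c * √(t : ℝ) * (c * √(t : ℝ)) = C ^ 2 * t := by
        rw [← hr2, Real.sqrt_sq hr0]; field_simp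
      rw [← this]
      exact mul_le_mul_of_nonneg_right h (by positivity)
    have h4 : r * (c * √(t : ℝ)) ≤ r * D := mul_le_mul_of_nonneg_left hz1 hrn
    linarith
  · apply le_max_of_le_left
    have hD0 : 0 ≤ D := le_trans (by positivity) hz1
    have h3 : 0 ≤ r * D := by positivity
    have h4 : r ^ 2 ≤ (C ^ 2 / c * √(t : ℝ)) ^ 2 := pow_le_pow_left₀ hrn h 2
    rw [mul_pow, hr2] at h4
    have h5 : 0 ≤ C ^ 2 / c := by positivity
    have h6 : (C ^ 2 / c) ^ 2 * t + C ^ 2 * t ≤ (C ^ 2 / c + C) ^ 2 * t := by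
      rw [← add_mul]
      apply mul_le_mul_of_nonneg_right _ (by positivity)
      nlinarith
    linarith

open Classical in
/-- In many stages, the displacements come close to a target. -/
theorem exists_steer {ε : ℝ} (hε : 0 < ε) : ∃ K p : ℝ, 0 < K ∧ 0 < p ∧ ∃ N : ℕ,
    ∀ n m : ℕ, N ≤ n → 2 ≤ m → m < n → ε * n ≤ m → ε * n ≤ (n : ℝ) - m →
    ∀ (α ζ : Fin 3 → ℝ) (t k : ℕ) (y : Aug n), 5 * n ≤ t → Function.Injective y.pos →
    dist2 α ζ y ≤ 400 * (k * t) →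
    p ^ k ≤ Ex (astep n m) (k * t) (fun z => if dist2 α ζ z ≤ K ^ 2 * t then (1 : ℝ) else 0) y := by
  obtain ⟨C, K, p, hC, hK, hp, N, hN⟩ := exists_stage hε
  refine ⟨K, p, hK, hp, N, ?_⟩
  intro n m hn hm2 hm h1 h2 α ζ t k y ht hy hd
  suffices h : ∀ k (y : Aug n), Function.Injective y.pos → p ^ k ≤ Ex (astep n m) (k * t) (fun z =>
      if dist2 α ζ z ≤ max (K ^ 2 * t) (dist2 α ζ y - k * (C ^ 2 * t)) then (1 : ℝ) else 0) y by
    refine (h k y hy).trans (Ex_mono _ (fun z => ?_) _ _)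
    have h3 : dist2 α ζ y - k * (C ^ 2 * t) ≤ K ^ 2 * t := by
      have : 400 * ((k : ℝ) * t) ≤ C ^ 2 * (k * t) :=
        mul_le_mul_of_nonneg_right (by nlinarith) (by positivity)
      have : 0 ≤ K ^ 2 * t := by positivity
      linarith
    rw [max_eq_left h3]
  intro k
  induction k with
  | zero => intro y _; simp
  | succ k ih =>
    intro y hy
    rw [show (k + 1) * t = t + k * t by ring, Ex_add_time]
    have h3 := hN n m hn hm2 hm h1 h2 α ζ t y ht hy
    have h4 : Ex (astep n m) t (fun z => p ^ k * (if dist2 α ζ z ≤ max (K ^ 2 * t)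
        (dist2 α ζ y - C ^ 2 * t) then (1 : ℝ) else 0)) y ≤
        Ex (astep n m) t (Ex (astep n m) (k * t) (fun z => if dist2 α ζ z ≤
          max (K ^ 2 * t) (dist2 α ζ y - (k + 1 : ℕ) * (C ^ 2 * t)) then (1 : ℝ) else 0)) y := by
      apply Ex_mono_inv (I := fun z => Function.Injective z.pos) _
        (fun z hz c => step_injective hz) _ _ hy
      intro z hz
      split_ifs with hd
      · rw [mul_one]
        refine (ih z hz).trans (Ex_mono _ (fun z' => ?_) _ _)
        have h5 : max (K ^ 2 * t) (dist2 α ζ z - k * (C ^ 2 * t)) ≤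
            max (K ^ 2 * t) (dist2 α ζ y - (k + 1 : ℕ) * (C ^ 2 * t)) := by
          apply max_le (le_max_left _ _)
          rcases le_max_iff.1 hd with h | h
          · apply le_max_of_le_left
            have : 0 ≤ k * (C ^ 2 * t) := by positivity
            linarith
          · apply le_max_of_le_right
            push_cast; linarith
        by_cases h6 : dist2 α ζ z' ≤ max (K ^ 2 * t) (dist2 α ζ z - k * (C ^ 2 * t))
        · rw [if_pos h6, if_pos (h6.trans h5)]
        · rw [if_neg h6]; split_ifs <;> norm_num
      · rw [mul_zero]
        exact Ex_nonneg _ (fun z => by split_ifs <;> norm_num) _ _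
    rw [Ex_mul] at h4
    calc p ^ (k + 1) = p ^ k * p := pow_succ _ _
      _ ≤ _ := mul_le_mul_of_nonneg_left h3 (by positivity)
      _ ≤ _ := h4

end Steering
end OverlappingCycles

/-! ### Dynamics killed outside a set of good states -/

namespace OverlappingCycles

open Finset

section Killed

variable {ι σ : Type*} [Fintype ι] (st : ι → σ → σ) (Good : σ → Prop)

open Classical in
/-- The expectation of `F` after `t` steps of the dynamics killed outside `Good`. -/
noncomputable def Kil : ℕ → (σ → ℝ) → σ → ℝ
  | 0, F => F
  | t + 1, F => fun y => if Good y then avg st (Kil t F) y else 0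

open Classical in
/-- The expected reward in `t` steps of the dynamics killed outside `Good`. -/
noncomputable def rew (w : σ → ℝ) : ℕ → σ → ℝ
  | 0 => fun _ => 0
  | t + 1 => fun y => if Good y then w y + avg st (rew w t) y else 0

/-- The probability to survive `t` steps of the dynamics killed outside `Good`. -/
noncomputable def surv (t : ℕ) : σ → ℝ := Kil st Good t fun _ => 1

variable {st Good}

theorem surv_zero (y : σ) : surv st Good 0 y = 1 := rfl

theorem surv_succ (t : ℕ) {y : σ} (h : Good y) :
    surv st Good (t + 1) y = avg st (surv st Good t) y := by
  unfold surv; rw [Kil]; exact if_pos h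

theorem surv_succ_of_not (t : ℕ) {y : σ} (h : ¬ Good y) : surv st Good (t + 1) y = 0 := by
  unfold surv; rw [Kil]; exact if_neg h

theorem rew_succ (w : σ → ℝ) (t : ℕ) {y : σ} (h : Good y) :
    rew st Good w (t + 1) y = w y + avg st (rew st Good w t) y := by rw [rew]; exact if_pos h

theorem rew_succ_of_not (w : σ → ℝ) (t : ℕ) {y : σ} (h : ¬ Good y) :
    rew st Good w (t + 1) y = 0 := by rw [rew]; exact if_neg h

theorem Kil_mono {F G : σ → ℝ} (h : ∀ y, F y ≤ G y) (t : ℕ) (y : σ) :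
    Kil st Good t F y ≤ Kil st Good t G y := by
  induction t generalizing y with
  | zero => exact h y
  | succ t ih =>
    rw [Kil, Kil]
    dsimp only
    split_ifs
    · exact avg_mono _ _ fun i => ih _
    · exact le_rfl

theorem Kil_sub (F G : σ → ℝ) (t : ℕ) (y : σ) :
    Kil st Good t (fun z => F z - G z) y = Kil st Good t F y - Kil st Good t G y := by
  induction t generalizing y with
  | zero => rfl
  | succ t ih =>
    rw [Kil, Kil, Kil]
    dsimp only
    split_ifs
    · rw [← avg_sub]; exact avg_congr _ _ fun i => ih _
    · ring

theorem Kil_mul (a : ℝ) (F : σ → ℝ) (t : ℕ) (y : σ) :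
    Kil st Good t (fun z => a * F z) y = a * Kil st Good t F y := by
  induction t generalizing y with
  | zero => rfl
  | succ t ih =>
    rw [Kil, Kil]
    dsimp only
    split_ifs
    · rw [← avg_mul]; exact avg_congr _ _ fun i => ih _
    · ring

theorem Kil_add_time (F : σ → ℝ) (s t : ℕ) (y : σ) :
    Kil st Good (s + t) F y = Kil st Good s (Kil st Good t F) y := by
  induction s generalizing y with
  | zero => simp [Kil]
  | succ s ih =>
    rw [show s + 1 + t = s + t + 1 by omega, Kil, Kil]
    dsimp only
    split_ifs
    · exact avg_congr _ _ fun i => ih _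
    · rfl

theorem rew_add_time (w : σ → ℝ) (s t : ℕ) (y : σ) :
    rew st Good w (s + t) y = rew st Good w s y + Kil st Good s (rew st Good w t) y := by
  induction s generalizing y with
  | zero => simp [rew, Kil]
  | succ s ih =>
    rw [show s + 1 + t = s + t + 1 by omega, rew, rew, Kil]
    dsimp only
    split_ifs
    · rw [add_assoc, ← avg_add]
      congr 1
      exact avg_congr _ _ fun i => ih _
    · simp

theorem rew_le {I : σ → Prop} (hI : ∀ y, Good y → ∀ i, I (st i y)) {w f : σ → ℝ}
    (hf : ∀ y, I y → 0 ≤ f y) (h : ∀ y, I y → Good y → w y + avg st f y ≤ f y) (t : ℕ) {y : σ}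
    (hy : I y) : rew st Good w t y ≤ f y := by
  induction t generalizing y with
  | zero => exact hf y hy
  | succ t ih =>
    by_cases hg : Good y
    · rw [rew_succ w t hg]
      have := avg_mono st y (F := rew st Good w t) (G := f) fun i => ih (hI y hg i)
      linarith [h y hy hg]
    · rw [rew_succ_of_not w t hg]; exact hf y hy

variable [Nonempty ι]

theorem surv_nonneg (t : ℕ) (y : σ) : 0 ≤ surv st Good t y := by
  induction t generalizing y with
  | zero => rw [surv_zero]; norm_num
  | succ t ih =>
    by_cases h : Good y
    · rw [surv_succ t h, ← avg_const st 0 y]; exact avg_mono _ _ fun i => ih _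
    · rw [surv_succ_of_not t h]

theorem surv_le_one (t : ℕ) (y : σ) : surv st Good t y ≤ 1 := by
  induction t generalizing y with
  | zero => rw [surv_zero]
  | succ t ih =>
    by_cases h : Good y
    · rw [surv_succ t h, ← avg_const st 1 y]; exact avg_mono _ _ fun i => ih _
    · rw [surv_succ_of_not t h]; norm_num

theorem surv_anti {s t : ℕ} (h : s ≤ t) (y : σ) : surv st Good t y ≤ surv st Good s y := by
  obtain ⟨u, rfl⟩ := Nat.exists_eq_add_of_le h
  unfold surv
  rw [Kil_add_time]
  exact Kil_mono (fun y => surv_le_one u y) s y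

/-- Killing happens at most once, and the reward lost after it is at most `B`. -/
theorem Tot_le_rew {w : σ → ℝ} {B : ℝ} {L : ℕ} (hB : ∀ s ≤ L, ∀ y, Tot st s w y ≤ B)
    {t : ℕ} (ht : t ≤ L) (y : σ) :
    Tot st t w y ≤ rew st Good w t y + B * (1 - surv st Good t y) := by
  induction t generalizing y with
  | zero => simp [rew, surv_zero]
  | succ t ih =>
    by_cases hg : Good y
    · rw [rew_succ w t hg, surv_succ t hg, Tot_succ]
      have h1 := avg_mono st y (F := Tot st t w)
        (G := fun z => rew st Good w t z + B * (1 - surv st Good t z)) fun i => ih (by omega) _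
      rw [avg_add, avg_mul, avg_sub, avg_const] at h1
      linarith
    · rw [rew_succ_of_not w t hg, surv_succ_of_not t hg]
      linarith [hB (t + 1) ht y]

/-- A path that survives `N` blocks has collected about `w₀` in each of them. The loss `B` is
charged once, at the death, and so carries the weight `1 - surv`. -/
theorem surv_mul_le {w : σ → ℝ} {B w₀ : ℝ} (hw₀ : 0 ≤ w₀) {L : ℕ} (hL : 0 < L)
    (hB : ∀ s ≤ L, ∀ y, Tot st s w y ≤ B) (hw : ∀ y, Good y → w₀ ≤ Tot st L w y)
    (N : ℕ) (y : σ) : w₀ * N * surv st Good (N * L) y - B * (1 - surv st Good (N * L) y) ≤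
      rew st Good w (N * L) y := by
  have hB0 : 0 ≤ B := by simpa using hB 0 (Nat.zero_le _) y
  induction N generalizing y with
  | zero => simp [surv_zero, rew]
  | succ N ih =>
    rw [show (N + 1) * L = L + N * L by ring]
    by_cases hg : Good y
    · rw [rew_add_time]
      have e : surv st Good (L + N * L) y = Kil st Good L (surv st Good (N * L)) y := by
        unfold surv; rw [Kil_add_time]
      have h1 := Kil_mono (st := st) (Good := Good) ih L y
      have e2 : (fun y => w₀ * N * surv st Good (N * L) y - B * (1 - surv st Good (N * L) y)) =
          fun y => w₀ * N * surv st Good (N * L) y - B * ((fun y => 1 - surv st Good (N * L) y) y) :=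
        rfl
      rw [e2, Kil_sub, Kil_mul, Kil_mul, Kil_sub, ← e] at h1
      have h2 := Tot_le_rew (Good := Good) hB le_rfl y
      have h3 := hw y hg
      have e3 : Kil st Good L (fun _ => 1) y = surv st Good L y := rfl
      rw [e3] at h1
      have h4 := surv_le_one (st := st) (Good := Good) (L + N * L) y
      push_cast
      nlinarith
    · obtain ⟨t, ht⟩ : ∃ t, L + N * L = t + 1 := ⟨L + N * L - 1, by omega⟩
      rw [ht, surv_succ_of_not t hg, rew_succ_of_not w t hg]
      linarith

/-- The potential `f` pays for all rewards, so the total reward is at most `f y`, while survival for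
`N` blocks brings `w₀ N`. For a bounded martingale with `f` concave this bounds the tail of the exit
time. -/
theorem surv_le {I : σ → Prop} (hI : ∀ y, Good y → ∀ i, I (st i y)) {w f : σ → ℝ}
    (hf : ∀ y, I y → 0 ≤ f y) (h : ∀ y, I y → Good y → w y + avg st f y ≤ f y)
    {B w₀ : ℝ} (hw₀ : 0 < w₀) {L : ℕ} (hL : 0 < L)
    (hB : ∀ s ≤ L, ∀ y, Tot st s w y ≤ B) (hw : ∀ y, Good y → w₀ ≤ Tot st L w y)
    {N t : ℕ} (hN : 0 < N) (ht : N * L ≤ t) {y : σ} (hy : I y) :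
    surv st Good t y ≤ (f y + B) / (w₀ * N) := by
  have hN' : (0 : ℝ) < N := by exact_mod_cast hN
  have hB0 : 0 ≤ B := by simpa using hB 0 (Nat.zero_le _) y
  refine (surv_anti ht y).trans ?_
  rw [le_div_iff₀ (by positivity)]
  have h1 := surv_mul_le hw₀.le hL hB hw N y
  have h2 := rew_le hI hf h (N * L) hy
  have := mul_nonneg hB0 (surv_nonneg (st := st) (Good := Good) (N * L) y)
  linarith

/-- Optional stopping at the first bad state: there `W` is below the potential `Φ`, which does not
increase in mean; the paths that never meet a bad state contribute at most their probability. -/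
theorem le_potential_add_surv {I : σ → Prop} (hI : ∀ y, Good y → ∀ i, I (st i y))
    {W Φ : ℕ → σ → ℝ} (h0 : ∀ y, W 0 y ≤ 1) (hΦ0 : ∀ y, I y → 0 ≤ Φ 0 y)
    (hW : ∀ t y, I y → Good y → W (t + 1) y ≤ avg st (W t) y)
    (hΦ : ∀ t y, I y → Good y → avg st (Φ t) y ≤ Φ (t + 1) y)
    (hbad : ∀ t y, I y → ¬ Good y → W t y ≤ Φ t y) (t : ℕ) {y : σ} (hy : I y) :
    W t y ≤ Φ t y + surv st Good t y := by
  induction t generalizing y with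
  | zero => rw [surv_zero]; linarith [h0 y, hΦ0 y hy]
  | succ t ih =>
    by_cases hg : Good y
    · rw [surv_succ t hg]
      have h1 := avg_mono st y (F := W t) (G := fun z => Φ t z + surv st Good t z)
        fun i => ih (hI y hg i)
      rw [avg_add] at h1
      linarith [hW t y hy hg, hΦ t y hy hg]
    · linarith [hbad (t + 1) y hy hg, surv_nonneg (st := st) (Good := Good) (t + 1) y]

end Killed

/-! ### Dynamics with one coin fixed in advance -/

section Forced

variable {σ : Type*} (st : Bool → σ → σ)

/-- The value of `Φ` if the coin in the step number `s` from now is `ζ`. -/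
noncomputable def Force (ζ : Bool) (Φ : ℕ → σ → ℝ) : ℕ → ℕ → σ → ℝ
  | _, 0 => Φ 0
  | 0, t + 1 => fun x => Φ t (st ζ x)
  | s + 1, t + 1 => avg st (Force ζ Φ s t)

theorem Force_avg_le {Φ : ℕ → σ → ℝ} (h : ∀ t x, avg st (Φ t) x ≤ Φ (t + 1) x) (s t : ℕ) (x : σ) :
    (Force st true Φ s t x + Force st false Φ s t x) / 2 ≤ Φ t x := by
  induction t generalizing s x with
  | zero => cases s <;> simp [Force]
  | succ t ih =>
    cases s with
    | zero => have := h t x; rw [avg_bool] at this; simpa [Force] using this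
    | succ s =>
      refine le_trans ?_ (h t x)
      have h1 := ih s (st true x)
      have h2 := ih s (st false x)
      simp only [Force, avg_bool]
      linarith

theorem Force_nonneg {Φ : ℕ → σ → ℝ} (h : ∀ t x, 0 ≤ Φ t x) (ζ : Bool) (s t : ℕ) (x : σ) :
    0 ≤ Force st ζ Φ s t x := by
  induction t generalizing s x with
  | zero => cases s <;> simp [Force, h]
  | succ t ih =>
    cases s with
    | zero => simp [Force, h]
    | succ s =>
      have h1 := ih s (st true x)
      have h2 := ih s (st false x)
      simp only [Force, avg_bool]
      linarith

/-- After the forced coin, which is used within `s + 1` rounds, the dynamics is free again and has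
`L` rounds to earn the reward. Nothing is lost before, as `F` is nonnegative. -/
theorem le_sum_Force {I : σ → Prop} (hI : ∀ x, I x → ∀ c, I (st c x)) {F : σ → ℝ}
    (hF : ∀ x, 0 ≤ F x) {L : ℕ} {w : ℝ} (hw : ∀ x, I x → w ≤ Tot st L F x) (ζ : Bool) (s : ℕ)
    {x : σ} (hx : I x) :
    w ≤ ∑ u ∈ range (L + s + 1), Force st ζ (fun t => Ex st t F) s u x := by
  induction s generalizing x with
  | zero =>
    rw [Finset.sum_range_succ']
    have := hw _ (hI x hx ζ)
    simp only [Force, Ex_zero]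
    unfold Tot at this
    linarith [hF x]
  | succ s ih =>
    rw [show L + (s + 1) + 1 = L + s + 1 + 1 by ring, Finset.sum_range_succ']
    have h1 := ih (hI x hx true)
    have h2 := ih (hI x hx false)
    have e : ∑ u ∈ range (L + s + 1), Force st ζ (fun t => Ex st t F) (s + 1) (u + 1) x =
        (∑ u ∈ range (L + s + 1), Force st ζ (fun t => Ex st t F) s u (st true x) +
        ∑ u ∈ range (L + s + 1), Force st ζ (fun t => Ex st t F) s u (st false x)) / 2 := by
      rw [← Finset.sum_add_distrib, Finset.sum_div]
      exact Finset.sum_congr rfl fun u _ => by simp only [Force, avg_bool]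
    rw [e]
    simp only [Force, Ex_zero]
    linarith [hF x]

end Forced

/-! ### The lattice of displacements -/

/-- `d` is the displacement with the parameters `α` and `Z`. -/
def Lat (n m : ℕ) (α Z d : ℤ) : Prop :=
  ∃ V : ℤ, (V - Z) % 2 = 0 ∧ d = α - n * V - (n - m) * Z

/-- In the coordinate `g`, `y` is obtained from `x` by a shift by `t` and a displacement of size at
most `ρ`. -/
def Near (n m : ℕ) (t : ℤ) (ρ : ℝ) (x y : Fin n) : Prop :=
  ∃ α Z : ℤ, Lat n m α Z (g n m y - g n m x - t) ∧ |(α : ℝ)| ≤ ρ ∧ |(Z : ℝ)| * √(n : ℝ) ≤ ρ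

section Lattice

variable {n m : ℕ}

theorem Lat.add {α Z d α' Z' d' : ℤ} (h : Lat n m α Z d) (h' : Lat n m α' Z' d') :
    Lat n m (α + α') (Z + Z') (d + d') := by
  obtain ⟨V, h1, h2⟩ := h
  obtain ⟨V', h1', h2'⟩ := h'
  exact ⟨V + V', by omega, by rw [h2, h2']; ring⟩

theorem Lat.neg {α Z d : ℤ} (h : Lat n m α Z d) : Lat n m (-α) (-Z) (-d) := by
  obtain ⟨V, h1, h2⟩ := h
  exact ⟨-V, by omega, by rw [h2]; ring⟩

theorem Lat.sub {α Z d α' Z' d' : ℤ} (h : Lat n m α Z d) (h' : Lat n m α' Z' d') :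
    Lat n m (α - α') (Z - Z') (d - d') := by
  simpa only [sub_eq_add_neg] using h.add h'.neg

theorem lat_self (α : ℤ) : Lat n m α 0 α := ⟨0, by simp, by ring⟩

/-- If `Z = 0` then `V` is even, so the displacement is `α` modulo `2 n`, while values of `g` differ
by less than `2 n`. This is how agreement of `Z` turns into a distance on the line. -/
theorem Lat.eq_of_zero {α d : ℤ} (h : Lat n m α 0 d) (h' : |d - α| < 2 * n) : d = α := by
  obtain ⟨V, h1, h2⟩ := h
  obtain ⟨k, hk⟩ : ∃ k, V = 2 * k := ⟨V / 2, by omega⟩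
  subst hk
  have e : d - α = -(2 * n * k) := by rw [h2]; ring
  rw [e, abs_neg, abs_mul, abs_of_nonneg (by positivity : (0 : ℤ) ≤ 2 * n)] at h'
  have hn : (0 : ℤ) ≤ 2 * n := by positivity
  have : |k| < 1 := by
    by_contra hk
    push Not at hk
    nlinarith
  rw [Int.abs_lt_one_iff] at this
  subst this
  linarith

/-- A visit contributes `V = 1` and `Z = ± 1`, whence the parity condition; its jump minus the drift
is `-n - (n - m) Z`. -/
theorem lat_round (hm2 : 2 ≤ m) (hm : m < n) (c : Bool) (x : Fin n) :
    Lat n m (if g n m x < 0 then sg c else 0) (if g n m x = m then sg c else 0)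
      (g n m (round n m c x) - g n m x - 1) := by
  have h1 := g_le (m := m) x
  refine ⟨if g n m x = m then 1 else 0, ?_, ?_⟩
  · cases c <;> simp only [sg] <;> split_ifs <;> simp at *
  · rw [g_round hm2 hm]
    by_cases h2 : g n m x < 0
    · rw [if_pos h2, if_pos h2, if_neg (by omega), if_neg (by omega)]; ring
    · by_cases h3 : g n m x < m
      · rw [if_neg h2, if_neg h2, if_pos h3, if_neg (by omega), if_neg (by omega)]; ring
      · have h4 : g n m x = m := by omega
        rw [if_neg h2, if_neg h2, if_neg h3, if_pos h4, if_pos h4, h4]; ring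

theorem Near.mono {t : ℤ} {ρ ρ' : ℝ} {x y : Fin n} (h : Near n m t ρ x y) (h' : ρ ≤ ρ') :
    Near n m t ρ' x y := by
  obtain ⟨α, Z, h1, h2, h3⟩ := h
  exact ⟨α, Z, h1, h2.trans h', h3.trans h'⟩

theorem Near.trans {s t : ℤ} {ρ ρ' : ℝ} {x y z : Fin n} (h : Near n m s ρ x y)
    (h' : Near n m t ρ' y z) : Near n m (s + t) (ρ + ρ') x z := by
  obtain ⟨α, Z, h1, h2, h3⟩ := h
  obtain ⟨α', Z', h1', h2', h3'⟩ := h'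
  refine ⟨α + α', Z + Z', ?_, ?_, ?_⟩
  · convert h1.add h1' using 1; ring
  · push_cast; exact (abs_add_le _ _).trans (add_le_add h2 h2')
  · push_cast
    calc _ ≤ (|(Z : ℝ)| + |(Z' : ℝ)|) * √(n : ℝ) :=
          mul_le_mul_of_nonneg_right (abs_add_le _ _) (Real.sqrt_nonneg _)
      _ ≤ _ := by rw [add_mul]; exact add_le_add h3 h3'

theorem Near.symm {t : ℤ} {ρ : ℝ} {x y : Fin n} (h : Near n m t ρ x y) : Near n m (-t) ρ y x := by
  obtain ⟨α, Z, h1, h2, h3⟩ := h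
  refine ⟨-α, -Z, ?_, ?_, ?_⟩
  · convert h1.neg using 1; ring
  · push_cast; rwa [abs_neg]
  · push_cast; rwa [abs_neg]

/-- On the front and on the back the reflection is `-g` plus a constant. The two constants differ by
`2 n - m + 1`, which is a displacement with `α` and `Z` in `{1, -1}`; hence the extra `√n + 1`. -/
theorem near_sig (hm2 : 2 ≤ m) (hm : m < n) {t : ℤ} {ρ : ℝ} {x y : Fin n}
    (h : Near n m (-t) ρ x y) : Near n m t (ρ + √(n : ℝ) + 1) (sig n m x) (sig n m y) := by
  obtain ⟨α, Z, h1, h2, h3⟩ := h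
  have key : ∀ e : ℤ, |e| ≤ 1 →
      g n m (sig n m y) - g n m (sig n m x) - t = -(g n m y - g n m x + t) + e * (2 * n - m + 1) →
      Near n m t (ρ + √(n : ℝ) + 1) (sig n m x) (sig n m y) := by
    intro e he h4
    have h5 : Lat n m e (-e) (e * (2 * n - m + 1)) := ⟨-e, by omega, by ring⟩
    have he' : |(e : ℝ)| ≤ 1 := by exact_mod_cast he
    have hs := Real.sqrt_nonneg (n : ℝ)
    refine ⟨-α + e, -Z + -e, ?_, ?_, ?_⟩
    · rw [h4]
      have := h1.neg.add h5
      rwa [sub_neg_eq_add] at this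
    · push_cast
      have := abs_add_le (-(α : ℝ)) e
      rw [abs_neg] at this
      linarith
    · push_cast
      have := abs_add_le (-(Z : ℝ)) (-e)
      rw [abs_neg, abs_neg] at this
      nlinarith
  rw [g_sig _ hm2 hm, g_sig _ hm2 hm] at key
  by_cases hx : g n m x < 0 <;> by_cases hy : g n m y < 0 <;> simp only [hx, hy, if_true, if_false] at key
  · exact key 0 (by simp) (by ring)
  · exact key 1 (by simp) (by ring)
  · exact key (-1) (by simp) (by ring)
  · exact key 0 (by simp) (by ring)

/-- The accumulated displacements of `y` lead from the positions `x` to the current ones. -/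
def Cons (n m : ℕ) (x : Fin 3 → Fin n) (t : ℤ) (y : Aug n) : Prop :=
  ∀ a, Lat n m (y.A a) (y.Z a) (g n m (y.pos a) - g n m (x a) - t)

theorem Cons.step (hm2 : 2 ≤ m) (hm : m < n) {x : Fin 3 → Fin n} {t : ℤ} {y : Aug n}
    (h : Cons n m x t y) (c : Bool) : Cons n m x (t + 1) (astep n m c y) := by
  intro a
  have := (h a).add (lat_round hm2 hm c (y.pos a))
  have e : g n m ((astep n m c y).pos a) - g n m (x a) - (t + 1) = g n m (y.pos a) - g n m (x a) - t +
      (g n m (round n m c (y.pos a)) - g n m (y.pos a) - 1) := by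
    change g n m (round n m c (y.pos a)) - g n m (x a) - (t + 1) = _
    ring
  rw [e]
  exact this

theorem cons_start (x : Fin 3 → Fin n) : Cons n m x 0 ⟨x, 0, 0⟩ := by
  intro a; simpa using lat_self (n := n) (m := m) 0

/-- A bound for the probability that a displacement exceeds `ρ` within `t` rounds. -/
noncomputable def Psi (n m : ℕ) (ρ : ℝ) (t : ℕ) (y : Aug n) : ℝ :=
  ∑ a, ((y.A a : ℝ) ^ 2 + t + n * ((y.Z a : ℝ) ^ 2 + vb n m t (y.pos a))) / ρ ^ 2

theorem Psi_nonneg (ρ : ℝ) (t : ℕ) (y : Aug n) : 0 ≤ Psi n m ρ t y := by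
  refine Finset.sum_nonneg fun a _ => ?_
  have := vb_nonneg (m := m) t (y.pos a)
  positivity

/-- Chebyshev's inequality in the form of a supermartingale, so that it also applies at a stopping
time: `A ^ 2` grows in mean by at most 1 per round and `Z ^ 2` by 1 per visit. -/
theorem avg_Psi_le (hm2 : 2 ≤ m) (hm : m < n) (ρ : ℝ) (t : ℕ) (y : Aug n) :
    avg (astep n m) (Psi n m ρ t) y ≤ Psi n m ρ (t + 1) y := by
  unfold Psi
  rw [avg_sum]
  apply Finset.sum_le_sum
  intro a _
  have h1 := Ex_A_sq (m := m) a 0 1 y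
  have h2 : avg (astep n m) (fun z => (z.Z a : ℝ) ^ 2 + vb n m t (z.pos a)) y ≤
      (y.Z a : ℝ) ^ 2 + vb n m (t + 1) (y.pos a) := by
    rw [avg_bool]
    have h1 := vb_step hm2 hm t true a y.pos
    have h2 := vb_step hm2 hm t false a y.pos
    by_cases h : g n m (y.pos a) = m <;> simp [astep, sg, vis, h] at * <;> nlinarith
  rw [Ex_succ] at h1
  simp only [sub_zero, Nat.cast_one] at h1
  have e : avg (astep n m) (fun y => ((y.A a : ℝ) ^ 2 + t +
      n * ((y.Z a : ℝ) ^ 2 + vb n m t (y.pos a))) / ρ ^ 2) y =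
      (avg (astep n m) (fun y => (y.A a : ℝ) ^ 2) y + t +
      n * avg (astep n m) (fun z => (z.Z a : ℝ) ^ 2 + vb n m t (z.pos a)) y) / ρ ^ 2 := by
    simp only [avg_bool]; ring
  rw [e]
  apply div_le_div_of_nonneg_right _ (by positivity)
  have h3 := mul_le_mul_of_nonneg_left h2 (by positivity : (0 : ℝ) ≤ n)
  have h4 : avg (astep n m) (fun y => (y.A a : ℝ) ^ 2) y ≤ (y.A a : ℝ) ^ 2 + 1 := h1
  push_cast
  linarith

theorem one_le_Psi {ρ : ℝ} (hρ : 0 < ρ) (t : ℕ) (y : Aug n) (a : Fin 3)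
    (h : ρ < |(y.A a : ℝ)| ∨ ρ < |(y.Z a : ℝ)| * √(n : ℝ)) : 1 ≤ Psi n m ρ t y := by
  have hterm : ∀ b, 0 ≤ ((y.A b : ℝ) ^ 2 + t + n * ((y.Z b : ℝ) ^ 2 + vb n m t (y.pos b))) / ρ ^ 2 := by
    intro b
    have := vb_nonneg (m := m) t (y.pos b)
    positivity
  refine le_trans ?_ (Finset.single_le_sum (fun b _ => hterm b) (Finset.mem_univ a))
  rw [le_div_iff₀ (by positivity), one_mul]
  have h0 := vb_nonneg (m := m) t (y.pos a)
  have ht : (0 : ℝ) ≤ t := by positivity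
  have h1 : 0 ≤ (n : ℝ) * vb n m t (y.pos a) := by positivity
  have h2 : 0 ≤ (n : ℝ) * (y.Z a : ℝ) ^ 2 := by positivity
  rcases h with h | h
  · have : ρ ^ 2 ≤ (y.A a : ℝ) ^ 2 := by rw [← sq_abs (y.A a : ℝ)]; gcongr
    linarith
  · have : ρ ^ 2 ≤ n * (y.Z a : ℝ) ^ 2 := by
      have e : (n : ℝ) * (y.Z a : ℝ) ^ 2 = (|(y.Z a : ℝ)| * √(n : ℝ)) ^ 2 := by
        rw [mul_pow, sq_abs, Real.sq_sqrt (by positivity)]; ring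
      rw [e]; gcongr
    nlinarith [sq_nonneg (y.A a : ℝ)]

end Lattice
end OverlappingCycles

/-! ### The mirror coupling of two decks that differ in one card -/

namespace OverlappingCycles

open Finset

/-- The state of a coupling of two decks which differ in the position of one card: the first deck
`y`, the second deck `x`, and, while one of the two copies of the card has made its choice at
position `m` and the other one has not, the coins which the two decks are to exchange and the number
of rounds until then. -/
@[ext] structure Cpl (n : ℕ) where
  y : Aug n
  x : Fin 3 → Fin n
  pend : Option (Bool × Bool × ℕ)

section Coupling

variable {n m : ℕ} {a : Fin 3}

theorem g_round_neg (hm2 : 2 ≤ m) (hm : m < n) {c : Bool} {x : Fin n} (h : g n m x < 0) :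
    g n m (round n m c x) = g n m x + 1 + sg c := by rw [g_round hm2 hm, if_pos h]

theorem g_round_mid (hm2 : 2 ≤ m) (hm : m < n) {c : Bool} {x : Fin n} (h : 0 < g n m x)
    (h' : g n m x < m) : g n m (round n m c x) = g n m x + 1 := by
  rw [g_round hm2 hm, if_neg (by omega), if_pos h']

theorem g_round_top (hm2 : 2 ≤ m) (hm : m < n) {c : Bool} {x : Fin n} (h : g n m x = m) :
    g n m (round n m c x) = if c then 1 else 2 * (m : ℤ) + 1 - 2 * n := by
  rw [g_round hm2 hm, if_neg (by omega), if_neg (by omega)]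
  cases c <;> simp [sg]
  ring

theorem astep_pos (c : Bool) (y : Aug n) (b : Fin 3) :
    (astep n m c y).pos b = round n m c (y.pos b) := rfl

theorem step_apply (c : Bool) (x : Fin 3 → Fin n) (b : Fin 3) :
    step n m c x b = round n m c (x b) := rfl

theorem sg_cases (c : Bool) : sg c = 1 ∨ sg c = -1 := by cases c <;> simp [sg]

/-- Both copies of card `a` are beyond position `m`, and the other cards do not use the coin. -/
def Mir (n m : ℕ) (a : Fin 3) (q : Cpl n) : Prop :=
  g n m (q.y.pos a) < 0 ∧ g n m (q.x a) < 0 ∧ ∀ b, b ≠ a → 0 < g n m (q.y.pos b) ∧ g n m (q.y.pos b) < m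

open Classical in
/-- One round of the coupling. -/
noncomputable def cstep (n m : ℕ) (a : Fin 3) (b : Bool × Bool) (q : Cpl n) : Cpl n :=
  match q.pend with
  | some (ζ, χ, 0) => ⟨astep n m χ q.y, step n m ζ q.x, none⟩
  | some (ζ, χ, s + 1) => ⟨astep n m b.1 q.y, step n m b.1 q.x, some (ζ, χ, s)⟩
  | none =>
    if q.y.pos = q.x then ⟨astep n m b.1 q.y, step n m b.1 q.x, none⟩
    else if g n m (q.y.pos a) = m then
      ⟨astep n m b.1 q.y, step n m b.2 q.x, some (b.1, b.2, (m - g n m (q.x a)).toNat - 1)⟩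
    else if Mir n m a q then ⟨astep n m (!b.1) q.y, step n m b.1 q.x, none⟩
    else ⟨astep n m b.1 q.y, step n m b.1 q.x, none⟩

theorem cstep_zero (b : Bool × Bool) {q : Cpl n} {ζ χ : Bool} (h : q.pend = some (ζ, χ, 0)) :
    cstep n m a b q = ⟨astep n m χ q.y, step n m ζ q.x, none⟩ := by
  unfold cstep; rw [h]

theorem cstep_succ (b : Bool × Bool) {q : Cpl n} {ζ χ : Bool} {s : ℕ}
    (h : q.pend = some (ζ, χ, s + 1)) :
    cstep n m a b q = ⟨astep n m b.1 q.y, step n m b.1 q.x, some (ζ, χ, s)⟩ := by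
  unfold cstep; rw [h]

theorem cstep_merged (b : Bool × Bool) {q : Cpl n} (h : q.pend = none) (h1 : q.y.pos = q.x) :
    cstep n m a b q = ⟨astep n m b.1 q.y, step n m b.1 q.x, none⟩ := by
  unfold cstep; rw [h]; exact if_pos h1

theorem cstep_cross (b : Bool × Bool) {q : Cpl n} (h : q.pend = none) (h1 : q.y.pos ≠ q.x)
    (h2 : g n m (q.y.pos a) = m) : cstep n m a b q =
      ⟨astep n m b.1 q.y, step n m b.2 q.x, some (b.1, b.2, (m - g n m (q.x a)).toNat - 1)⟩ := by
  unfold cstep; rw [h]; simp only [if_neg h1, if_pos h2]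

theorem cstep_mirror (b : Bool × Bool) {q : Cpl n} (h : q.pend = none) (h1 : q.y.pos ≠ q.x)
    (h2 : g n m (q.y.pos a) ≠ m) (h3 : Mir n m a q) :
    cstep n m a b q = ⟨astep n m (!b.1) q.y, step n m b.1 q.x, none⟩ := by
  unfold cstep; rw [h]; simp only [if_neg h1, if_neg h2, if_pos h3]

theorem cstep_same (b : Bool × Bool) {q : Cpl n} (h : q.pend = none) (h1 : q.y.pos ≠ q.x)
    (h2 : g n m (q.y.pos a) ≠ m) (h3 : ¬ Mir n m a q) :
    cstep n m a b q = ⟨astep n m b.1 q.y, step n m b.1 q.x, none⟩ := by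
  unfold cstep; rw [h]; simp only [if_neg h1, if_neg h2, if_neg h3]

/-- A function of the first deck and of the remaining time, given the pending coins. -/
noncomputable def my (n m : ℕ) (Φ : ℕ → Aug n → ℝ) (t : ℕ) (q : Cpl n) : ℝ :=
  match q.pend with
  | none => Φ t q.y
  | some (_, χ, s) => Force (astep n m) χ Φ s t q.y

/-- A function of the second deck and of the remaining time, given the pending coins. -/
noncomputable def mx (n m : ℕ) (Φ : ℕ → (Fin 3 → Fin n) → ℝ) (t : ℕ) (q : Cpl n) : ℝ :=
  match q.pend with
  | none => Φ t q.x
  | some (ζ, _, s) => Force (step n m) ζ Φ s t q.x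

theorem my_none {Φ : ℕ → Aug n → ℝ} {t : ℕ} {q : Cpl n} (h : q.pend = none) :
    my n m Φ t q = Φ t q.y := by unfold my; rw [h]

theorem my_some {Φ : ℕ → Aug n → ℝ} {t : ℕ} {q : Cpl n} {ζ χ : Bool} {s : ℕ}
    (h : q.pend = some (ζ, χ, s)) : my n m Φ t q = Force (astep n m) χ Φ s t q.y := by
  unfold my; rw [h]

theorem mx_none {Φ : ℕ → (Fin 3 → Fin n) → ℝ} {t : ℕ} {q : Cpl n} (h : q.pend = none) :
    mx n m Φ t q = Φ t q.x := by unfold mx; rw [h]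

theorem mx_some {Φ : ℕ → (Fin 3 → Fin n) → ℝ} {t : ℕ} {q : Cpl n} {ζ χ : Bool} {s : ℕ}
    (h : q.pend = some (ζ, χ, s)) : mx n m Φ t q = Force (step n m) ζ Φ s t q.x := by
  unfold mx; rw [h]

theorem my_zero (Φ : ℕ → Aug n → ℝ) (q : Cpl n) : my n m Φ 0 q = Φ 0 q.y := by
  rcases h : q.pend with _ | ⟨ζ, χ, s⟩
  · exact my_none h
  · rw [my_some h]; cases s <;> rfl

theorem mx_zero (Φ : ℕ → (Fin 3 → Fin n) → ℝ) (q : Cpl n) : mx n m Φ 0 q = Φ 0 q.x := by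
  rcases h : q.pend with _ | ⟨ζ, χ, s⟩
  · exact mx_none h
  · rw [mx_some h]; cases s <;> rfl

/-- Each deck alone must see fair independent coins. A pending coin has been drawn already but is
not yet seen by the deck in question, and averaging over it at the moment of drawing is
`Force_avg_le`. -/
theorem avg_my_le {Φ : ℕ → Aug n → ℝ} (hΦ : ∀ t y, avg (astep n m) (Φ t) y ≤ Φ (t + 1) y) (t : ℕ)
    (q : Cpl n) : avg (cstep n m a) (my n m Φ t) q ≤ my n m Φ (t + 1) q := by
  have h0 := hΦ t q.y
  rw [avg_bool] at h0
  rw [avg_bool_prod]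
  rcases h : q.pend with _ | ⟨ζ, χ, s⟩
  · rw [my_none h]
    by_cases h1 : q.y.pos = q.x
    · simp only [cstep_merged _ h h1, my]; linarith
    by_cases h2 : g n m (q.y.pos a) = m
    · simp only [cstep_cross _ h h1 h2, my]
      have k1 := Force_avg_le (astep n m) hΦ ((m - g n m (q.x a)).toNat - 1) t (astep n m true q.y)
      have k2 := Force_avg_le (astep n m) hΦ ((m - g n m (q.x a)).toNat - 1) t (astep n m false q.y)
      linarith
    by_cases h3 : Mir n m a q
    · simp only [cstep_mirror _ h h1 h2 h3, my, Bool.not_true, Bool.not_false]; linarith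
    · simp only [cstep_same _ h h1 h2 h3, my]; linarith
  · rw [my_some h]
    cases s with
    | zero => simp only [cstep_zero _ h, my, Force]; linarith
    | succ s => simp only [cstep_succ _ h, my, Force, avg_bool]; linarith

theorem avg_mx_le {Φ : ℕ → (Fin 3 → Fin n) → ℝ} (hΦ : ∀ t y, avg (step n m) (Φ t) y ≤ Φ (t + 1) y)
    (t : ℕ) (q : Cpl n) : avg (cstep n m a) (mx n m Φ t) q ≤ mx n m Φ (t + 1) q := by
  have h0 := hΦ t q.x
  rw [avg_bool] at h0
  rw [avg_bool_prod]
  rcases h : q.pend with _ | ⟨ζ, χ, s⟩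
  · rw [mx_none h]
    by_cases h1 : q.y.pos = q.x
    · simp only [cstep_merged _ h h1, mx]; linarith
    by_cases h2 : g n m (q.y.pos a) = m
    · simp only [cstep_cross _ h h1 h2, mx]
      have k1 := Force_avg_le (step n m) hΦ ((m - g n m (q.x a)).toNat - 1) t (step n m true q.x)
      have k2 := Force_avg_le (step n m) hΦ ((m - g n m (q.x a)).toNat - 1) t (step n m false q.x)
      linarith
    by_cases h3 : Mir n m a q
    · simp only [cstep_mirror _ h h1 h2 h3, mx]; linarith
    · simp only [cstep_same _ h h1 h2 h3, mx]; linarith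
  · rw [mx_some h]
    cases s with
    | zero => simp only [cstep_zero _ h, mx, Force]; linarith
    | succ s => simp only [cstep_succ _ h, mx, Force, avg_bool]; linarith

theorem Force_neg {σ : Type*} (st : Bool → σ → σ) (ζ : Bool) (Φ : ℕ → σ → ℝ) (s t : ℕ) (x : σ) :
    Force st ζ (fun t x => -Φ t x) s t x = -Force st ζ Φ s t x := by
  induction t generalizing s x with
  | zero => cases s <;> simp [Force]
  | succ t ih =>
    cases s with
    | zero => simp [Force]
    | succ s => simp only [Force, avg_bool, ih]; ring

/-- The inequality is applied to `F` and to `-F`. -/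
theorem Ex_cstep_y (F : Aug n → ℝ) (t : ℕ) (q : Cpl n) :
    Ex (cstep n m a) t (fun q => F q.y) q = my n m (fun t => Ex (astep n m) t F) t q := by
  have key : ∀ F : Aug n → ℝ, Ex (cstep n m a) t (fun q => F q.y) q ≤
      my n m (fun t => Ex (astep n m) t F) t q := by
    intro F
    have := Ex_le_of_inv (I := fun _ => True) (cstep n m a) (fun _ _ _ => trivial)
      (Φ := my n m (fun t => Ex (astep n m) t F))
      (fun t q _ => avg_my_le (fun t y => le_of_eq (Ex_succ _ t F y).symm) t q) t (x := q) trivial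
    refine le_trans (le_of_eq ?_) this
    congr 1; funext q; rw [my_zero]; rfl
  apply le_antisymm (key F)
  have h := key fun y => -F y
  have e1 : ∀ t y, Ex (astep n m) t (fun y => -F y) y = -Ex (astep n m) t F y := by
    intro t y
    have := Ex_mul (astep n m) t (-1) F y
    simpa using this
  have e2 : Ex (cstep n m a) t (fun q => -F q.y) q = -Ex (cstep n m a) t (fun q => F q.y) q := by
    have := Ex_mul (cstep n m a) t (-1) (fun q => F q.y) q
    simpa using this
  have e3 : my n m (fun t => Ex (astep n m) t fun y => -F y) t q =
      -my n m (fun t => Ex (astep n m) t F) t q := by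
    have : (fun t => Ex (astep n m) t fun y => -F y) = fun t y => -Ex (astep n m) t F y := by
      funext t y; exact e1 t y
    rw [this]
    rcases h : q.pend with _ | ⟨ζ, χ, s⟩
    · rw [my_none h, my_none h]
    · rw [my_some h, my_some h, Force_neg]
  rw [e2, e3] at h
  linarith

theorem Ex_cstep_x (F : (Fin 3 → Fin n) → ℝ) (t : ℕ) (q : Cpl n) :
    Ex (cstep n m a) t (fun q => F q.x) q = mx n m (fun t => Ex (step n m) t F) t q := by
  have key : ∀ F : (Fin 3 → Fin n) → ℝ, Ex (cstep n m a) t (fun q => F q.x) q ≤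
      mx n m (fun t => Ex (step n m) t F) t q := by
    intro F
    have := Ex_le_of_inv (I := fun _ => True) (cstep n m a) (fun _ _ _ => trivial)
      (Φ := mx n m (fun t => Ex (step n m) t F))
      (fun t q _ => avg_mx_le (fun t y => le_of_eq (Ex_succ _ t F y).symm) t q) t (x := q) trivial
    refine le_trans (le_of_eq ?_) this
    congr 1; funext q; rw [mx_zero]; rfl
  apply le_antisymm (key F)
  have h := key fun y => -F y
  have e1 : ∀ t y, Ex (step n m) t (fun y => -F y) y = -Ex (step n m) t F y := by
    intro t y
    have := Ex_mul (step n m) t (-1) F y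
    simpa using this
  have e2 : Ex (cstep n m a) t (fun q => -F q.x) q = -Ex (cstep n m a) t (fun q => F q.x) q := by
    have := Ex_mul (cstep n m a) t (-1) (fun q => F q.x) q
    simpa using this
  have e3 : mx n m (fun t => Ex (step n m) t fun y => -F y) t q =
      -mx n m (fun t => Ex (step n m) t F) t q := by
    have : (fun t => Ex (step n m) t fun y => -F y) = fun t y => -Ex (step n m) t F y := by
      funext t y; exact e1 t y
    rw [this]
    rcases h : q.pend with _ | ⟨ζ, χ, s⟩
    · rw [mx_none h, mx_none h]
    · rw [mx_some h, mx_some h, Force_neg]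
  rw [e2, e3] at h
  linarith

/-- The distance between the two copies of card `a`. -/
def gap (n m : ℕ) (a : Fin 3) (q : Cpl n) : ℤ :=
  match q.pend with
  | none => g n m (q.y.pos a) - g n m (q.x a)
  | some (ζ, χ, s) => if ζ then g n m (q.y.pos a) + s
      else g n m (q.y.pos a) - (2 * m + 1 - 2 * n) + s + 1 + sg χ

/-- The structure of the states of the coupling. -/
def Shape (n m : ℕ) (a : Fin 3) (q : Cpl n) : Prop :=
  match q.pend with
  | none => (∀ b, b ≠ a → q.y.pos b = q.x b) ∧ g n m (q.x a) ≤ g n m (q.y.pos a)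
  | some (ζ, χ, s) => g n m (q.x a) + s = m ∧ 0 < g n m (q.x a) ∧
      (if ζ then 1 ≤ g n m (q.y.pos a) ∧ g n m (q.y.pos a) + s < m
        else 2 * (m : ℤ) + 1 - 2 * n ≤ g n m (q.y.pos a) ∧ g n m (q.y.pos a) + 2 * s < 0) ∧
      ∀ b, b ≠ a → (q.y.pos b = q.x b ∧ 0 < g n m (q.x b) ∧ g n m (q.x b) + s < m) ∨
        (g n m (q.y.pos b) + 2 * s < 0 ∧ g n m (q.x b) + 2 * s < 0 ∧
          g n m (q.y.pos b) - sg ζ = g n m (q.x b) - sg χ)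

theorem shape_none {q : Cpl n} (h : q.pend = none) : Shape n m a q ↔
    (∀ b, b ≠ a → q.y.pos b = q.x b) ∧ g n m (q.x a) ≤ g n m (q.y.pos a) := by
  unfold Shape; rw [h]

theorem shape_some {q : Cpl n} {ζ χ : Bool} {s : ℕ} (h : q.pend = some (ζ, χ, s)) :
    Shape n m a q ↔ g n m (q.x a) + s = m ∧ 0 < g n m (q.x a) ∧
      (if ζ then 1 ≤ g n m (q.y.pos a) ∧ g n m (q.y.pos a) + s < m
        else 2 * (m : ℤ) + 1 - 2 * n ≤ g n m (q.y.pos a) ∧ g n m (q.y.pos a) + 2 * s < 0) ∧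
      ∀ b, b ≠ a → (q.y.pos b = q.x b ∧ 0 < g n m (q.x b) ∧ g n m (q.x b) + s < m) ∨
        (g n m (q.y.pos b) + 2 * s < 0 ∧ g n m (q.x b) + 2 * s < 0 ∧
          g n m (q.y.pos b) - sg ζ = g n m (q.x b) - sg χ) := by
  unfold Shape; rw [h]

theorem gap_none {q : Cpl n} (h : q.pend = none) :
    gap n m a q = g n m (q.y.pos a) - g n m (q.x a) := by unfold gap; rw [h]

theorem gap_some {q : Cpl n} {ζ χ : Bool} {s : ℕ} (h : q.pend = some (ζ, χ, s)) :
    gap n m a q = if ζ then g n m (q.y.pos a) + s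
      else g n m (q.y.pos a) - (2 * m + 1 - 2 * n) + s + 1 + sg χ := by unfold gap; rw [h]

theorem gap_nonneg {q : Cpl n} (h : Shape n m a q) : 0 ≤ gap n m a q := by
  rcases hp : q.pend with _ | ⟨ζ, χ, s⟩
  · rw [shape_none hp] at h
    rw [gap_none hp]
    omega
  · rw [shape_some hp] at h
    rw [gap_some hp]
    obtain ⟨_, _, h3, _⟩ := h
    rcases sg_cases χ with h5 | h5 <;> cases ζ <;> simp only [Bool.false_eq_true, if_true, if_false] at * <;> omega

theorem gap_step_zero (hm2 : 2 ≤ m) (hm : m < n) {q : Cpl n} {ζ χ : Bool}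
    (hp : q.pend = some (ζ, χ, 0)) (h : Shape n m a q) (b : Bool × Bool) :
    Shape n m a (cstep n m a b q) ∧ gap n m a (cstep n m a b q) = gap n m a q := by
  rw [shape_some hp] at h
  rw [gap_some hp, cstep_zero b hp, shape_none rfl, gap_none rfl]
  obtain ⟨h1, h2, h3, h4⟩ := h
  simp only [astep_pos, step_apply, Nat.cast_zero, add_zero] at *
  refine ⟨⟨?_, ?_⟩, ?_⟩
  · intro b hb
    apply g_injective (m := m)
    rcases h4 b hb with ⟨e, h5, h6⟩ | ⟨h5, h6, h7⟩
    · rw [e, g_round_mid hm2 hm h5 h6, g_round_mid hm2 hm h5 h6]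
    · rw [g_round_neg hm2 hm (by omega), g_round_neg hm2 hm (by omega)]; omega
  · rw [g_round_top hm2 hm h1]
    cases ζ <;> simp only [Bool.false_eq_true, if_true, if_false] at *
    · rw [g_round_neg hm2 hm (by omega)]; rcases sg_cases χ with h5 | h5 <;> omega
    · rw [g_round_mid hm2 hm (by omega) (by omega)]; omega
  · rw [g_round_top hm2 hm h1]
    cases ζ <;> simp only [Bool.false_eq_true, if_true, if_false] at *
    · rw [g_round_neg hm2 hm (by omega)]; ring
    · rw [g_round_mid hm2 hm (by omega) (by omega)]; ring

theorem gap_step_succ (hm2 : 2 ≤ m) (hm : m < n) {q : Cpl n} {ζ χ : Bool} {s : ℕ}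
    (hp : q.pend = some (ζ, χ, s + 1)) (h : Shape n m a q) (b : Bool × Bool) :
    Shape n m a (cstep n m a b q) ∧
      gap n m a (cstep n m a b q) = gap n m a q + if ζ then 0 else sg b.1 := by
  rw [shape_some hp] at h
  rw [gap_some hp, cstep_succ b hp, shape_some rfl, gap_some rfl]
  obtain ⟨h1, h2, h3, h4⟩ := h
  simp only [astep_pos, step_apply, Nat.cast_add, Nat.cast_one] at *
  have hs := sg_cases b.1
  rw [g_round_mid hm2 hm h2 (by omega)]
  refine ⟨⟨by omega, by omega, ?_, ?_⟩, ?_⟩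
  · cases ζ <;> simp only [Bool.false_eq_true, if_true, if_false] at *
    · rw [g_round_neg hm2 hm (by omega)]; omega
    · rw [g_round_mid hm2 hm (by omega) (by omega)]; omega
  · intro c hc
    rcases h4 c hc with ⟨e, h5, h6⟩ | ⟨h5, h6, h7⟩
    · left
      rw [e, g_round_mid hm2 hm h5 (by omega)]
      exact ⟨rfl, by omega, by omega⟩
    · right
      rw [g_round_neg hm2 hm (by omega), g_round_neg hm2 hm (by omega)]
      omega
  · cases ζ <;> simp only [Bool.false_eq_true, if_true, if_false] at *
    · rw [g_round_neg hm2 hm (by omega)]; ring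
    · rw [g_round_mid hm2 hm (by omega) (by omega)]; ring

/-- The leading copy chooses at `m` with one coin while the second deck uses another; the coins are
exchanged when the other copy arrives. So both copies make the same choice, and a card that stays
beyond `m` meanwhile uses both coins in either deck. The condition `hok` keeps the other cards away
from `m` and from the top during the wait. If the choice is Tails, the leading copy walks randomly
until then, and this changes the gap. -/
theorem gap_step_cross (hm2 : 2 ≤ m) (hm : m < n) {q : Cpl n} (hp : q.pend = none)
    (hne : q.y.pos ≠ q.x) (htop : g n m (q.y.pos a) = m) (h : Shape n m a q)
    (hgm : gap n m a q < m) (hgn : gap n m a q ≤ n - m)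
    (hok : ∀ b, b ≠ a → (0 < g n m (q.y.pos b) ∧ g n m (q.y.pos b) + gap n m a q < m) ∨
      g n m (q.y.pos b) + 2 * gap n m a q < 0) (b : Bool × Bool) :
    Shape n m a (cstep n m a b q) ∧
      gap n m a (cstep n m a b q) = gap n m a q + if b.1 then 0 else sg b.2 := by
  rw [shape_none hp] at h
  rw [gap_none hp] at *
  rw [cstep_cross b hp hne htop, shape_some rfl, gap_some rfl]
  obtain ⟨h1, h2⟩ := h
  have hd : g n m (q.x a) ≠ m := by
    intro e
    apply hne
    funext c
    by_cases hc : c = a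
    · subst hc; exact g_injective (htop.trans e.symm)
    · exact h1 c hc
  simp only [astep_pos, step_apply] at *
  have hs : (((m - g n m (q.x a)).toNat - 1 : ℕ) : ℤ) = m - g n m (q.x a) - 1 := by omega
  rw [hs, g_round_mid hm2 hm (c := b.2) (by omega) (by omega), g_round_top hm2 hm htop]
  refine ⟨⟨by omega, by omega, ?_, ?_⟩, ?_⟩
  · rcases hb : b.1 with _ | _ <;> simp only [Bool.false_eq_true, if_true, if_false] <;> omega
  · intro c hc
    have e := h1 c hc
    have h3 := hok c hc
    rw [← e]
    have s1 := sg_cases b.1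
    have s2 := sg_cases b.2
    rcases h3 with ⟨h4, h5⟩ | h5
    · left
      have e1 := g_round_mid hm2 hm (c := b.1) h4 (by omega)
      have e2 := g_round_mid hm2 hm (c := b.2) h4 (by omega)
      exact ⟨g_injective (e1.trans e2.symm), by omega, by omega⟩
    · right
      rw [g_round_neg hm2 hm (by omega), g_round_neg hm2 hm (by omega)]
      omega
  · rcases hb : b.1 with _ | _ <;> simp only [Bool.false_eq_true, if_true, if_false] <;> omega

theorem gap_step_mirror (hm2 : 2 ≤ m) (hm : m < n) {q : Cpl n} (hp : q.pend = none)
    (hne : q.y.pos ≠ q.x) (htop : g n m (q.y.pos a) ≠ m) (hmir : Mir n m a q)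
    (h : Shape n m a q) (b : Bool × Bool) :
    Shape n m a (cstep n m a b q) ∧
      gap n m a (cstep n m a b q) = gap n m a q - 2 * sg b.1 := by
  rw [shape_none hp] at h
  rw [gap_none hp, cstep_mirror b hp hne htop hmir, shape_none rfl, gap_none rfl]
  obtain ⟨h1, h2⟩ := h
  obtain ⟨h3, h4, h5⟩ := hmir
  have hd : g n m (q.x a) ≠ g n m (q.y.pos a) := by
    intro e
    apply hne
    funext c
    by_cases hc : c = a
    · subst hc; exact g_injective e.symm
    · exact h1 c hc
  -- Values beyond `m` are odd, so distinct copies are at least 2 apart and mirrored moves can make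
  -- them meet but not cross.
  have o1 := g_odd _ h3
  have o2 := g_odd _ h4
  have hs : sg (!b.1) = -sg b.1 := by cases b.1 <;> simp [sg]
  have hs' := sg_cases b.1
  simp only [astep_pos, step_apply]
  rw [g_round_neg hm2 hm h3, g_round_neg hm2 hm h4, hs]
  refine ⟨⟨?_, by omega⟩, by omega⟩
  intro c hc
  have e := h1 c hc
  obtain ⟨h6, h7⟩ := h5 c hc
  apply g_injective (m := m)
  rw [← e, g_round_mid hm2 hm h6 h7, g_round_mid hm2 hm h6 h7]

theorem gap_step_same (hm2 : 2 ≤ m) (hm : m < n) {q : Cpl n} (hp : q.pend = none)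
    (hne : q.y.pos ≠ q.x) (htop : g n m (q.y.pos a) ≠ m) (hmir : ¬ Mir n m a q)
    (h : Shape n m a q) (b : Bool × Bool) :
    Shape n m a (cstep n m a b q) ∧
      gap n m a (cstep n m a b q) = gap n m a q -
        if g n m (q.x a) < 0 ∧ 0 < g n m (q.y.pos a) then sg b.1 else 0 := by
  rw [shape_none hp] at h
  rw [gap_none hp, cstep_same b hp hne htop hmir, shape_none rfl, gap_none rfl]
  obtain ⟨h1, h2⟩ := h
  have l1 := g_le (m := m) (q.y.pos a)
  have z1 := g_ne_zero (m := m) (q.y.pos a)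
  have z2 := g_ne_zero (m := m) (q.x a)
  have hs' := sg_cases b.1
  have key : g n m (round n m b.1 (q.y.pos a)) - g n m (round n m b.1 (q.x a)) =
      g n m (q.y.pos a) - g n m (q.x a) -
        (if g n m (q.x a) < 0 ∧ 0 < g n m (q.y.pos a) then sg b.1 else 0) := by
    by_cases h3 : g n m (q.y.pos a) < 0
    · rw [g_round_neg hm2 hm h3, g_round_neg hm2 hm (by omega), if_neg (by omega)]; ring
    · rw [g_round_mid hm2 hm (by omega) (by omega)]
      by_cases h4 : g n m (q.x a) < 0
      · rw [g_round_neg hm2 hm h4, if_pos ⟨h4, by omega⟩]; ring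
      · rw [g_round_mid hm2 hm (by omega) (by omega), if_neg (by omega)]; ring
  simp only [astep_pos, step_apply]
  refine ⟨⟨fun c hc => by rw [h1 c hc], ?_⟩, key⟩
  split_ifs at key <;> omega

end Coupling
end OverlappingCycles

namespace OverlappingCycles

open Finset

section Mirror

variable {n m : ℕ} {a : Fin 3}

theorem cstep_decks (b : Bool × Bool) (q : Cpl n) : ∃ c c' : Bool,
    (cstep n m a b q).y = astep n m c q.y ∧ (cstep n m a b q).x = step n m c' q.x := by
  rcases h : q.pend with _ | ⟨ζ, χ, s⟩
  · by_cases h1 : q.y.pos = q.x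
    · rw [cstep_merged b h h1]; exact ⟨_, _, rfl, rfl⟩
    by_cases h2 : g n m (q.y.pos a) = m
    · rw [cstep_cross b h h1 h2]; exact ⟨_, _, rfl, rfl⟩
    by_cases h3 : Mir n m a q
    · rw [cstep_mirror b h h1 h2 h3]; exact ⟨_, _, rfl, rfl⟩
    · rw [cstep_same b h h1 h2 h3]; exact ⟨_, _, rfl, rfl⟩
  · cases s with
    | zero => rw [cstep_zero b h]; exact ⟨_, _, rfl, rfl⟩
    | succ s => rw [cstep_succ b h]; exact ⟨_, _, rfl, rfl⟩

/-- The cards in `y` are so close to where they are expected to be that cards which were far from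
each other in `x₀` have not met. -/
def Tame (l : ℝ) (y : Aug n) : Prop := ∀ b, |(y.A b : ℝ)| ≤ l ∧ |(y.Z b : ℝ)| * √(n : ℝ) ≤ l

/-- The invariant of the coupling. -/
def CInv (n m : ℕ) (a : Fin 3) (x₀ : Fin 3 → Fin n) (R : ℤ) (q : Cpl n) : Prop :=
  Function.Injective q.y.pos ∧ Function.Injective q.x ∧ (∃ t, Cons n m x₀ t q.y) ∧
    Shape n m a q ∧ gap n m a q ≤ R + 2

/-- The states in which the coupling goes on. -/
def CGood (n m : ℕ) (a : Fin 3) (x₀ : Fin 3 → Fin n) (l : ℝ) (R : ℤ) (q : Cpl n) : Prop :=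
  CInv n m a x₀ R q ∧ gap n m a q ≤ R ∧ (q.pend = none → q.y.pos ≠ q.x ∧ Tame l q.y)

/-- A card that could disturb a crossing is within `R` of position `m`, or within `2 R` of leaving
the back. Tracing both cards back to the start costs `2 l` more, so their starting positions would
have been near each other. -/
theorem not_near_of_tame {x₀ : Fin 3 → Fin n} {l : ℝ} {t : ℤ} {y : Aug n} (hc : Cons n m x₀ t y)
    (hy : Tame l y) (hn : √(n : ℝ) ≤ 2 * l) {R : ℤ} (hR : (R : ℝ) ≤ l) {b : Fin 3}
    (htop : g n m (y.pos a) = m) (hR0 : 0 ≤ R)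
    (h : ¬ ((0 < g n m (y.pos b) ∧ g n m (y.pos b) + R < m) ∨ g n m (y.pos b) + 2 * R < 0)) :
    Near n m 0 (4 * l) (x₀ a) (x₀ b) := by
  push Not at h
  obtain ⟨h1, h2⟩ := h
  have h3 := (hc a).sub (hc b)
  have l1 := g_le (m := m) (y.pos b)
  have z1 := g_ne_zero (m := m) (y.pos b)
  obtain ⟨a1, a2⟩ := hy a
  obtain ⟨b1, b2⟩ := hy b
  have hA : |(y.A a : ℝ) - y.A b| ≤ 2 * l := (abs_sub _ _).trans (by linarith)
  have hZ : |(y.Z a : ℝ) - y.Z b| * √(n : ℝ) ≤ 2 * l := by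
    refine (mul_le_mul_of_nonneg_right (abs_sub _ _) (Real.sqrt_nonneg _)).trans ?_
    rw [add_mul]; linarith
  by_cases h4 : 0 < g n m (y.pos b)
  · have h5 := h1 h4
    refine ⟨y.A a - y.A b - (m - g n m (y.pos b)), y.Z a - y.Z b - 0, ?_, ?_, ?_⟩
    · convert h3.sub (lat_self (n := n) (m := m) (m - g n m (y.pos b))) using 1
      rw [htop]; ring
    · have : |((m : ℤ) - g n m (y.pos b) : ℤ)| ≤ R := by rw [abs_le]; constructor <;> omega
      have h6 : |(((m : ℤ) - g n m (y.pos b) : ℤ) : ℝ)| ≤ R := by exact_mod_cast this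
      have hl0 : 0 ≤ l := (abs_nonneg _).trans a1
      push_cast at *
      exact (abs_sub _ _).trans (by linarith)
    · push_cast
      rw [sub_zero]; linarith [abs_nonneg (y.A a : ℝ)]
  -- A Heads move leads from `m` to the top, next to the last positions of the back; this is its
  -- inverse, hence `V = -1` and `Z = 1`.
  · have hl : Lat n m (-g n m (y.pos b)) 1 (m - g n m (y.pos b)) := ⟨-1, by simp, by ring⟩
    refine ⟨y.A a - y.A b - -g n m (y.pos b), y.Z a - y.Z b - 1, ?_, ?_, ?_⟩
    · convert h3.sub hl using 1
      rw [htop]; ring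
    · have : |(-g n m (y.pos b) : ℤ)| ≤ 2 * R := by rw [abs_le]; constructor <;> omega
      have h6 : |((-g n m (y.pos b) : ℤ) : ℝ)| ≤ 2 * R := by exact_mod_cast this
      push_cast at *
      exact (abs_sub _ _).trans (by linarith)
    · push_cast
      refine (mul_le_mul_of_nonneg_right (abs_sub _ _) (Real.sqrt_nonneg _)).trans ?_
      rw [add_mul, abs_one]; linarith

variable {x₀ : Fin 3 → Fin n} {l : ℝ} {R : ℤ}

/-- The gap is a martingale. If card `a` of the second deck is deep and alone, the other copy, which
is at most `R` ahead with `2 R ≤ n - m`, is also beyond `m`; then the coins are mirrored and the gap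
moves by exactly 2. -/
theorem exists_gap_incr (hm2 : 2 ≤ m) (hm : m < n) (hR : (R : ℝ) ≤ l)
    (hn : √(n : ℝ) ≤ 2 * l) (hRm : R < m) (hRn : 2 * R ≤ n - m)
    (hsep : ∀ b, b ≠ a → ¬ Near n m 0 (4 * l) (x₀ a) (x₀ b)) {q : Cpl n}
    (hq : CGood n m a x₀ l R q) : ∃ e : Bool × Bool → ℤ,
      (∀ b, Shape n m a (cstep n m a b q) ∧ gap n m a (cstep n m a b q) = gap n m a q + e b) ∧
      (∀ b, e b ≤ 2) ∧ e (true, true) + e (true, false) + e (false, true) + e (false, false) = 0 ∧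
      (Priv n m a q.x → ∀ b, e b ^ 2 = 4) := by
  obtain ⟨⟨hi, hi', ⟨t, hc⟩, hs, -⟩, hg, hgood⟩ := hq
  rcases hp : q.pend with _ | ⟨ζ, χ, s⟩
  · obtain ⟨hne, htame⟩ := hgood hp
    have hs' := (shape_none hp).1 hs
    have hg0 := gap_none (m := m) (a := a) hp
    by_cases htop : g n m (q.y.pos a) = m
    · have hg' := gap_nonneg hs
      refine ⟨fun b => if b.1 then 0 else sg b.2, gap_step_cross hm2 hm hp hne htop hs (by omega)
        (by omega) ?_, ?_, ?_, ?_⟩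
      · intro b hb
        by_contra hcon
        refine hsep b hb (not_near_of_tame hc htame hn (R := gap n m a q) ?_ htop (by omega) hcon)
        have : (gap n m a q : ℝ) ≤ R := by exact_mod_cast hg
        linarith
      · intro b
        have := sg_cases b.2
        dsimp only
        split_ifs <;> omega
      · simp [sg]
      · intro hpr
        have := hpr.1
        omega
    · by_cases hmir : Mir n m a q
      · refine ⟨fun b => -(2 * sg b.1), fun b => ?_, ?_, ?_, ?_⟩
        · rw [← sub_eq_add_neg]; exact gap_step_mirror hm2 hm hp hne htop hmir hs b
        · intro b; have := sg_cases b.1; dsimp only; omega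
        · simp [sg]
        · intro _ b
          rcases sg_cases b.1 with h | h <;> simp [h]
      · refine ⟨fun b => -(if g n m (q.x a) < 0 ∧ 0 < g n m (q.y.pos a) then sg b.1 else 0),
          fun b => ?_, ?_, ?_, ?_⟩
        · rw [← sub_eq_add_neg]; exact gap_step_same hm2 hm hp hne htop hmir hs b
        · intro b; have := sg_cases b.1; dsimp only; split_ifs <;> omega
        · split_ifs <;> simp [sg]
        · intro hpr
          refine absurd ⟨?_, ?_, fun b hb => ?_⟩ hmir
          · have := hpr.1; omega
          · have := hpr.1; omega
          · rw [hs'.1 b hb]; exact hpr.2 b hb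
  · have hs' := (shape_some hp).1 hs
    have hno : ¬ Priv n m a q.x := fun h => by have := h.1; omega
    cases s with
    | zero =>
      exact ⟨fun _ => 0, fun b => by rw [add_zero]; exact gap_step_zero hm2 hm hp hs b,
        by simp, by simp, fun h => absurd h hno⟩
    | succ s =>
      refine ⟨fun b => if ζ then 0 else sg b.1, fun b => gap_step_succ hm2 hm hp hs b, ?_, ?_,
        fun h => absurd h hno⟩
      · intro b
        have := sg_cases b.1
        dsimp only
        split_ifs <;> omega
      · cases ζ <;> simp [sg]

theorem CGood.next (hm2 : 2 ≤ m) (hm : m < n) (hR : (R : ℝ) ≤ l)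
    (hn : √(n : ℝ) ≤ 2 * l) (hRm : R < m) (hRn : 2 * R ≤ n - m)
    (hsep : ∀ b, b ≠ a → ¬ Near n m 0 (4 * l) (x₀ a) (x₀ b)) {q : Cpl n}
    (hq : CGood n m a x₀ l R q) (b : Bool × Bool) : CInv n m a x₀ R (cstep n m a b q) := by
  obtain ⟨e, h1, h2, -, -⟩ := exists_gap_incr hm2 hm hR hn hRm hRn hsep hq
  obtain ⟨⟨hi, hi', ⟨t, hc⟩, hs, -⟩, hg, -⟩ := hq
  obtain ⟨c, c', h3, h4⟩ := cstep_decks (m := m) (a := a) b q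
  refine ⟨?_, ?_, ⟨t + 1, ?_⟩, (h1 b).1, ?_⟩
  · rw [h3]; exact step_injective hi
  · rw [h4]; exact step_injective hi'
  · rw [h3]; exact hc.step hm2 hm c
  · rw [(h1 b).2]; have := h2 b; omega

theorem Ex_merged (t : ℕ) {q : Cpl n} (h : q.pend = none) (h1 : q.y.pos = q.x) :
    Ex (cstep n m a) t (fun q => if q.x = q.y.pos then (0 : ℝ) else 1) q = 0 := by
  induction t generalizing q with
  | zero => rw [Ex_zero, if_pos h1.symm]
  | succ t ih =>
    rw [Ex_succ]
    rw [avg_congr (G := fun _ => 0), avg_const]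
    intro b
    rw [cstep_merged b h h1]
    apply ih rfl
    funext c
    change round n m b.1 (q.y.pos c) = round n m b.1 (q.x c)
    rw [h1]

/-- The potential `(R + 2) gap - gap ^ 2` drops in mean by the variance of the gap, which is 4
during the private time. Blocks have length `6 n`: pending coins are settled within `m ≤ n` rounds
and `5 n` rounds supply private time. -/
theorem surv_cpl_le (hm2 : 2 ≤ m) (hm : m < n) (hR : (R : ℝ) ≤ l) (hR1 : 1 ≤ R)
    (hn : √(n : ℝ) ≤ 2 * l) (hRm : R < m) (hRn : 2 * R ≤ n - m)
    (hsep : ∀ b, b ≠ a → ¬ Near n m 0 (4 * l) (x₀ a) (x₀ b)) {c : ℝ} (hc : 0 < c)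
    (hpriv : ∀ x : Fin 3 → Fin n, Function.Injective x → c * n ≤
      Tot (step n m) (5 * n) (fun y => open Classical in if Priv n m a y then 1 else 0) x)
    {N t : ℕ} (hN : 0 < N) (ht : N * (6 * n) ≤ t) {q : Cpl n} (hq : CInv n m a x₀ R q) :
    surv (cstep n m a) (CGood n m a x₀ l R) t q ≤
      ((R + 2) * (gap n m a q : ℝ) + 24 * n) / (4 * (c * n) * N) := by
  classical
  have hn0 : (0 : ℝ) < n := by exact_mod_cast (by omega : 0 < n)
  set F : (Fin 3 → Fin n) → ℝ := fun y => if Priv n m a y then 1 else 0 with hF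
  have hF0 : ∀ y, 0 ≤ F y := fun y => by simp only [hF]; split_ifs <;> norm_num
  have hF1 : ∀ y, F y ≤ 1 := fun y => by simp only [hF]; split_ifs <;> norm_num
  set f : Cpl n → ℝ := fun q => (R + 2) * (gap n m a q : ℝ) - (gap n m a q : ℝ) ^ 2 with hf
  have hpriv' : ∀ x : Fin 3 → Fin n, Function.Injective x → c * n ≤ Tot (step n m) (5 * n) F x := by
    intro x hx
    convert hpriv x hx using 2
  have key := surv_le (st := cstep n m a) (Good := CGood n m a x₀ l R) (I := CInv n m a x₀ R)
    (fun q hq b => hq.next hm2 hm hR hn hRm hRn hsep b) (w := fun q => 4 * F q.x) (f := f)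
    ?_ ?_ (B := 24 * n) (w₀ := 4 * (c * n)) (by positivity) (L := 6 * n) (by omega) ?_ ?_ hN ht hq
  · refine key.trans (div_le_div_of_nonneg_right ?_ (by positivity))
    simp only [hf]
    nlinarith [sq_nonneg (gap n m a q : ℝ)]
  · intro q hq
    have h1 := gap_nonneg hq.2.2.2.1
    have h2 := hq.2.2.2.2
    have h1' : (0 : ℝ) ≤ gap n m a q := by exact_mod_cast h1
    have h2' : (gap n m a q : ℝ) ≤ R + 2 := by exact_mod_cast h2
    simp only [hf]
    nlinarith
  · intro q _ hq
    obtain ⟨e, h1, h2, h3, h4⟩ := exists_gap_incr hm2 hm hR hn hRm hRn hsep hq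
    rw [avg_bool_prod]
    simp only [hf, (h1 _).2]
    push_cast
    have h3' : (e (true, true) + e (true, false) + e (false, true) + e (false, false) : ℝ) = 0 := by
      exact_mod_cast h3
    by_cases hpr : Priv n m a q.x
    · have h4' : ∀ b, (e b : ℝ) ^ 2 = 4 := fun b => by exact_mod_cast h4 hpr b
      have : F q.x = 1 := by simp [hF, hpr]
      rw [this]
      linear_combination (R + 2 - 2 * (gap n m a q : ℝ)) / 4 * h3' - (h4' (true, true) +
        h4' (true, false) + h4' (false, true) + h4' (false, false)) / 4
    · have : F q.x = 0 := by simp [hF, hpr]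
      rw [this]
      have h5 : (R + 2 - 2 * (gap n m a q : ℝ)) *
        (e (true, true) + e (true, false) + e (false, true) + e (false, false) : ℝ) = 0 := by
        rw [h3', mul_zero]
      nlinarith [sq_nonneg (e (true, true) : ℝ), sq_nonneg (e (true, false) : ℝ),
        sq_nonneg (e (false, true) : ℝ), sq_nonneg (e (false, false) : ℝ)]
  · intro s hs q
    have h1 := Tot_mono (cstep n m a) s (w := fun q => 4 * F q.x) (w' := fun _ => 4)
      (fun q => by linarith [hF1 q.x]) q
    rw [Tot_const] at h1
    have : (s : ℝ) ≤ 6 * n := by exact_mod_cast hs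
    linarith
  · intro q hq
    have e1 : Tot (cstep n m a) (6 * n) (fun q => 4 * F q.x) q =
        4 * ∑ s ∈ range (6 * n), mx n m (fun t => Ex (step n m) t F) s q := by
      unfold Tot
      rw [Finset.mul_sum]
      refine Finset.sum_congr rfl fun s _ => ?_
      rw [← Ex_cstep_x (a := a) F s q, ← Ex_mul]
    rw [e1]
    obtain ⟨⟨-, hi', -, hs, -⟩, -, -⟩ := hq
    have : c * n ≤ ∑ s ∈ range (6 * n), mx n m (fun t => Ex (step n m) t F) s q := by
      rcases hp : q.pend with _ | ⟨ζ, χ, s⟩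
      · simp only [mx_none hp]
        refine (hpriv' q.x hi').trans ?_
        exact Finset.sum_le_sum_of_subset_of_nonneg (Finset.range_mono (by omega))
          fun s _ _ => Ex_nonneg (step n m) hF0 s q.x
      · simp only [mx_some hp]
        have hs' := (shape_some hp).1 hs
        refine (le_sum_Force (step n m) (I := Function.Injective)
          (fun x hx c => step_injective hx) hF0 hpriv' ζ s hi').trans ?_
        exact Finset.sum_le_sum_of_subset_of_nonneg (Finset.range_mono (by omega))
          fun u _ _ => Force_nonneg (step n m) (fun t x => Ex_nonneg (step n m) hF0 t x) ζ s u q.x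
    linarith

/-- The difference is at most the probability that the decks have not merged. The three terms bound
the events that the gap exceeds `R` (martingale), that a card strays by more than `l` (Chebyshev),
and that the coupling has not ended in time. -/
theorem abs_Ex_sub_le_of_gap (hm2 : 2 ≤ m) (hm : m < n) (hR : (R : ℝ) ≤ l) (hR1 : 1 ≤ R)
    (hn : √(n : ℝ) ≤ 2 * l) (hRm : R < m) (hRn : 2 * R ≤ n - m)
    (hsep : ∀ b, b ≠ a → ¬ Near n m 0 (4 * l) (x₀ a) (x₀ b)) {c : ℝ} (hc : 0 < c)
    (hpriv : ∀ x : Fin 3 → Fin n, Function.Injective x → c * n ≤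
      Tot (step n m) (5 * n) (fun y => open Classical in if Priv n m a y then 1 else 0) x)
    {N t : ℕ} (hN : 0 < N) (ht : N * (6 * n) ≤ t) {y : Aug n} {x : Fin 3 → Fin n} {u : ℤ}
    (hy : Function.Injective y.pos) (hx : Function.Injective x) (hcons : Cons n m x₀ u y)
    (heq : ∀ b, b ≠ a → y.pos b = x b) (h0 : g n m (x a) ≤ g n m (y.pos a))
    (hgap : g n m (y.pos a) - g n m (x a) ≤ R) {F : (Fin 3 → Fin n) → ℝ}
    (hF0 : ∀ z, 0 ≤ F z) (hF1 : ∀ z, F z ≤ 1) :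
    |Ex (step n m) t F x - Ex (step n m) t F y.pos| ≤
      ((g n m (y.pos a) - g n m (x a) : ℤ) : ℝ) / R + Psi n m l t y +
      ((R + 2) * ((g n m (y.pos a) - g n m (x a) : ℤ) : ℝ) + 24 * n) / (4 * (c * n) * N) := by
  classical
  set q : Cpl n := ⟨y, x, none⟩ with hq
  have hp : q.pend = none := rfl
  have hgq : gap n m a q = g n m (y.pos a) - g n m (x a) := gap_none hp
  have hinv : CInv n m a x₀ R q :=
    ⟨hy, hx, ⟨u, hcons⟩, (shape_none hp).2 ⟨heq, h0⟩, by rw [hgq]; omega⟩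
  have hl : 0 < l := by
    have : (1 : ℝ) ≤ R := by exact_mod_cast hR1
    linarith
  have hRpos : (0 : ℝ) < R := by exact_mod_cast (by omega : 0 < R)
  set D : Cpl n → ℝ := fun q => if q.x = q.y.pos then (0 : ℝ) else 1 with hD
  have hD1 : ∀ t q, Ex (cstep n m a) t D q ≤ 1 := by
    intro t q
    have := Ex_mono (cstep n m a) (F := D) (G := fun _ => 1)
      (fun q => by simp only [hD]; split_ifs <;> norm_num) t q
    rwa [Ex_const] at this
  have hPsi0 : ∀ t q, 0 ≤ my n m (Psi n m l) t q := by
    intro t q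
    rcases h : q.pend with _ | ⟨ζ, χ, s⟩
    · rw [my_none h]; exact Psi_nonneg _ _ _
    · rw [my_some h]; exact Force_nonneg _ (fun t y => Psi_nonneg l t y) _ _ _ _
  have key := le_potential_add_surv (st := cstep n m a) (Good := CGood n m a x₀ l R)
    (I := CInv n m a x₀ R) (fun q hq b => hq.next hm2 hm hR hn hRm hRn hsep b)
    (W := fun t q => Ex (cstep n m a) t D q)
    (Φ := fun t q => (gap n m a q : ℝ) / R + my n m (Psi n m l) t q)
    (fun q => hD1 0 q) ?_ (fun t q _ _ => le_of_eq (Ex_succ _ _ _ _)) ?_ ?_ t hinv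
  · have h1 := surv_cpl_le hm2 hm hR hR1 hn hRm hRn hsep hc hpriv hN ht hinv
    rw [my_none hp, hgq] at key
    rw [hgq] at h1
    have h2 : Ex (step n m) t F x - Ex (step n m) t F y.pos =
        Ex (cstep n m a) t (fun q => F q.x - F q.y.pos) q := by
      rw [Ex_sub, Ex_cstep_x, mx_none hp, Ex_cstep_y (fun y => F y.pos), my_none hp, Ex_astep]
    have h3 : |Ex (cstep n m a) t (fun q => F q.x - F q.y.pos) q| ≤ Ex (cstep n m a) t D q := by
      rw [abs_le]
      have hb : ∀ q : Cpl n, |F q.x - F q.y.pos| ≤ D q := by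
        intro q
        simp only [hD]
        split_ifs with h
        · rw [h]; simp
        · rw [abs_le]
          constructor <;> linarith [hF0 q.x, hF0 q.y.pos, hF1 q.x, hF1 q.y.pos]
      constructor
      · have := Ex_mono (cstep n m a) (F := fun q => (-1) * D q) (G := fun q => F q.x - F q.y.pos)
          (fun q => by linarith [(abs_le.1 (hb q)).1]) t q
        rw [Ex_mul] at this
        linarith
      · exact Ex_mono (cstep n m a) (fun q => (abs_le.1 (hb q)).2) t q
    rw [h2]
    linarith
  · intro q hq
    have : (0 : ℝ) ≤ gap n m a q := by exact_mod_cast gap_nonneg hq.2.2.2.1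
    exact add_nonneg (by positivity) (hPsi0 0 q)
  · intro t q _ hq
    obtain ⟨e, h1, h2, h3, h4⟩ := exists_gap_incr hm2 hm hR hn hRm hRn hsep hq
    rw [avg_add]
    refine add_le_add (le_of_eq ?_) (avg_my_le (fun t y => avg_Psi_le hm2 hm l t y) t q)
    rw [avg_bool_prod]
    simp only [(h1 _).2]
    push_cast
    have h3' : (e (true, true) + e (true, false) + e (false, true) + e (false, false) : ℝ) = 0 := by
      exact_mod_cast h3
    linear_combination h3' / (4 * R)
  · intro t q hq hbad
    have hg0 : (0 : ℝ) ≤ gap n m a q := by exact_mod_cast gap_nonneg hq.2.2.2.1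
    have hg1 : 0 ≤ (gap n m a q : ℝ) / R := by positivity
    by_cases h1 : gap n m a q ≤ R
    · have h2 : ¬ (q.pend = none → q.y.pos ≠ q.x ∧ Tame l q.y) := fun h => hbad ⟨hq, h1, h⟩
      push Not at h2
      obtain ⟨h3, h4⟩ := h2
      by_cases h5 : q.y.pos = q.x
      · have := Ex_merged (m := m) (a := a) t h3 h5
        simp only [hD]
        rw [this]
        exact add_nonneg hg1 (hPsi0 t q)
      · have h6 := h4 h5
        unfold Tame at h6
        push Not at h6
        obtain ⟨b, hb⟩ := h6
        have h7 := one_le_Psi (m := m) hl t q.y b (by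
          by_contra hcon
          push Not at hcon
          linarith [hb hcon.1])
        rw [my_none h3]
        linarith [hD1 t q]
    · have h2 : (R : ℝ) < gap n m a q := by exact_mod_cast (not_le.1 h1)
      have h3 : 1 ≤ (gap n m a q : ℝ) / R := by rw [le_div_iff₀ hRpos]; linarith
      linarith [hD1 t q, hPsi0 t q]

end Mirror
end OverlappingCycles

/-! ### Two decks with the same coins, until the displacements `Z` agree -/

namespace OverlappingCycles

open Finset

section SameCoins

variable {n m : ℕ} {a : Fin 3} {x₀ : Fin 3 → Fin n}

/-- One round for two decks with the same coin. -/
noncomputable def pstep (n m : ℕ) (c : Bool) (q : Aug n × Aug n) : Aug n × Aug n :=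
  (astep n m c q.1, astep n m c q.2)

/-- The invariant of two decks which use the same coins and differ in card `a`. -/
def PInv (n m : ℕ) (a : Fin 3) (x₀ : Fin 3 → Fin n) (R₁ : ℤ) (q : Aug n × Aug n) : Prop :=
  (∃ t, Cons n m x₀ t q.1 ∧ Cons n m x₀ t q.2) ∧ Function.Injective q.1.pos ∧
    Function.Injective q.2.pos ∧ (∀ b, b ≠ a → q.1.pos b = q.2.pos b) ∧
    |q.1.Z a - q.2.Z a| ≤ R₁ + 1

/-- The states in which the two decks go on to use the same coins. -/
def PGood (n m : ℕ) (a : Fin 3) (x₀ : Fin 3 → Fin n) (R₁ R₂ : ℤ) (q : Aug n × Aug n) : Prop :=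
  PInv n m a x₀ R₁ q ∧ q.1.pos ≠ q.2.pos ∧ q.1.Z a - q.2.Z a ≠ 0 ∧ |q.1.Z a - q.2.Z a| ≤ R₁ ∧
    |q.1.A a - q.2.A a| ≤ R₂

theorem astep_A (c : Bool) (y : Aug n) (b : Fin 3) :
    (astep n m c y).A b = y.A b + if g n m (y.pos b) < 0 then sg c else 0 := by
  simp [astep]

theorem astep_Z (c : Bool) (y : Aug n) (b : Fin 3) :
    (astep n m c y).Z b = y.Z b + if g n m (y.pos b) = m then sg c else 0 := by
  simp [astep]

theorem PGood.next (hm2 : 2 ≤ m) (hm : m < n) {R₁ R₂ : ℤ} {q : Aug n × Aug n}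
    (h : PGood n m a x₀ R₁ R₂ q) (c : Bool) : PInv n m a x₀ R₁ (pstep n m c q) := by
  obtain ⟨⟨⟨t, h1, h2⟩, h3, h4, h5, -⟩, hne, h6, h7, h8⟩ := h
  refine ⟨⟨t + 1, h1.step hm2 hm c, h2.step hm2 hm c⟩, step_injective h3, step_injective h4,
    fun b hb => ?_, ?_⟩
  · simp only [pstep, astep_pos, h5 b hb]
  · simp only [pstep, astep_Z]
    rw [abs_le] at *
    have := sg_cases c
    split_ifs <;> constructor <;> omega

/-- A nonzero integer does not change its sign under a step of size at most 1, so its absolute value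
remains a martingale until it hits 0. -/
theorem avg_abs_Z_sub {q : Aug n × Aug n} (h : q.1.Z a - q.2.Z a ≠ 0) :
    avg (pstep n m) (fun q => |((q.1.Z a - q.2.Z a : ℤ) : ℝ)|) q =
      |((q.1.Z a - q.2.Z a : ℤ) : ℝ)| := by
  rw [avg_bool]
  simp only [pstep, astep_Z]
  have key : ∀ i j d : ℤ, d ≠ 0 → |j| ≤ 1 → i = -j → |d + i| + |d + j| = 2 * |d| := by
    intro i j d hd hj hi
    rw [abs_le] at hj
    rcases lt_or_gt_of_ne hd with hd | hd
    · rw [abs_of_neg hd, abs_of_nonpos (by omega), abs_of_nonpos (by omega)]; omega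
    · rw [abs_of_pos hd, abs_of_nonneg (by omega), abs_of_nonneg (by omega)]; omega
  have := key ((if g n m (q.1.pos a) = m then sg true else 0) -
    (if g n m (q.2.pos a) = m then sg true else 0)) ((if g n m (q.1.pos a) = m then sg false else 0) -
    (if g n m (q.2.pos a) = m then sg false else 0)) _ h
    (by simp only [sg, Bool.false_eq_true, if_false]; split_ifs <;> simp)
    (by simp only [sg, if_true, Bool.false_eq_true, if_false]; split_ifs <;> simp)
  have e : ∀ d d' i j : ℤ, d + i - (d' + j) = d - d' + (i - j) := by intros; ring
  rw [e, e]
  have h' := congrArg (Int.cast : ℤ → ℝ) this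
  push_cast at *
  linarith

/-- Unless both copies visit `m` at once, a visit of either changes the difference by `± 1`. The
visits of the second copy alone supply enough variance. -/
theorem avg_Z_sub_sq (q : Aug n × Aug n) (hne : ¬ (g n m (q.1.pos a) = m ∧ g n m (q.2.pos a) = m)) :
    vis n m a q.2.pos + ((q.1.Z a - q.2.Z a : ℤ) : ℝ) ^ 2 ≤
      avg (pstep n m) (fun q => ((q.1.Z a - q.2.Z a : ℤ) : ℝ) ^ 2) q := by
  rw [avg_bool]
  simp only [pstep, astep_Z, sg, vis]
  by_cases h1 : g n m (q.1.pos a) = m <;> by_cases h2 : g n m (q.2.pos a) = m <;>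
    simp [h1, h2] at * <;> nlinarith

theorem avg_A_sub_sq (q : Aug n × Aug n) :
    avg (pstep n m) (fun q => ((q.1.A a - q.2.A a : ℤ) : ℝ) ^ 2) q ≤
      ((q.1.A a - q.2.A a : ℤ) : ℝ) ^ 2 + 1 := by
  rw [avg_bool]
  simp only [pstep, astep_A, sg]
  by_cases h1 : g n m (q.1.pos a) < 0 <;> by_cases h2 : g n m (q.2.pos a) < 0 <;>
    simp [h1, h2] at * <;> nlinarith

theorem Ex_pstep_snd (F : Aug n → ℝ) (t : ℕ) (q : Aug n × Aug n) :
    Ex (pstep n m) t (fun q => F q.2) q = Ex (astep n m) t F q.2 := by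
  induction t generalizing q with
  | zero => rfl
  | succ t ih => rw [Ex_succ, Ex_succ]; simp only [avg_bool, ih]; rfl

theorem surv_pair_le (hm2 : 2 ≤ m) (hm : m < n) {R₁ R₂ : ℤ} {N u : ℕ} (hN : 0 < N)
    (hu : N * (5 * n) ≤ u) {q : Aug n × Aug n} (hq : PInv n m a x₀ R₁ q) :
    surv (pstep n m) (PGood n m a x₀ R₁ R₂) u q ≤
      ((R₁ + 1) * |((q.1.Z a - q.2.Z a : ℤ) : ℝ)| + (5 * n / m + 1)) / (3 * N) := by
  have hn0 : (0 : ℝ) < n := by exact_mod_cast (by omega : 0 < n)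
  have hm0 : (0 : ℝ) < m := by exact_mod_cast (by omega : 0 < m)
  have key := surv_le (st := pstep n m) (Good := PGood n m a x₀ R₁ R₂) (I := PInv n m a x₀ R₁)
    (fun q hq c => hq.next hm2 hm c) (w := fun q => vis n m a q.2.pos)
    (f := fun q => (R₁ + 1) * |((q.1.Z a - q.2.Z a : ℤ) : ℝ)| - ((q.1.Z a - q.2.Z a : ℤ) : ℝ) ^ 2)
    ?_ ?_ (B := 5 * n / m + 1) (w₀ := 3) (by norm_num) (L := 5 * n) (by omega) ?_ ?_ hN hu hq
  · refine key.trans (div_le_div_of_nonneg_right ?_ (by positivity))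
    nlinarith [sq_nonneg ((q.1.Z a - q.2.Z a : ℤ) : ℝ)]
  · intro q hq
    have h1 : |((q.1.Z a - q.2.Z a : ℤ) : ℝ)| ≤ R₁ + 1 := by exact_mod_cast hq.2.2.2.2
    rw [← sq_abs ((q.1.Z a - q.2.Z a : ℤ) : ℝ)]
    nlinarith [abs_nonneg ((q.1.Z a - q.2.Z a : ℤ) : ℝ)]
  · intro q _ hq
    have h1 := avg_abs_Z_sub (m := m) hq.2.2.1
    have h2 := avg_Z_sub_sq (m := m) (a := a) q (by
      rintro ⟨h3, h4⟩
      apply hq.2.1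
      funext b
      by_cases hb : b = a
      · subst hb; exact g_injective (h3.trans h4.symm)
      · exact hq.1.2.2.2.1 b hb)
    rw [avg_sub, avg_mul, h1]
    linarith
  · intro s hs q
    have e : Tot (pstep n m) s (fun q => vis n m a q.2.pos) q = Tot (step n m) s (vis n m a) q.2.pos := by
      unfold Tot
      refine Finset.sum_congr rfl fun s _ => ?_
      rw [Ex_pstep_snd (fun y => vis n m a y.pos), Ex_astep]
    rw [e]
    refine (Tot_vis_le hm2 hm s a q.2.pos).trans ((vb_le hm2 s _).trans ?_)
    have : (s : ℝ) ≤ 5 * n := by exact_mod_cast hs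
    gcongr
  · intro q _
    have e : Tot (pstep n m) (5 * n) (fun q => vis n m a q.2.pos) q =
        Tot (step n m) (5 * n) (vis n m a) q.2.pos := by
      unfold Tot
      refine Finset.sum_congr rfl fun s _ => ?_
      rw [Ex_pstep_snd (fun y => vis n m a y.pos), Ex_astep]
    rw [e]
    refine le_trans ?_ (le_Tot_vis hm2 hm (5 * n) a q.2.pos)
    push_cast
    rw [mul_div_assoc, div_self hn0.ne']
    norm_num

/-- For `u` rounds both decks use the same coins, so the other cards remain equal. At the first
agreement of `Z` the copies differ by the difference of `A`, at most `R₂` on the good event, and the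
remaining rounds, at least `t`, are left to the mirror coupling. The terms account for a large
difference of `Z`, a large difference of `A`, straying cards, the two failures of the mirror
coupling, and no agreement within `u` rounds. -/
theorem abs_Ex_sub_le (hm2 : 2 ≤ m) (hm : m < n) {l : ℝ} {R R₁ R₂ : ℤ} (hR : (R : ℝ) ≤ l)
    (hR1 : 1 ≤ R) (hn : √(n : ℝ) ≤ 2 * l) (hRm : R < m) (hRn : 2 * R ≤ n - m) (hR₁ : 1 ≤ R₁)
    (hR₂ : 1 ≤ R₂) (hR₂R : R₂ ≤ R)
    (hsep : ∀ b, b ≠ a → ¬ Near n m 0 (4 * l) (x₀ a) (x₀ b)) {c : ℝ} (hc : 0 < c)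
    (hpriv : ∀ x : Fin 3 → Fin n, Function.Injective x → c * n ≤
      Tot (step n m) (5 * n) (fun y => open Classical in if Priv n m a y then 1 else 0) x)
    {N N₁ t u : ℕ} (hN : 0 < N) (ht : N * (6 * n) ≤ t) (hN₁ : 0 < N₁) (hu : N₁ * (5 * n) ≤ u)
    {y : Fin 3 → Fin n} (hx : Function.Injective x₀) (hy : Function.Injective y)
    (heq : ∀ b, b ≠ a → y b = x₀ b) {α δ : ℤ} (hl : Lat n m α δ (g n m (y a) - g n m (x₀ a)))
    (hδ : |δ| ≤ R₁) {F : (Fin 3 → Fin n) → ℝ} (hF0 : ∀ z, 0 ≤ F z) (hF1 : ∀ z, F z ≤ 1) :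
    |Ex (step n m) (t + u) F x₀ - Ex (step n m) (t + u) F y| ≤
      |(δ : ℝ)| / R₁ + ((α : ℝ) ^ 2 + u) / R₂ ^ 2 +
      (6 * ((t + u : ℕ) + n * ((t + u : ℕ) / m + 1)) + (α ^ 2 + n * δ ^ 2)) / l ^ 2 +
      R₂ / R + ((R + 2) * R₂ + 24 * n) / (4 * (c * n) * N) +
      ((R₁ + 1) * |(δ : ℝ)| + (5 * n / m + 1)) / (3 * N₁) := by
  have hl0 : 0 < l := by
    have : (1 : ℝ) ≤ R := by exact_mod_cast hR1
    linarith
  have hRpos : (0 : ℝ) < R := by exact_mod_cast (by omega : 0 < R)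
  have hR₁pos : (0 : ℝ) < R₁ := by exact_mod_cast (by omega : 0 < R₁)
  have hR₂pos : (0 : ℝ) < R₂ := by exact_mod_cast (by omega : 0 < R₂)
  have hn0 : (0 : ℝ) < n := by exact_mod_cast (by omega : 0 < n)
  set E : ℕ → (Fin 3 → Fin n) → ℝ := fun t => Ex (step n m) t F with hE
  have hE0 : ∀ t x, 0 ≤ E t x := fun t x => Ex_nonneg _ hF0 t x
  have hE1 : ∀ t x, E t x ≤ 1 := fun t x => by
    have := Ex_mono (step n m) (F := F) (G := fun _ => 1) hF1 t x
    rwa [Ex_const] at this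
  have hEabs : ∀ t x x', |E t x - E t x'| ≤ 1 := fun t x x' => by
    rw [abs_le]; constructor <;> linarith [hE0 t x, hE1 t x, hE0 t x', hE1 t x']
  set η₂ : ℝ := R₂ / R + ((R + 2) * R₂ + 24 * n) / (4 * (c * n) * N) with hη₂
  have hη₂0 : 0 ≤ η₂ := by positivity
  -- The initial displacement of the moved card is booked as accumulated in `A` and `Z`, so that
  -- both decks are traced back to the same `x₀`.
  set qs : Aug n × Aug n := (⟨y, Function.update 0 a α, Function.update 0 a δ⟩, ⟨x₀, 0, 0⟩) with hqs
  have hinv : PInv n m a x₀ R₁ qs := by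
    refine ⟨⟨0, ?_, cons_start x₀⟩, hy, hx, heq, ?_⟩
    · intro b
      by_cases hb : b = a
      · subst hb; simpa [hqs] using hl
      · simpa [hqs, Function.update_of_ne hb, heq b hb] using lat_self (n := n) (m := m) 0
    · simp [hqs]; omega
  have key := le_potential_add_surv (st := pstep n m) (Good := PGood n m a x₀ R₁ R₂)
    (I := PInv n m a x₀ R₁) (fun q hq b => hq.next hm2 hm b)
    (W := fun v q => |E (t + v) q.1.pos - E (t + v) q.2.pos|)
    (Φ := fun v q => |((q.1.Z a - q.2.Z a : ℤ) : ℝ)| / R₁ +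
      (((q.1.A a - q.2.A a : ℤ) : ℝ) ^ 2 + v) / R₂ ^ 2 +
      (Psi n m l (t + v) q.1 + Psi n m l (t + v) q.2) + η₂)
    (fun q => hEabs _ _ _) ?_ ?_ ?_ ?_ u hinv
  · have h1 := surv_pair_le (R₂ := R₂) hm2 hm hN₁ hu hinv
    have e1 : qs.1.Z a - qs.2.Z a = δ := by simp [hqs]
    have e2 : qs.1.A a - qs.2.A a = α := by simp [hqs]
    rw [e1] at h1 key
    rw [e2] at key
    have h2 : Psi n m l (t + u) qs.1 + Psi n m l (t + u) qs.2 ≤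
        (6 * ((t + u : ℕ) + n * ((t + u : ℕ) / m + 1)) + (α ^ 2 + n * δ ^ 2)) / l ^ 2 := by
      have h3 : ∀ b, ((qs.1.A b : ℝ) ^ 2 + (t + u : ℕ) + n * ((qs.1.Z b : ℝ) ^ 2 + vb n m (t + u) (qs.1.pos b))) / l ^ 2
          ≤ ((t + u : ℕ) + n * ((t + u : ℕ) / m + 1) + (if b = a then (α ^ 2 + n * δ ^ 2 : ℝ) else 0)) / l ^ 2 := by
        intro b
        have hv := mul_le_mul_of_nonneg_left (vb_le hm2 (t + u) (qs.1.pos b)) hn0.le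
        apply div_le_div_of_nonneg_right _ (by positivity)
        by_cases hb : b = a
        · subst hb; simp [hqs] at *; linarith
        · simp [hqs, hb] at *; linarith
      have h4 : ∀ b, ((qs.2.A b : ℝ) ^ 2 + (t + u : ℕ) + n * ((qs.2.Z b : ℝ) ^ 2 + vb n m (t + u) (qs.2.pos b))) / l ^ 2
          ≤ ((t + u : ℕ) + n * ((t + u : ℕ) / m + 1)) / l ^ 2 := by
        intro b
        have hv := mul_le_mul_of_nonneg_left (vb_le hm2 (t + u) (qs.2.pos b)) hn0.le
        apply div_le_div_of_nonneg_right _ (by positivity)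
        simp [hqs] at *; linarith
      unfold Psi
      refine (add_le_add (Finset.sum_le_sum fun b _ => h3 b) (Finset.sum_le_sum fun b _ => h4 b)).trans
        (le_of_eq ?_)
      rw [← Finset.sum_div, ← Finset.sum_div, Finset.sum_add_distrib, Finset.sum_ite_eq']
      simp
      ring
    rw [abs_sub_comm]
    change |E (t + u) qs.1.pos - E (t + u) qs.2.pos| ≤ _
    linarith
  · intro q _
    have := Psi_nonneg (m := m) l (t + 0) q.1
    have := Psi_nonneg (m := m) l (t + 0) q.2
    positivity
  · intro v q _ _
    rw [avg_bool]
    have e : ∀ x, E (t + (v + 1)) x = (E (t + v) (step n m true x) + E (t + v) (step n m false x)) / 2 := by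
      intro x
      simp only [hE]
      rw [← add_assoc, Ex_succ, avg_bool]
    rw [e, e]
    have h1 := abs_add_le (E (t + v) (step n m true q.1.pos) - E (t + v) (step n m true q.2.pos))
      (E (t + v) (step n m false q.1.pos) - E (t + v) (step n m false q.2.pos))
    have h2 : ∀ p r s t : ℝ, (p + r) / 2 - (s + t) / 2 = ((p - s) + (r - t)) / 2 := by intros; ring
    rw [h2, abs_div, abs_two]
    exact div_le_div_of_nonneg_right h1 (by norm_num)
  · intro v q _ hq
    have h1 := avg_abs_Z_sub (m := m) hq.2.2.1
    have h2 := avg_A_sub_sq (m := m) (a := a) q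
    have h3 := avg_Psi_le hm2 hm l (t + v) q.1
    have h4 := avg_Psi_le hm2 hm l (t + v) q.2
    have e : avg (pstep n m) (fun q => |((q.1.Z a - q.2.Z a : ℤ) : ℝ)| / R₁ +
        (((q.1.A a - q.2.A a : ℤ) : ℝ) ^ 2 + v) / R₂ ^ 2 +
        (Psi n m l (t + v) q.1 + Psi n m l (t + v) q.2) + η₂) q =
        avg (pstep n m) (fun q => |((q.1.Z a - q.2.Z a : ℤ) : ℝ)|) q / R₁ +
        (avg (pstep n m) (fun q => ((q.1.A a - q.2.A a : ℤ) : ℝ) ^ 2) q + v) / R₂ ^ 2 +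
        (avg (astep n m) (Psi n m l (t + v)) q.1 + avg (astep n m) (Psi n m l (t + v)) q.2) +
        η₂ := by
      simp only [avg_bool, pstep]; ring
    rw [e, h1, ← add_assoc t v 1]
    have h5 : (avg (pstep n m) (fun q => ((q.1.A a - q.2.A a : ℤ) : ℝ) ^ 2) q + v) / (R₂ : ℝ) ^ 2 ≤
        (((q.1.A a - q.2.A a : ℤ) : ℝ) ^ 2 + (v + 1 : ℕ)) / R₂ ^ 2 := by
      apply div_le_div_of_nonneg_right _ (by positivity)
      push_cast at *
      linarith
    linarith
  · intro v q hq hbad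
    have p1 := Psi_nonneg (m := m) l (t + v) q.1
    have p2 := Psi_nonneg (m := m) l (t + v) q.2
    have p3 : 0 ≤ |((q.1.Z a - q.2.Z a : ℤ) : ℝ)| / R₁ := by positivity
    have p4 : 0 ≤ (((q.1.A a - q.2.A a : ℤ) : ℝ) ^ 2 + v) / R₂ ^ 2 := by positivity
    by_cases c1 : q.1.pos = q.2.pos
    · rw [c1, sub_self, abs_zero]
      linarith
    by_cases c2 : R₁ < |q.1.Z a - q.2.Z a|
    · have : (R₁ : ℝ) < |((q.1.Z a - q.2.Z a : ℤ) : ℝ)| := by exact_mod_cast c2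
      have h1 : 1 ≤ |((q.1.Z a - q.2.Z a : ℤ) : ℝ)| / R₁ := by rw [le_div_iff₀ hR₁pos]; linarith
      linarith [hEabs (t + v) q.1.pos q.2.pos]
    by_cases c3 : R₂ < |q.1.A a - q.2.A a|
    · have : (R₂ : ℝ) < |((q.1.A a - q.2.A a : ℤ) : ℝ)| := by exact_mod_cast c3
      have h1 : 1 ≤ (((q.1.A a - q.2.A a : ℤ) : ℝ) ^ 2 + v) / R₂ ^ 2 := by
        rw [le_div_iff₀ (by positivity), ← sq_abs ((q.1.A a - q.2.A a : ℤ) : ℝ)]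
        have : (0 : ℝ) ≤ v := by positivity
        nlinarith
      linarith [hEabs (t + v) q.1.pos q.2.pos]
    push Not at c2 c3
    -- All other reasons for being bad are excluded, so this is the agreement of `Z`.
    have c4 : q.1.Z a - q.2.Z a = 0 := by
      by_contra h
      exact hbad ⟨hq, c1, h, c2, c3⟩
    obtain ⟨⟨t₀, k1, k2⟩, k3, k4, k5, -⟩ := hq
    have k6 := (k1 a).sub (k2 a)
    rw [c4] at k6
    have e : g n m (q.1.pos a) - g n m (x₀ a) - t₀ - (g n m (q.2.pos a) - g n m (x₀ a) - t₀) =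
        g n m (q.1.pos a) - g n m (q.2.pos a) := by ring
    rw [e] at k6
    have b1 := g_le (m := m) (q.1.pos a)
    have b2 := g_le (m := m) (q.2.pos a)
    have b3 := le_g hm (q.1.pos a)
    have b4 := le_g hm (q.2.pos a)
    have k7 := k6.eq_of_zero (by rw [abs_le] at c3; rw [abs_lt]; constructor <;> omega)
    have htv : N * (6 * n) ≤ t + v := by omega
    have bound : ∀ d : ℤ, 0 ≤ d → d ≤ R₂ → ((d : ℤ) : ℝ) / R +
        ((R + 2) * ((d : ℤ) : ℝ) + 24 * n) / (4 * (c * n) * N) ≤ η₂ := by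
      intro d h0 h1
      have : (d : ℝ) ≤ R₂ := by exact_mod_cast h1
      have h0' : (0 : ℝ) ≤ d := by exact_mod_cast h0
      rw [hη₂]
      gcongr
    rw [abs_le] at c3
    rcases le_total (g n m (q.2.pos a)) (g n m (q.1.pos a)) with hle | hle
    · have h1 := abs_Ex_sub_le_of_gap hm2 hm hR hR1 hn hRm hRn hsep hc hpriv hN htv k3 k4 k1 k5 hle
        (by omega) hF0 hF1
      have h2 := bound (g n m (q.1.pos a) - g n m (q.2.pos a)) (by omega) (by omega)
      rw [abs_sub_comm]
      simp only [hE]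
      linarith
    · have h1 := abs_Ex_sub_le_of_gap hm2 hm hR hR1 hn hRm hRn hsep hc hpriv hN htv k4 k3 k2
        (fun b hb => (k5 b hb).symm) hle (by omega) hF0 hF1
      have h2 := bound (g n m (q.2.pos a) - g n m (q.1.pos a)) (by omega) (by omega)
      simp only [hE]
      linarith

end SameCoins
end OverlappingCycles

/-! ### Regularity: the choice of the constants in the coupling bound -/

namespace OverlappingCycles

open Finset

set_option maxHeartbeats 1000000 in
-- The constants are chosen in the order `κ`, `s`, `κ₁`, `r`, `C`. Small `κ` keeps the cards within
-- `l`. Small `s` makes a gap `s l` close in time and before it grows to `R`. Small `κ₁` keeps the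
-- difference of `A` below `s l` during the same-coin phase. Small `r` makes the difference of `Z`
-- vanish in that phase. Large `C` absorbs the terms of order `n`.
theorem exists_regularity {ε : ℝ} (hε : 0 < ε) (hε1 : ε ≤ 1 / 2) {η : ℝ} (hη : 0 < η) (hη1 : η ≤ 1)
    {κ₀ : ℝ} (hκ₀ : 0 < κ₀) : ∃ κ r C : ℝ, 0 < κ ∧ κ ≤ κ₀ ∧ 0 < r ∧ r ≤ 1 ∧ 0 < C ∧
      ∀ n m : ℕ, 2 ≤ m → m < n → ε * n ≤ m → ε * n ≤ n - m → ∀ l : ℝ, C * √(n : ℝ) ≤ l → 99 * l ≤ n →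
      ∀ T : ℕ, κ * l ^ 2 ≤ T → T ≤ 2 * κ * l ^ 2 → ∀ (a : Fin 3) (x y : Fin 3 → Fin n),
      Function.Injective x → Function.Injective y → (∀ b, b ≠ a → y b = x b) →
      Near n m 0 (r * l) (x a) (y a) → (∀ b, b ≠ a → ¬ Near n m 0 (4 * l) (x a) (x b)) →
      ∀ F : (Fin 3 → Fin n) → ℝ, (∀ z, 0 ≤ F z) → (∀ z, F z ≤ 1) →
      |Ex (step n m) T F x - Ex (step n m) T F y| ≤ η := by
  obtain ⟨c, hc, N₀, hpriv⟩ := exists_Tot_priv_ge hε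
  obtain ⟨κ, hκ, hκκ₀, hκη⟩ : ∃ κ : ℝ, 0 < κ ∧ κ ≤ κ₀ ∧ κ ≤ η * ε / 400 :=
    ⟨min κ₀ (η * ε / 400), by positivity, min_le_left _ _, min_le_right _ _⟩
  obtain ⟨s, hs, hs1, hs2⟩ : ∃ s : ℝ, 0 < s ∧ s ≤ ε * η / 40 ∧ s ≤ c * κ * η / 100 :=
    ⟨min _ _, by positivity, min_le_left _ _, min_le_right _ _⟩
  obtain ⟨κ₁, hκ₁, hκ₁1, hκ₁2⟩ : ∃ κ₁ : ℝ, 0 < κ₁ ∧ κ₁ ≤ s ^ 2 * η / 200 ∧ κ₁ ≤ κ / 2 :=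
    ⟨min _ _, by positivity, min_le_left _ _, min_le_right _ _⟩
  have hηε : η * ε ≤ η / 2 := by
    have := mul_le_mul_of_nonneg_left hε1 hη.le; linarith
  have hκ1 : κ ≤ 1 := by linarith
  have hsε : s ≤ ε := by
    have := mul_le_mul_of_nonneg_left hη1 hε.le; linarith
  have hκ₁le : κ₁ ≤ 1 := by linarith
  obtain ⟨r, hr, hr'⟩ : ∃ r : ℝ, 0 < r ∧ r = η * κ₁ / 40 := ⟨_, by positivity, rfl⟩
  have hηκ : η * κ₁ ≤ 1 := by nlinarith
  have hr2 : r ^ 2 ≤ η ^ 2 * κ₁ / 1600 := by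
    have : (η * κ₁) ^ 2 ≤ η ^ 2 * κ₁ := by
      rw [mul_pow]; gcongr; exact pow_le_of_le_one hκ₁.le hκ₁le (by norm_num)
    rw [hr', div_pow]; linarith
  have hr2κ : r ^ 2 ≤ κ₁ := by
    have : η ^ 2 * κ₁ ≤ κ₁ := by
      have : η ^ 2 ≤ 1 := by nlinarith
      nlinarith
    linarith
  have hr2η : r ^ 2 ≤ η / 1600 := by
    have : η ^ 2 * κ₁ ≤ η := by nlinarith
    linarith
  have hN₀ : (0 : ℝ) ≤ N₀ := by positivity
  obtain ⟨C, hC0, hCN, hCε, hCs, hCr, hCκ, hCc, hCκ₁, hCκ₂, hCη⟩ : ∃ C : ℝ, 1 ≤ C ∧ (N₀ : ℝ) ≤ C ∧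
      4 / ε ≤ C ∧ 2 / s ≤ C ∧ 1 / r ≤ C ∧ 24 / κ ≤ C ∧ 2304 / (c * κ * η) ≤ C ∧ 20 / κ₁ ≤ C ∧
      60 * (5 / ε + 1) / (κ₁ * η) ≤ C ∧ 96 / η ≤ C := by
    have h1 : 0 < 4 / ε := by positivity
    have h2 : 0 < 2 / s := by positivity
    have h3 : 0 < 1 / r := by positivity
    have h4 : 0 < 24 / κ := by positivity
    have h5 : 0 < 2304 / (c * κ * η) := by positivity
    have h6 : 0 < 20 / κ₁ := by positivity
    have h7 : 0 < 60 * (5 / ε + 1) / (κ₁ * η) := by positivity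
    have h8 : 0 < 96 / η := by positivity
    refine ⟨1 + N₀ + 4 / ε + 2 / s + 1 / r + 24 / κ + 2304 / (c * κ * η) + 20 / κ₁ +
      60 * (5 / ε + 1) / (κ₁ * η) + 96 / η, ?_, ?_, ?_, ?_, ?_, ?_, ?_, ?_, ?_, ?_⟩ <;> linarith
  refine ⟨κ, r, C, hκ, hκκ₀, hr, by rw [hr']; linarith, by linarith, ?_⟩
  intro n m hm2 hm hm3 hm4 l hl hln T hT1 hT2 a x y hx hy heq hnear hsep F hF0 hF1
  have hn1 : (1 : ℝ) ≤ n := by exact_mod_cast (by omega : 1 ≤ n)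
  have hn0 : (0 : ℝ) < n := by linarith
  have hm0 : (0 : ℝ) < m := by exact_mod_cast (by omega : 0 < m)
  have hsn1 : 1 ≤ √(n : ℝ) := by rwa [Real.one_le_sqrt]
  have hsn0 : 0 < √(n : ℝ) := by linarith
  have hsq : √(n : ℝ) ^ 2 = n := Real.sq_sqrt hn0.le
  have hCl : C ≤ l := (le_mul_of_one_le_right (by linarith) hsn1).trans hl
  have hl0 : 0 < l := by linarith
  have hsl : √(n : ℝ) ≤ l := (le_mul_of_one_le_left (by linarith) hC0).trans hl
  have hX : C ≤ l / √(n : ℝ) := by rwa [le_div_iff₀ hsn0]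
  have hU : C * n ≤ l ^ 2 := by
    have h1 : (C * √(n : ℝ)) ^ 2 ≤ l ^ 2 := by gcongr
    rw [mul_pow, hsq] at h1
    have : C * n ≤ C ^ 2 * n := by gcongr; exact le_self_pow₀ hC0 (by norm_num)
    linarith
  have hUK : ∀ {K : ℝ}, K ≤ C → K * n ≤ l ^ 2 := fun h =>
    (mul_le_mul_of_nonneg_right h hn0.le).trans hU
  have hnN : N₀ ≤ n := by
    have : (N₀ : ℝ) ≤ n := by linarith
    exact_mod_cast this
  have hεl : 4 ≤ ε * l := by
    have := (div_le_iff₀ hε).1 (hCε.trans hCl); linarith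
  have hsl2 : 2 ≤ s * l := by
    have := (div_le_iff₀ hs).1 (hCs.trans hCl); linarith
  set ρ : ℝ := r * l / √(n : ℝ) with hρ
  have hρ1 : 1 ≤ ρ := by
    have := (div_le_iff₀ hr).1 (hCr.trans hX)
    rw [hρ, mul_div_assoc]; linarith
  have hρ2 : ρ ^ 2 = r ^ 2 * (l ^ 2 / n) := by rw [hρ, div_pow, hsq, mul_pow, mul_div_assoc]
  obtain ⟨α, δ, hlat, hα, hδ⟩ := hnear
  rw [sub_zero] at hlat
  have hδ' : |(δ : ℝ)| ≤ ρ := by rw [hρ, le_div_iff₀ hsn0]; exact hδ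
  -- The gap threshold `R` must fit into the front and into half of the back. A difference of `Z`
  -- starts at most at `ρ` and passes `R₁` with probability at most `η / 16`.
  set R : ℤ := ⌊ε * l⌋ with hRdef
  set R₂ : ℤ := ⌊s * l⌋ with hR₂def
  set R₁ : ℤ := ⌈16 * ρ / η⌉ with hR₁def
  have R1 : (R : ℝ) ≤ ε * l := Int.floor_le _
  have R2 : ε * l / 2 ≤ R := by have := Int.lt_floor_add_one (ε * l); rw [← hRdef] at this; linarith
  have S1 : (R₂ : ℝ) ≤ s * l := Int.floor_le _
  have S2 : s * l / 2 ≤ R₂ := by have := Int.lt_floor_add_one (s * l); rw [← hR₂def] at this; linarith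
  have D1 : 16 * ρ / η ≤ R₁ := Int.le_ceil _
  have D2 : (R₁ : ℝ) ≤ 16 * ρ / η + 1 := (Int.ceil_lt_add_one _).le
  have hρη : ρ ≤ 16 * ρ / η := by 
    rw [le_div_iff₀ hη]
    have := mul_le_mul_of_nonneg_left hη1 (by linarith : 0 ≤ ρ)
    linarith
  have hR0 : (0 : ℝ) < R := by linarith
  have hR₁0 : (0 : ℝ) < R₁ := by linarith
  have hR₂0 : (0 : ℝ) < R₂ := by linarith
  have hδR : |(δ : ℝ)| ≤ R₁ := by linarith
  set u : ℕ := ⌊κ₁ * l ^ 2⌋₊ with hu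
  have u1 : (u : ℝ) ≤ κ₁ * l ^ 2 := Nat.floor_le (by positivity)
  have u2 : κ₁ * l ^ 2 ≤ u + 1 := (Nat.lt_floor_add_one _).le
  have hl2 : 0 < l ^ 2 := by positivity
  have huT' : (u : ℝ) ≤ κ * l ^ 2 / 2 := by
    have := mul_le_mul_of_nonneg_right hκ₁2 hl2.le
    linarith
  have huT : u ≤ T := by
    have : (u : ℝ) ≤ T := by linarith [mul_pos hκ hl2]
    exact_mod_cast this
  obtain ⟨t, rfl⟩ := Nat.exists_eq_add_of_le' huT
  have ht : κ * l ^ 2 / 2 ≤ t := by push_cast at hT1; linarith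
  have hdiv : ∀ w k : ℕ, 0 < k → (w : ℝ) / (k * n) - 1 ≤ (w / (k * n) : ℕ) := by
    intro w k hk
    have h1 : w < (w / (k * n) + 1) * (k * n) := by
      have hkn : 0 < k * n := Nat.mul_pos hk (by omega)
      have := Nat.lt_mul_div_succ w hkn
      rwa [mul_comm] at this
    have h2 : (w : ℝ) < ((w / (k * n) : ℕ) + 1) * (k * n) := by exact_mod_cast h1
    have hk' : (0 : ℝ) < k := by exact_mod_cast hk
    have h3 : (w : ℝ) / (k * n) ≤ (w / (k * n) : ℕ) + 1 := by
      rw [div_le_iff₀ (by positivity)]; exact h2.le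
    linarith
  set N : ℕ := t / (6 * n) with hN
  set N₁ : ℕ := u / (5 * n) with hN₁
  have n1 := hdiv t 6 (by norm_num)
  have n2 := hdiv u 5 (by norm_num)
  rw [← hN] at n1
  rw [← hN₁] at n2
  push_cast at n1 n2
  have v1 : 24 ≤ κ * l ^ 2 / n := by
    rw [le_div_iff₀ hn0]
    have := hUK hCκ
    rw [div_mul_eq_mul_div, div_le_iff₀ hκ] at this
    linarith
  have v2 : 20 ≤ κ₁ * l ^ 2 / n := by
    rw [le_div_iff₀ hn0]
    have := hUK hCκ₁
    rw [div_mul_eq_mul_div, div_le_iff₀ hκ₁] at this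
    linarith
  have hNlow : κ * l ^ 2 / n / 24 ≤ N := by
    have : κ * l ^ 2 / n / 12 ≤ t / (6 * n) := by
      have e : κ * l ^ 2 / n / 12 = (κ * l ^ 2 / 2) / (6 * n) := by field_simp; ring
      rw [e]
      gcongr
    linarith
  have hN₁low : κ₁ * l ^ 2 / n / 10 ≤ N₁ := by
    have : κ₁ * l ^ 2 / n / 5 - 1 ≤ u / (5 * n) := by
      have h1 : κ₁ * l ^ 2 / n / 5 ≤ (u + 1) / (5 * n) := by
        rw [div_div, mul_comm (n : ℝ) 5]
        gcongr
      have h2 : (1 : ℝ) / (5 * n) ≤ 1 := by rw [div_le_one (by positivity)]; linarith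
      rw [add_div] at h1
      linarith
    linarith
  have hN0 : (0 : ℝ) < N := by linarith
  have hN₁0 : (0 : ℝ) < N₁ := by linarith
  have hεl1 : ε * l ≤ l / 2 := by
    have := mul_le_mul_of_nonneg_right hε1 hl0.le; linarith
  have hεn : 99 * (ε * l) ≤ ε * n := by
    have := mul_le_mul_of_nonneg_left hln hε.le; linarith
  have key := abs_Ex_sub_le (x₀ := x) (R := R) (R₁ := R₁) (R₂ := R₂) (N := N) (N₁ := N₁) (t := t)
    (u := u) hm2 hm (l := l) (by linarith) (by exact_mod_cast (by linarith : (1 : ℝ) ≤ R))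
    (by linarith) (by exact_mod_cast (by linarith : (R : ℝ) < m)) ?_
    (by exact_mod_cast (by linarith : (1 : ℝ) ≤ R₁)) (by exact_mod_cast (by linarith : (1 : ℝ) ≤ R₂))
    (Int.floor_le_floor (by gcongr)) hsep hc (hpriv n m hnN hm2 hm hm3 hm4 a)
    (by exact_mod_cast hN0) (Nat.div_mul_le_self _ _) (by exact_mod_cast hN₁0)
    (Nat.div_mul_le_self _ _) hx hy heq hlat (by exact_mod_cast hδR) hF0 hF1
  · refine key.trans ?_
    have hα2 : (α : ℝ) ^ 2 ≤ r ^ 2 * l ^ 2 := by rw [← mul_pow, ← sq_abs]; gcongr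
    have hδ2 : n * (δ : ℝ) ^ 2 ≤ r ^ 2 * l ^ 2 := by
      have h1 : (|(δ : ℝ)| * √(n : ℝ)) ^ 2 ≤ (r * l) ^ 2 := by gcongr
      rw [mul_pow, mul_pow, hsq, sq_abs] at h1
      linarith
    have e1 : |(δ : ℝ)| / R₁ ≤ η / 16 := by
      rw [div_le_iff₀ hR₁0]
      rw [div_le_iff₀ hη] at D1
      linarith
    have e2 : ((α : ℝ) ^ 2 + u) / R₂ ^ 2 ≤ η / 25 := by
      rw [div_le_iff₀ (by positivity)]
      have h1 : (s * l / 2) ^ 2 ≤ (R₂ : ℝ) ^ 2 := by gcongr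
      have h2 : (α : ℝ) ^ 2 + u ≤ 2 * κ₁ * l ^ 2 := by
        have := mul_le_mul_of_nonneg_right hr2κ hl2.le
        linarith
      have h3 : 2 * κ₁ * l ^ 2 ≤ 2 * (s ^ 2 * η / 200) * l ^ 2 := by gcongr
      have h4 : η / 25 * (s * l / 2) ^ 2 ≤ η / 25 * (R₂ : ℝ) ^ 2 := by gcongr
      linarith
    have e3 : (6 * ((t + u : ℕ) + n * ((t + u : ℕ) / m + 1)) + ((α : ℝ) ^ 2 + n * δ ^ 2)) / l ^ 2 ≤
        η / 8 := by
      rw [div_le_iff₀ hl2]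
      have h1 : (n : ℝ) * ((t + u : ℕ) / m) ≤ (t + u : ℕ) / ε := by
        rw [mul_div_assoc', div_le_div_iff₀ hm0 hε]
        have := mul_le_mul_of_nonneg_right hm3 (by positivity : (0 : ℝ) ≤ (t + u : ℕ))
        linarith
      have h2 : ((t + u : ℕ) : ℝ) ≤ η * ε / 200 * l ^ 2 := hT2.trans (by gcongr; linarith)
      have h3 : ((t + u : ℕ) : ℝ) / ε ≤ η / 200 * l ^ 2 := by
        rw [div_le_iff₀ hε]; linarith
      have h4 := hUK hCη
      rw [div_mul_eq_mul_div, div_le_iff₀ hη] at h4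
      have h5 : r ^ 2 * l ^ 2 ≤ η / 1600 * l ^ 2 := by gcongr
      have h6 : ((t + u : ℕ) : ℝ) ≤ η / 400 * l ^ 2 := h2.trans (mul_le_mul_of_nonneg_right (by linarith only [hηε]) hl2.le)
      have h7 : (n : ℝ) ≤ l ^ 2 * η / 96 := by linarith
      have h8 : 0 < η * l ^ 2 := by positivity
      linarith
    have e4 : (R₂ : ℝ) / R ≤ η / 20 := by
      rw [div_le_iff₀ hR0]
      have h1 := mul_le_mul_of_nonneg_right hs1 hl0.le
      have h2 := mul_le_mul_of_nonneg_left R2 (by positivity : 0 ≤ η / 20)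
      linarith
    have e5 : (((R : ℝ) + 2) * R₂ + 24 * n) / (4 * (c * n) * N) ≤ η / 8 := by
      rw [div_le_iff₀ (by positivity)]
      have h1 : ((R : ℝ) + 2) * R₂ ≤ l * (s * l) := by
        exact mul_le_mul (by linarith) S1 hR₂0.le hl0.le
      have h2 : l * (s * l) ≤ c * κ * η / 100 * l ^ 2 := by
        have := mul_le_mul_of_nonneg_right hs2 hl2.le
        linarith
      have h3 := hUK hCc
      rw [div_mul_eq_mul_div, div_le_iff₀ (by positivity)] at h3
      have h4 : c * κ * l ^ 2 / 6 ≤ 4 * (c * n) * N := by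
        have : κ * l ^ 2 / 24 ≤ n * N := by
          rw [div_right_comm, div_le_iff₀ hn0] at hNlow; linarith
        have := mul_le_mul_of_nonneg_left this (by positivity : 0 ≤ 4 * c)
        linarith
      have h5 : η / 8 * (c * κ * l ^ 2 / 6) ≤ η / 8 * (4 * (c * n) * N) := by gcongr
      have h6 : 0 < c * κ * η * l ^ 2 := by positivity
      linarith
    have e6 : (((R₁ : ℝ) + 1) * |(δ : ℝ)| + (5 * n / m + 1)) / (3 * N₁) ≤ η / 8 := by
      rw [div_le_iff₀ (by positivity)]
      have h1 : ((R₁ : ℝ) + 1) * |(δ : ℝ)| ≤ 18 * ρ / η * ρ := by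
        apply mul_le_mul _ hδ' (abs_nonneg _) (by positivity)
        have : 2 ≤ 2 * ρ / η := by rw [le_div_iff₀ hη]; linarith
        have e : 18 * ρ / η = 16 * ρ / η + 2 * ρ / η := by ring
        linarith
      have h2 : 18 * ρ / η * ρ ≤ 18 / 1600 * (η * (κ₁ * (l ^ 2 / n))) := by
        have e : 18 * ρ / η * ρ = 18 / η * ρ ^ 2 := by ring
        rw [e, hρ2]
        have h3 : r ^ 2 * (l ^ 2 / n) ≤ η ^ 2 * κ₁ / 1600 * (l ^ 2 / n) := by gcongr
        calc 18 / η * (r ^ 2 * (l ^ 2 / n)) ≤ 18 / η * (η ^ 2 * κ₁ / 1600 * (l ^ 2 / n)) := by gcongr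
          _ = _ := by field_simp
      have h3 : 5 * (n : ℝ) / m ≤ 5 / ε := by
        rw [div_le_div_iff₀ hm0 hε]; linarith
      have h4 : 5 / ε + 1 ≤ η * (κ₁ * (l ^ 2 / n)) / 60 := by
        have := hUK hCκ₂
        rw [div_mul_eq_mul_div, div_le_iff₀ (by positivity)] at this
        have e : η * (κ₁ * (l ^ 2 / n)) / 60 = (l ^ 2 * (κ₁ * η)) / (60 * n) := by field_simp
        rw [e, le_div_iff₀ (by positivity)]
        linarith
      have h5 : η / 8 * (3 * (κ₁ * (l ^ 2 / n) / 10)) ≤ η / 8 * (3 * N₁) := by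
        gcongr
        rw [← mul_div_assoc]; exact hN₁low
      have h6 : 0 < η * (κ₁ * (l ^ 2 / n)) := by positivity
      linarith
    linarith
  · have h1 : 2 * (R : ℝ) ≤ n - m := by linarith
    exact_mod_cast h1

end OverlappingCycles

namespace OverlappingCycles

open Finset

/-! ### Counting positions -/

/-- The modulus `2n - m + 1`. -/
def md (n m : ℕ) : ℕ := 2 * n - m + 1

/-- The residues of `a + b m` with `|a| ≤ ρ` and `|b| √n ≤ ρ`. -/
noncomputable def Box (n m : ℕ) (ρ : ℝ) : Finset (ZMod (md n m)) :=
  (Icc (-⌊ρ⌋) ⌊ρ⌋ ×ˢ Icc (-⌊ρ / √(n : ℝ)⌋) ⌊ρ / √(n : ℝ)⌋).image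
    fun v : ℤ × ℤ => ((v.1 + v.2 * m : ℤ) : ZMod (md n m))

section Boxes

variable {n m : ℕ}

theorem md_cast (hm : m < n) : (md n m : ℤ) = 2 * n - m + 1 := by unfold md; omega

theorem mem_Icc_floor {a : ℤ} {ρ : ℝ} : a ∈ Icc (-⌊ρ⌋) ⌊ρ⌋ ↔ |(a : ℝ)| ≤ ρ := by
  rw [Finset.mem_Icc, abs_le, neg_le, Int.le_floor, Int.le_floor]
  push_cast
  constructor <;> rintro ⟨h1, h2⟩ <;> constructor <;> linarith

theorem mem_Box (hn : 0 < n) {ρ : ℝ} {w : ZMod (md n m)} : w ∈ Box n m ρ ↔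
    ∃ a b : ℤ, |(a : ℝ)| ≤ ρ ∧ |(b : ℝ)| * √(n : ℝ) ≤ ρ ∧ ((a + b * m : ℤ) : ZMod (md n m)) = w := by
  have h : 0 < √(n : ℝ) := Real.sqrt_pos.2 (by exact_mod_cast hn)
  unfold Box
  simp only [Finset.mem_image, Finset.mem_product, mem_Icc_floor, Prod.exists, le_div_iff₀ h, and_assoc]

theorem Box_mono (hn : 0 < n) {ρ ρ' : ℝ} (h : ρ ≤ ρ') : Box n m ρ ⊆ Box n m ρ' := by
  intro w hw
  rw [mem_Box hn] at *
  obtain ⟨a, b, h1, h2, h3⟩ := hw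
  exact ⟨a, b, h1.trans h, h2.trans h, h3⟩

theorem intCast_mem_Box (hm : m < n) {ρ : ℝ} {w : ℤ} : ((w : ℤ) : ZMod (md n m)) ∈ Box n m ρ ↔
    ∃ a b j : ℤ, |(a : ℝ)| ≤ ρ ∧ |(b : ℝ)| * √(n : ℝ) ≤ ρ ∧ w = a + b * m + j * (2 * n - m + 1) := by
  rw [mem_Box (by omega)]
  constructor
  · rintro ⟨a, b, h1, h2, h3⟩
    rw [ZMod.intCast_eq_intCast_iff_dvd_sub, md_cast hm] at h3
    obtain ⟨j, hj⟩ := h3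
    exact ⟨a, b, j, h1, h2, by linarith⟩
  · rintro ⟨a, b, j, h1, h2, h3⟩
    refine ⟨a, b, h1, h2, ?_⟩
    rw [ZMod.intCast_eq_intCast_iff_dvd_sub, md_cast hm]
    exact ⟨j, by linarith⟩

theorem abs_ediv_le {K : ℕ} {ρ : ℝ} (hρ : 1 ≤ ρ) {a : ℤ} (ha : |(a : ℝ)| ≤ K * ρ) :
    a / ⌊ρ⌋ ∈ Icc (-(2 * K : ℤ)) (2 * K) ∧ |((a % ⌊ρ⌋ : ℤ) : ℝ)| ≤ ρ := by
  have h1 : 1 ≤ ⌊ρ⌋ := by rw [Int.le_floor]; exact_mod_cast hρ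
  have h1' : (1 : ℝ) ≤ ⌊ρ⌋ := by exact_mod_cast h1
  have h2 := Int.lt_floor_add_one ρ
  have h3 : |(a : ℝ)| ≤ ((2 * K * ⌊ρ⌋ : ℤ) : ℝ) := by
    push_cast
    refine ha.trans ?_
    have : (0 : ℝ) ≤ K := by positivity
    nlinarith
  have h4 : |a| ≤ 2 * K * ⌊ρ⌋ := by exact_mod_cast h3
  rw [abs_le] at h4
  constructor
  · rw [Finset.mem_Icc]
    constructor
    · rw [Int.le_ediv_iff_mul_le (by omega)]; linarith
    · apply Int.le_of_lt_add_one
      rw [Int.ediv_lt_iff_lt_mul (by omega)]; linarith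
  · have h5 := Int.emod_nonneg a (by omega : ⌊ρ⌋ ≠ 0)
    have h6 := Int.emod_lt_of_pos a (by omega : 0 < ⌊ρ⌋)
    rw [abs_of_nonneg (by exact_mod_cast h5)]
    have : ((a % ⌊ρ⌋ : ℤ) : ℝ) ≤ ⌊ρ⌋ := by exact_mod_cast h6.le
    exact this.trans (Int.floor_le ρ)

/-- Division with remainder by the side lengths covers the large box by translates of the small one.
Each quotient lies in `[-2K, 2K]`, because the integer part of a side is at least half of it. -/
theorem card_Box_mul_le (hn : 0 < n) (K : ℕ) {ρ : ℝ} (hρ : √(n : ℝ) ≤ ρ) :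
    #(Box n m (K * ρ)) ≤ (4 * K + 1) ^ 2 * #(Box n m ρ) := by
  classical
  have h0 : 1 ≤ √(n : ℝ) := by rw [Real.one_le_sqrt]; exact_mod_cast hn
  have h0' : 0 < √(n : ℝ) := by linarith
  set s := ⌊ρ⌋
  set s' := ⌊ρ / √(n : ℝ)⌋
  have key : Box n m (K * ρ) ⊆ (Icc (-(2 * K : ℤ)) (2 * K) ×ˢ Icc (-(2 * K : ℤ)) (2 * K)).biUnion
      fun v => (Box n m ρ).image fun w => w + ((v.1 * s + v.2 * s' * m : ℤ) : ZMod (md n m)) := by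
    intro w hw
    rw [mem_Box hn] at hw
    obtain ⟨a, b, h1, h2, h3⟩ := hw
    obtain ⟨k1, k2⟩ := abs_ediv_le (by linarith) h1
    obtain ⟨k3, k4⟩ := abs_ediv_le (K := K) (ρ := ρ / √(n : ℝ)) (a := b)
      (by rwa [le_div_iff₀ h0', one_mul]) (by rwa [← mul_div_assoc, le_div_iff₀ h0'])
    rw [Finset.mem_biUnion]
    refine ⟨(a / s, b / s'), Finset.mem_product.2 ⟨k1, k3⟩, ?_⟩
    rw [Finset.mem_image]
    refine ⟨((a % s + b % s' * m : ℤ) : ZMod (md n m)), ?_, ?_⟩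
    · rw [mem_Box hn]
      exact ⟨_, _, k2, by rwa [← le_div_iff₀ h0'], rfl⟩
    · rw [← h3, ← Int.cast_add]
      congr 1
      have e1 := Int.emod_add_mul_ediv a s
      have e2 := Int.emod_add_mul_ediv b s'
      dsimp only
      linear_combination e1 + m * e2
  refine (Finset.card_le_card key).trans ((Finset.card_biUnion_le_card_mul _ _ _
    fun v _ => Finset.card_image_le).trans (le_of_eq ?_))
  rw [Finset.card_product, Int.card_Icc]
  have : (2 * K + 1 - -(2 * K : ℤ)).toNat = 4 * K + 1 := by omega
  rw [this, sq]

theorem card_Icc_floor_le {ρ : ℝ} (hρ : 0 ≤ ρ) : (#(Icc (-⌊ρ⌋) ⌊ρ⌋) : ℝ) ≤ 2 * ρ + 1 := by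
  rw [Int.card_Icc]
  have h1 : 0 ≤ ⌊ρ⌋ := Int.floor_nonneg.2 hρ
  have h2 : (((⌊ρ⌋ + 1 - -⌊ρ⌋).toNat : ℤ) : ℝ) = ((⌊ρ⌋ + 1 - -⌊ρ⌋ : ℤ) : ℝ) := by
    rw [Int.toNat_of_nonneg (by omega)]
  have h3 := Int.floor_le ρ
  push_cast at h2
  rw [h2]; linarith

/-- If `κ m ≡ a`, then `(-a, κ)` represents 0. Adding these pairs to one representation of a residue
gives `γ` different pairs in a rectangle of twice the size, and pairs of different residues differ.
So `#Box * γ` is at most the number of integer points there. -/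
theorem card_Box_mul_gam_le (hn : 0 < n) (hm : m < n) {l ρ : ℝ} (hl : √(n : ℝ) ≤ l) (hρ : l ≤ ρ) :
    (#(Box n m ρ) : ℝ) * gam l n m ≤ 25 * ρ ^ 2 / √(n : ℝ) := by
  classical
  have h0 : 1 ≤ √(n : ℝ) := by rw [Real.one_le_sqrt]; exact_mod_cast hn
  have h0' : 0 < √(n : ℝ) := by linarith
  set G : Set ℕ := {κ : ℕ | (absM n m ((κ : ℤ) * m) : ℝ) < l ∧ (κ : ℝ) < l / √(n : ℝ)} with hG
  have hfin : G.Finite := by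
    refine (Set.finite_Iio (⌈l / √(n : ℝ)⌉₊)).subset fun κ hκ => ?_
    have h1 : (κ : ℝ) < ⌈l / √(n : ℝ)⌉₊ := hκ.2.trans_le (Nat.le_ceil _)
    exact_mod_cast h1
  have hgam : gam l n m = #hfin.toFinset := Set.ncard_eq_toFinset_card _ hfin
  have hab : ∀ κ ∈ hfin.toFinset, ∃ a : ℤ, |(a : ℝ)| ≤ l ∧ (κ : ℝ) * √(n : ℝ) ≤ l ∧
      ((κ * m : ℤ) : ZMod (md n m)) = (a : ℤ) := by
    intro κ hκ
    rw [Set.Finite.mem_toFinset] at hκ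
    obtain ⟨h1, h2⟩ := hκ
    have hne : {r : ℕ | ∃ a : ℤ, (κ : ℤ) * m ≡ a [ZMOD (2 * (n : ℤ) - m + 1)] ∧ r = a.natAbs}.Nonempty :=
      ⟨_, _, Int.ModEq.refl _, rfl⟩
    obtain ⟨a, h3, h4⟩ := Nat.sInf_mem hne
    refine ⟨a, ?_, ?_, ?_⟩
    · unfold absM at h1
      rw [h4] at h1
      rw [← Int.cast_abs, Int.abs_eq_natAbs, Int.cast_natCast]
      exact h1.le
    · rw [lt_div_iff₀ h0'] at h2
      exact h2.le
    · rwa [ZMod.intCast_eq_intCast_iff, md_cast hm]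
  have hrep : ∀ w ∈ Box n m ρ, ∃ a b : ℤ, |(a : ℝ)| ≤ ρ ∧ |(b : ℝ)| * √(n : ℝ) ≤ ρ ∧
      ((a + b * m : ℤ) : ZMod (md n m)) = w := fun w hw => (mem_Box hn).1 hw
  choose! fa hfa1 hfa2 hfa3 using hab
  choose! ga gb hg1 hg2 hg3 using hrep
  have hcard : #(Box n m ρ ×ˢ hfin.toFinset) ≤
      #(Icc (-⌊2 * ρ⌋) ⌊2 * ρ⌋ ×ˢ Icc (-⌊2 * ρ / √(n : ℝ)⌋) ⌊2 * ρ / √(n : ℝ)⌋) := by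
    apply Finset.card_le_card_of_injOn (fun v => (ga v.1 - fa v.2, gb v.1 + v.2))
    · rintro ⟨w, κ⟩ hv
      rw [Finset.mem_coe, Finset.mem_product] at hv
      obtain ⟨hw, hκ⟩ := hv
      rw [Finset.mem_coe, Finset.mem_product, mem_Icc_floor, mem_Icc_floor, le_div_iff₀ h0']
      push_cast
      constructor
      · exact (abs_sub _ _).trans (by linarith [hg1 w hw, hfa1 κ hκ])
      · refine (mul_le_mul_of_nonneg_right (abs_add_le _ _) h0'.le).trans ?_
        rw [add_mul, abs_of_nonneg (by positivity : (0 : ℝ) ≤ κ)]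
        linarith [hg2 w hw, hfa2 κ hκ]
    · rintro ⟨w, κ⟩ hv ⟨w', κ'⟩ hv' he
      rw [Finset.mem_coe, Finset.mem_product] at hv hv'
      simp only [Prod.mk.injEq] at he
      have e : ∀ w ∈ Box n m ρ, ∀ κ ∈ hfin.toFinset,
          ((ga w - fa κ + (gb w + κ) * m : ℤ) : ZMod (md n m)) = w := by
        intro w hw κ hκ
        have h1 := hg3 w hw
        have h2 := hfa3 κ hκ
        push_cast at *
        linear_combination h1 + h2
      have h1 := e w hv.1 κ hv.2
      have h2 := e w' hv'.1 κ' hv'.2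
      rw [he.1, he.2, h2] at h1
      subst h1
      have := he.2
      simp only [Prod.mk.injEq, true_and]
      omega
  rw [Finset.card_product, Finset.card_product, ← hgam] at hcard
  have h1 := card_Icc_floor_le (by linarith : 0 ≤ 2 * ρ)
  have hρ0 : 0 < ρ := by linarith
  have h2 := card_Icc_floor_le (by positivity : 0 ≤ 2 * ρ / √(n : ℝ))
  have h3 : (#(Box n m ρ) : ℝ) * gam l n m ≤
      #(Icc (-⌊2 * ρ⌋) ⌊2 * ρ⌋) * #(Icc (-⌊2 * ρ / √(n : ℝ)⌋) ⌊2 * ρ / √(n : ℝ)⌋) := by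
    exact_mod_cast hcard
  refine h3.trans ((mul_le_mul h1 h2 (by positivity) (by linarith)).trans ?_)
  have h4 : 2 * (2 * ρ / √(n : ℝ)) + 1 ≤ 5 * ρ / √(n : ℝ) := by
    rw [mul_div_assoc', div_add_one h0'.ne']; gcongr; linarith
  have h5 : 2 * (2 * ρ) + 1 ≤ 5 * ρ := by linarith
  refine (mul_le_mul h5 h4 (by positivity) (by linarith)).trans (le_of_eq (by ring))

theorem abs_g_sub_le (hm : m < n) (x y : Fin n) : |g n m y - g n m x| ≤ 2 * n - m - 1 := by
  have h1 := g_le (m := m) x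
  have h2 := g_le (m := m) y
  have h3 := le_g hm x
  have h4 := le_g hm y
  rw [abs_le]; constructor <;> omega

/-- The residue of the displacement which belongs to the drift in `t` rounds. -/
def drift (n m : ℕ) (t : ℤ) : ℤ := t + t / (2 * n) - t / (2 * n) * m

theorem abs_le_of_mul_eq {n i w : ℤ} {ζ : ℝ} (hn : 0 < n) {B : ℝ} (h : 2 * n * i = w)
    (hw : |(w : ℝ)| ≤ 2 * n * B) (hB : B ≤ ζ) : |(i : ℝ)| ≤ ζ := by
  have hn' : (0 : ℝ) < 2 * n := by have : (0 : ℝ) < n := by exact_mod_cast hn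
                                   linarith
  have h' : (2 * n * i : ℝ) = w := by exact_mod_cast h
  rw [← h', abs_mul, abs_of_pos hn'] at hw
  exact (le_of_mul_le_mul_left hw hn').trans hB

/-- With `V = 2 k - Z` the displacement is `α - 2 n k + m Z`, and `2 n ≡ m - 1`. As `g` is bounded,
`k` is `t / (2 n)` up to `3 + |Z| / 2`, so only this small difference enters the coefficients
besides the drift. -/
theorem Near.mem_Box (hm : m < n) {t : ℤ} {ρ : ℝ} (hρ : ρ ≤ n) {x y : Fin n}
    (h : Near n m t ρ x y) :
    ((g n m y - g n m x - drift n m t : ℤ) : ZMod (md n m)) ∈ Box n m (2 * ρ + 5 * √(n : ℝ)) := by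
  obtain ⟨α, Z, ⟨V, h1, h2⟩, h3, h4⟩ := h
  have hn1 : (1 : ℝ) ≤ n := by exact_mod_cast (by omega : 1 ≤ n)
  have h0 : 1 ≤ √(n : ℝ) := by rwa [Real.one_le_sqrt]
  have hmn : (m : ℝ) ≤ n := by exact_mod_cast hm.le
  obtain ⟨k, hk⟩ : ∃ k, V = 2 * k - Z := ⟨(V + Z) / 2, by omega⟩
  subst hk
  set q := t / (2 * n) with hq
  have hn2 : (0 : ℤ) < 2 * n := by omega
  have e1 := Int.emod_add_mul_ediv t (2 * n)
  have e2 := Int.emod_nonneg t hn2.ne'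
  have e3 := Int.emod_lt_of_pos t hn2
  rw [← hq] at e1
  set t' := t % (2 * n)
  have hgd := abs_g_sub_le hm x y
  have hi : |((q - k : ℤ) : ℝ)| ≤ 3 + |(Z : ℝ)| / 2 := by
    refine abs_le_of_mul_eq (n := n) (i := q - k) (w := g n m y - g n m x - t' - α - m * Z) (B := 3 + |(Z : ℝ)| / 2)
      (by omega) ?_ ?_ le_rfl
    · linarith
    · have k1 : |((g n m y - g n m x : ℤ) : ℝ)| ≤ 2 * n := by
        have : |g n m y - g n m x| ≤ 2 * n := by omega
        exact_mod_cast this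
      have k2 : (0 : ℝ) ≤ t' := by exact_mod_cast e2
      have k3 : (t' : ℝ) ≤ 2 * n := by exact_mod_cast e3.le
      have k4 : |(m * Z : ℝ)| ≤ n * |(Z : ℝ)| := by
        rw [abs_mul, abs_of_nonneg (by positivity : (0 : ℝ) ≤ m)]; gcongr
      push_cast at *
      rw [abs_le] at *
      constructor <;> linarith [k1.1, k1.2, k4.1, k4.2, h3.1, h3.2]
  have hZ : |(Z : ℝ)| ≤ ρ := by nlinarith [abs_nonneg (Z : ℝ)]
  rw [intCast_mem_Box hm]
  refine ⟨α - (q - k), Z + (q - k), -k, ?_, ?_, ?_⟩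
  · have := abs_sub (α : ℝ) ((q - k : ℤ) : ℝ)
    push_cast at *
    linarith [abs_nonneg (Z : ℝ)]
  · have := abs_add_le (Z : ℝ) ((q - k : ℤ) : ℝ)
    have h5 : |((Z + (q - k) : ℤ) : ℝ)| ≤ 3 / 2 * |(Z : ℝ)| + 3 := by push_cast at *; linarith
    have := mul_le_mul_of_nonneg_right h5 (by linarith : 0 ≤ √(n : ℝ))
    linarith [abs_nonneg (Z : ℝ)]
  · unfold drift
    rw [← hq]
    linarith

theorem near_of_mem_Box (hm : m < n) {t : ℤ} {ρ : ℝ} (hρ : ρ ≤ n) {x y : Fin n}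
    (h : ((g n m y - g n m x - drift n m t : ℤ) : ZMod (md n m)) ∈ Box n m ρ) :
    Near n m t (2 * ρ + 6 * √(n : ℝ)) x y := by
  rw [intCast_mem_Box hm] at h
  obtain ⟨a, b, j, h1, h2, h3⟩ := h
  have hn1 : (1 : ℝ) ≤ n := by exact_mod_cast (by omega : 1 ≤ n)
  have h0 : 1 ≤ √(n : ℝ) := by rwa [Real.one_le_sqrt]
  have hmn : (m : ℝ) ≤ n := by exact_mod_cast hm.le
  set q := t / (2 * n) with hq
  have hn2 : (0 : ℤ) < 2 * n := by omega
  have e1 := Int.emod_add_mul_ediv t (2 * n)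
  have e2 := Int.emod_nonneg t hn2.ne'
  have e3 := Int.emod_lt_of_pos t hn2
  rw [← hq] at e1
  set t' := t % (2 * n)
  have hgd := abs_g_sub_le hm x y
  have hb : |(b : ℝ)| ≤ ρ := by nlinarith [abs_nonneg (b : ℝ)]
  have hi : |((j + q : ℤ) : ℝ)| ≤ 5 + |(b : ℝ)| := by
    have h5 : ((2 * n - m + 1 : ℤ) : ℝ) * ((j + q : ℤ) : ℝ) =
        ((g n m y - g n m x - t' - a - b * m : ℤ) : ℝ) := by
      unfold drift at h3
      rw [← hq] at h3
      rw [← Int.cast_mul]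
      congr 1
      linarith
    have k1 : |((g n m y - g n m x : ℤ) : ℝ)| ≤ 2 * n := by
      have : |g n m y - g n m x| ≤ 2 * n := by omega
      exact_mod_cast this
    have k2 : (0 : ℝ) ≤ t' := by exact_mod_cast e2
    have k3 : (t' : ℝ) ≤ 2 * n := by exact_mod_cast e3.le
    have k4 : |(b * m : ℝ)| ≤ |(b : ℝ)| * n := by
      rw [abs_mul, abs_of_nonneg (by positivity : (0 : ℝ) ≤ m)]; gcongr
    have k5 : |((g n m y - g n m x - t' - a - b * m : ℤ) : ℝ)| ≤ n * (5 + |(b : ℝ)|) := by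
      push_cast at *
      rw [abs_le] at *
      constructor <;> linarith [k1.1, k1.2, k4.1, k4.2, h1.1, h1.2]
    rw [← h5, abs_mul] at k5
    have k6 : (n : ℝ) ≤ |((2 * n - m + 1 : ℤ) : ℝ)| := by
      rw [abs_of_nonneg] <;> push_cast <;> linarith
    have k7 := mul_le_mul_of_nonneg_right k6 (abs_nonneg ((j + q : ℤ) : ℝ))
    exact le_of_mul_le_mul_left (k7.trans k5) (by linarith)
  refine ⟨a + (j + q), b - (j + q), ⟨-b - (j + q) + 2 * q, by omega, ?_⟩, ?_, ?_⟩
  · unfold drift at h3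
    rw [← hq] at h3
    linarith
  · have := abs_add_le (a : ℝ) ((j + q : ℤ) : ℝ)
    push_cast at *
    linarith
  · have := abs_sub (b : ℝ) ((j + q : ℤ) : ℝ)
    have h5 : |((b - (j + q) : ℤ) : ℝ)| ≤ 2 * |(b : ℝ)| + 5 := by push_cast at *; linarith
    have := mul_le_mul_of_nonneg_right h5 (by linarith : 0 ≤ √(n : ℝ))
    linarith

open Classical in
/-- The positions near the expected position of a card. -/
noncomputable def nbh (n m : ℕ) (t : ℤ) (ρ : ℝ) (x : Fin n) : Finset (Fin n) :=
  Finset.univ.filter fun y => Near n m t ρ x y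

theorem mem_nbh {t : ℤ} {ρ : ℝ} {x y : Fin n} : y ∈ nbh n m t ρ x ↔ Near n m t ρ x y := by
  unfold nbh; simp

theorem card_nbh_le (hm : m < n) (t : ℤ) {ρ : ℝ} (hρ : ρ ≤ n) (x : Fin n) :
    #(nbh n m t ρ x) ≤ #(Box n m (2 * ρ + 5 * √(n : ℝ))) := by
  apply Finset.card_le_card_of_injOn
    (fun y => ((g n m y - g n m x - drift n m t : ℤ) : ZMod (md n m)))
  · intro y hy
    exact (mem_nbh.1 (Finset.mem_coe.1 hy)).mem_Box hm hρ
  · intro y _ y' _ h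
    dsimp only at h
    rw [ZMod.intCast_eq_intCast_iff_dvd_sub, md_cast hm] at h
    have h1 := abs_g_sub_le hm y y'
    have e : g n m y' - g n m x - drift n m t - (g n m y - g n m x - drift n m t) =
      g n m y' - g n m y := by ring
    rw [e] at h
    have := Int.eq_zero_of_abs_lt_dvd h (by omega)
    apply g_injective (m := m)
    omega

/-- The values of `g` miss only 0 and the even negative numbers of an interval, so of two
consecutive residues at least one is attained. -/
theorem exists_g_modEq (hm2 : 2 ≤ m) (hm : m < n) (v : ℤ) : ∃ y : Fin n,
    ((g n m y : ℤ) : ZMod (md n m)) = v ∨ ((g n m y : ℤ) : ZMod (md n m)) = v + 1 := by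
  have hM : (0 : ℤ) < 2 * n - m + 1 := by omega
  set w := (v - (2 * m - 2 * n)) % (2 * n - m + 1) + (2 * m - 2 * n) with hw
  have h1 := Int.emod_nonneg (v - (2 * m - 2 * n)) hM.ne'
  have h2 := Int.emod_lt_of_pos (v - (2 * m - 2 * n)) hM
  have h3 : ((w : ℤ) : ZMod (md n m)) = v := by
    rw [ZMod.intCast_eq_intCast_iff_dvd_sub, md_cast hm]
    have := Int.emod_add_mul_ediv (v - (2 * m - 2 * n)) (2 * n - m + 1)
    exact ⟨(v - (2 * m - 2 * n)) / (2 * n - m + 1), by linarith⟩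
  have h4 : ((w + 1 : ℤ) : ZMod (md n m)) = v + 1 := by rw [Int.cast_add, h3, Int.cast_one]
  rcases lt_trichotomy w 0 with h | h | h
  · rcases Int.emod_two_eq_zero_or_one w with h5 | h5
    · obtain ⟨y, hy⟩ := exists_g_neg (n := n) (m := m) (v := w + 1) (by omega) (by omega) (by omega)
      exact ⟨y, Or.inr (by rw [hy, h4])⟩
    · obtain ⟨y, hy⟩ := exists_g_neg (n := n) (m := m) (v := w) (by omega) (by omega) (by omega)
      exact ⟨y, Or.inl (by rw [hy, h3])⟩
  · obtain ⟨y, hy⟩ := exists_g_pos hm (v := w + 1) (by omega) (by omega)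
    exact ⟨y, Or.inr (by rw [hy, h4])⟩
  · obtain ⟨y, hy⟩ := exists_g_pos hm (v := w) (by omega) (by omega)
    exact ⟨y, Or.inl (by rw [hy, h3])⟩

/-- A residue of the box or its successor belongs to a position of the neighbourhood; hence the
factor 2 and the radius `ρ + 1`. -/
theorem le_card_nbh (hm2 : 2 ≤ m) (hm : m < n) (t : ℤ) {ρ : ℝ} (hρ : ρ + 1 ≤ n) (x : Fin n) :
    #(Box n m ρ) ≤ 2 * #(nbh n m t (2 * (ρ + 1) + 6 * √(n : ℝ)) x) := by
  classical
  set S := nbh n m t (2 * (ρ + 1) + 6 * √(n : ℝ)) x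
  set φ : Fin n → ZMod (md n m) := fun y => ((g n m y - g n m x - drift n m t : ℤ) : ZMod (md n m))
  have hn : 0 < n := by omega
  have hsub : Box n m ρ ⊆ S.image φ ∪ S.image fun y => φ y - 1 := by
    intro w hw
    rw [mem_Box hn] at hw
    obtain ⟨a, b, h1, h2, h3⟩ := hw
    have hw1 : w ∈ Box n m (ρ + 1) :=
      Box_mono hn (by linarith) ((mem_Box hn).2 ⟨a, b, h1, h2, h3⟩)
    have hw2 : w + 1 ∈ Box n m (ρ + 1) := by
      refine (mem_Box hn).2 ⟨a + 1, b, ?_, by linarith, ?_⟩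
      · push_cast
        refine (abs_add_le _ _).trans ?_
        rw [abs_one]; linarith
      · rw [← h3]; push_cast; ring
    obtain ⟨y, hy⟩ := exists_g_modEq hm2 hm (a + b * m + g n m x + drift n m t)
    rw [Finset.mem_union, Finset.mem_image, Finset.mem_image]
    rcases hy with hy | hy
    · have e : φ y = w := by
        simp only [φ]; push_cast at *; rw [hy, ← h3]; ring
      exact Or.inl ⟨y, mem_nbh.2 (near_of_mem_Box hm hρ (by rw [← e] at hw1; exact hw1)), e⟩
    · have e : φ y = w + 1 := by
        simp only [φ]; push_cast at *; rw [hy, ← h3]; ring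
      exact Or.inr ⟨y, mem_nbh.2 (near_of_mem_Box hm hρ (by rw [← e] at hw2; exact hw2)),
        by rw [e]; ring⟩
  refine (Finset.card_le_card hsub).trans ((Finset.card_union_le _ _).trans ?_)
  have h1 := Finset.card_image_le (s := S) (f := φ)
  have h2 := Finset.card_image_le (s := S) (f := fun y => φ y - 1)
  omega

theorem p_sub_p (x y : Fin n) : ∃ e : ℤ, p n m x - p n m y = g n m x - g n m y + e * (2 * n - m + 1) := by
  rcases p_eq_g (m := m) x with h | h <;> rcases p_eq_g (m := m) y with h' | h' <;> rw [h, h']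
  · exact ⟨0, by ring⟩
  · exact ⟨-1, by ring⟩
  · exact ⟨1, by ring⟩
  · exact ⟨0, by ring⟩

theorem mem_Box_of_wdist_lt (hm : m < n) {r : ℝ} {x y : Fin n} (h : wdist n m x y < r) :
    ((g n m y - g n m x : ℤ) : ZMod (md n m)) ∈ Box n m r := by
  unfold wdist wnorm at h
  have hne : {r : ℝ | ∃ (a : ℝ) (b q : ℤ), (p n m x : ℝ) - p n m y =
      a + b * m + q * (2 * (n : ℝ) - m + 1) ∧ r = |a| + |(b : ℝ)| * √(n : ℝ)}.Nonempty :=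
    ⟨_, (p n m x : ℝ) - p n m y, 0, 0, by simp, rfl⟩
  obtain ⟨s, ⟨a, b, q, h1, h2⟩, h3⟩ := exists_lt_of_csInf_lt hne h
  obtain ⟨e, he⟩ := p_sub_p (m := m) x y
  rw [intCast_mem_Box hm]
  -- The real number `a` in the norm is an integer here, since all other terms are.
  have ha : a = ((p n m x - p n m y - b * m - q * (2 * n - m + 1) : ℤ) : ℝ) := by
    push_cast; linarith
  have h0 := Real.sqrt_nonneg (n : ℝ)
  have k1 := abs_nonneg a
  have k2 := mul_nonneg (abs_nonneg (b : ℝ)) h0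
  refine ⟨-(p n m x - p n m y - b * m - q * (2 * n - m + 1)), -b, e - q, ?_, ?_, ?_⟩
  · rw [Int.cast_neg, abs_neg, ← ha]; linarith
  · rw [Int.cast_neg, abs_neg]; linarith
  · linarith

theorem wnorm_le {ω a : ℝ} {b q : ℤ} (h : ω = a + b * m + q * (2 * (n : ℝ) - m + 1)) :
    wnorm n m ω ≤ |a| + |(b : ℝ)| * √(n : ℝ) := by
  refine csInf_le ⟨0, ?_⟩ ⟨a, b, q, h, rfl⟩
  rintro r ⟨a, b, q, -, rfl⟩
  positivity

theorem wdist_le_of_mem_Box (hm : m < n) {ρ : ℝ} {x y : Fin n}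
    (h : ((g n m y - g n m x : ℤ) : ZMod (md n m)) ∈ Box n m ρ) : wdist n m x y ≤ 2 * ρ := by
  rw [intCast_mem_Box hm] at h
  obtain ⟨a, b, j, h1, h2, h3⟩ := h
  obtain ⟨e, he⟩ := p_sub_p (m := m) x y
  have : ((p n m x : ℝ) - p n m y) = ((-a : ℤ) : ℝ) + ((-b : ℤ) : ℝ) * m +
      ((e - j : ℤ) : ℝ) * (2 * (n : ℝ) - m + 1) := by
    have h4 : p n m x - p n m y = -a + -b * m + (e - j) * (2 * n - m + 1) := by linarith
    exact_mod_cast h4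
  unfold wdist
  refine (wnorm_le this).trans ?_
  push_cast
  rw [abs_neg, abs_neg]
  linarith

theorem wdist_le (hm : m < n) (x y : Fin n) : wdist n m x y ≤ 2 * n := by
  have : ((p n m x : ℝ) - p n m y) = ((p n m x - p n m y : ℤ) : ℝ) + ((0 : ℤ) : ℝ) * m +
      ((0 : ℤ) : ℝ) * (2 * (n : ℝ) - m + 1) := by push_cast; ring
  unfold wdist
  refine (wnorm_le this).trans ?_
  have h : |p n m x - p n m y| ≤ 2 * n := by
    have hx := x.2
    have hy := y.2
    unfold p
    rw [abs_le]; split_ifs <;> constructor <;> omega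
  have h' : |((p n m x - p n m y : ℤ) : ℝ)| ≤ 2 * n := by exact_mod_cast h
  simpa using h'

end Boxes
end OverlappingCycles

/-! ### Most triples near the expected one are hit -/

namespace OverlappingCycles

open Finset

section Ergodic

variable {n m : ℕ}

theorem Ex_mono_cons (hm2 : 2 ≤ m) (hm : m < n) {x : Fin 3 → Fin n} (t : ℕ) {F G : Aug n → ℝ}
    {s : ℤ} (h : ∀ z, Cons n m x (s + t) z → F z ≤ G z) {y : Aug n} (hy : Cons n m x s y) :
    Ex (astep n m) t F y ≤ Ex (astep n m) t G y := by
  induction t generalizing s y with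
  | zero => exact h y (by simpa using hy)
  | succ t ih =>
    rw [Ex_succ, Ex_succ]
    refine avg_mono _ _ fun c => ih (s := s + 1) (fun z hz => h z ?_) (hy.step hm2 hm c)
    push_cast
    rwa [add_comm (t : ℤ) 1, ← add_assoc]

open Classical in
theorem one_sub_le_Ex_near (hm2 : 2 ≤ m) (hm : m < n) {ρ : ℝ} (hρ : 0 < ρ) (t : ℕ)
    (x : Fin 3 → Fin n) : 1 - 3 * (t + n * (t / m + 1)) / ρ ^ 2 ≤
      Ex (step n m) t (fun y => if ∀ a, Near n m t ρ (x a) (y a) then 1 else 0) x := by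
  have h1 : Ex (astep n m) t (Psi n m ρ 0) ⟨x, 0, 0⟩ ≤ Psi n m ρ t ⟨x, 0, 0⟩ :=
    Ex_le_of_inv (I := fun _ => True) (astep n m) (fun _ _ _ => trivial)
      (Φ := fun t y => Psi n m ρ t y) (fun t y _ => avg_Psi_le hm2 hm ρ t y) t trivial
  have h2 : Psi n m ρ t ⟨x, 0, 0⟩ ≤ 3 * (t + n * (t / m + 1)) / ρ ^ 2 := by
    unfold Psi
    have h3 : ∀ a : Fin 3, (((0 : Fin 3 → ℤ) a : ℝ) ^ 2 + t +
        n * (((0 : Fin 3 → ℤ) a : ℝ) ^ 2 + vb n m t (x a))) / ρ ^ 2 ≤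
        (t + n * (t / m + 1)) / ρ ^ 2 := by
      intro a
      have hv := mul_le_mul_of_nonneg_left (vb_le hm2 t (x a)) (by positivity : (0 : ℝ) ≤ n)
      apply div_le_div_of_nonneg_right _ (by positivity)
      simp
      linarith
    refine (Finset.sum_le_sum fun a _ => h3 a).trans (le_of_eq ?_)
    simp
    ring
  have h3 := Ex_mono_cons hm2 hm t (F := fun y => 1 - Psi n m ρ 0 y)
    (G := fun y => if ∀ a, Near n m t ρ (x a) (y.pos a) then 1 else 0) (s := 0) ?_ (cons_start x)
  · rw [Ex_sub, Ex_const, Ex_astep t (fun y => if ∀ a, Near n m t ρ (x a) (y a) then (1 : ℝ) else 0)] at h3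
    linarith
  · intro y hy
    split_ifs with h
    · linarith [Psi_nonneg (m := m) ρ 0 y]
    · push Not at h
      obtain ⟨a, ha⟩ := h
      have h5 := one_le_Psi (m := m) hρ 0 y a (by
        by_contra hcon
        push Not at hcon
        have h6 := hy a
        rw [zero_add] at h6
        exact ha ⟨_, _, h6, hcon.1, hcon.2⟩)
      linarith

open Classical in
theorem exists_near_steer {ε : ℝ} (hε : 0 < ε) : ∃ K p : ℝ, 0 < K ∧ 0 < p ∧ ∃ N : ℕ,
    ∀ n m : ℕ, N ≤ n → 2 ≤ m → m < n → ε * n ≤ m → ε * n ≤ (n : ℝ) - m →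
    ∀ (t k : ℕ) (ρ ρ' : ℝ) (x z : Fin 3 → Fin n), 5 * n ≤ t → Function.Injective x →
    (∀ a, Near n m (k * t : ℕ) ρ (x a) (z a)) → 6 * ρ ^ 2 ≤ 400 * (k * t) → 0 ≤ ρ' →
    K ^ 2 * t ≤ ρ' ^ 2 →
    p ^ k ≤ Ex (step n m) (k * t) (fun w => if ∀ a, Near n m 0 ρ' (z a) (w a) then (1 : ℝ) else 0) x := by
  obtain ⟨K, p, hK, hp, N, hN⟩ := exists_steer hε
  refine ⟨K, p, hK, hp, N, ?_⟩
  intro n m hn hm2 hm h1 h2 t k ρ ρ' x z ht hx hz hρ hρ' hKt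
  choose α ζ hl hα hζ using hz
  have hd : dist2 (fun a => (α a : ℝ)) (fun a => (ζ a : ℝ)) (⟨x, 0, 0⟩ : Aug n) ≤ 400 * (k * t) := by
    refine le_trans ?_ hρ
    unfold dist2
    have : ∀ a : Fin 3, ((((0 : Fin 3 → ℤ) a : ℝ) - α a) ^ 2 + n * (((0 : Fin 3 → ℤ) a : ℝ) - ζ a) ^ 2) ≤
        2 * ρ ^ 2 := by
      intro a
      have k1 : (α a : ℝ) ^ 2 ≤ ρ ^ 2 := by
        rw [← sq_abs]; exact pow_le_pow_left₀ (abs_nonneg _) (hα a) 2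
      have k2 : (|(ζ a : ℝ)| * √(n : ℝ)) ^ 2 ≤ ρ ^ 2 := pow_le_pow_left₀ (by positivity) (hζ a) 2
      rw [mul_pow, sq_abs, Real.sq_sqrt (by positivity)] at k2
      simp
      linarith
    refine (Finset.sum_le_sum fun a _ => this a).trans (le_of_eq ?_)
    simp
    ring
  refine (hN n m hn hm2 hm h1 h2 _ _ t k ⟨x, 0, 0⟩ ht hx hd).trans ?_
  rw [← Ex_astep (k * t) (fun w => if ∀ a, Near n m 0 ρ' (z a) (w a) then (1 : ℝ) else 0)
    (⟨x, 0, 0⟩ : Aug n)]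
  refine Ex_mono_cons hm2 hm (k * t) (s := 0) (fun y hy => ?_) (cons_start x)
  split_ifs with h3 h4
  · exact le_rfl
  · exfalso
    apply h4
    intro a
    have h5 := (hy a).sub (hl a)
    have h6 : (y.A a - α a : ℝ) ^ 2 + n * (y.Z a - ζ a : ℝ) ^ 2 ≤ ρ' ^ 2 := by
      refine le_trans ?_ (h3.trans hKt)
      unfold dist2
      exact Finset.single_le_sum (f := fun a => (y.A a - α a : ℝ) ^ 2 + n * (y.Z a - ζ a : ℝ) ^ 2)
        (fun b _ => by positivity) (Finset.mem_univ a)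
    refine ⟨y.A a - α a, y.Z a - ζ a, ?_, ?_, ?_⟩
    · convert h5 using 1; ring
    · apply abs_le_of_sq_le_sq _ hρ'
      push_cast
      have : 0 ≤ n * (y.Z a - ζ a : ℝ) ^ 2 := by positivity
      linarith
    · apply abs_le_of_sq_le_sq' _ hρ' |>.2
      rw [mul_pow, sq_abs, Real.sq_sqrt (by positivity)]
      push_cast
      nlinarith [sq_nonneg (y.A a - α a : ℝ)]
  · norm_num
  · exact le_rfl

/-- The cards in `x` are far from each other. -/
def Sep (n m : ℕ) (ρ : ℝ) (x : Fin 3 → Fin n) : Prop :=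
  ∀ a b, a ≠ b → ¬ Near n m 0 ρ (x a) (x b)

theorem near_self {ρ : ℝ} (hρ : 0 ≤ ρ) (x : Fin n) : Near n m 0 ρ x x :=
  ⟨0, 0, by simpa using lat_self (n := n) (m := m) 0, by simpa using hρ, by simpa using hρ⟩

theorem Sep.injective {ρ : ℝ} (hρ : 0 ≤ ρ) {x : Fin 3 → Fin n} (h : Sep n m ρ x) :
    Function.Injective x := by
  intro a b hab
  by_contra hne
  exact h a b hne (hab ▸ near_self hρ (x a))

theorem Sep.of_near {t : ℤ} {ρ ρ₁ ρ₂ : ℝ} (hρ : ρ + 2 * ρ₁ ≤ ρ₂) {x z : Fin 3 → Fin n}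
    (h : Sep n m ρ₂ x) (hz : ∀ a, Near n m t ρ₁ (x a) (z a)) : Sep n m ρ z := by
  intro a b hab hn
  refine h a b hab ?_
  have := ((hz a).trans hn).trans (hz b).symm
  rw [show t + 0 + -t = 0 by ring] at this
  exact this.mono (by linarith)

/-- The three cards are moved one after the other; by the separation of `z` the intermediate triples
remain separated. -/
theorem abs_Ex_sub_le_of_cards {η r l : ℝ} (hl : 0 ≤ l) (hr0 : 0 ≤ r) (hr : r ≤ 1) {T : ℕ}
    {F : (Fin 3 → Fin n) → ℝ}
    (hreg : ∀ (a : Fin 3) (x y : Fin 3 → Fin n), Function.Injective x → Function.Injective y →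
      (∀ b, b ≠ a → y b = x b) → Near n m 0 (r * l) (x a) (y a) →
      (∀ b, b ≠ a → ¬ Near n m 0 (4 * l) (x a) (x b)) →
      |Ex (step n m) T F x - Ex (step n m) T F y| ≤ η) {z w : Fin 3 → Fin n}
    (hz : Sep n m (6 * l) z) (hw : ∀ a, Near n m 0 (r * l) (z a) (w a)) :
    |Ex (step n m) T F z - Ex (step n m) T F w| ≤ 3 * η := by
  set u : ℕ → Fin 3 → Fin n := fun k a => if (a : ℕ) < k then w a else z a with hu
  have hrl : r * l ≤ l := mul_le_of_le_one_left hl hr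
  have hrl0 : 0 ≤ r * l := mul_nonneg hr0 hl
  have hsep : ∀ k, Sep n m (4 * l) (u k) := by
    intro k
    refine hz.of_near (t := 0) (ρ₁ := r * l) (by linarith) fun a => ?_
    simp only [hu]
    split_ifs
    · exact hw a
    · exact near_self hrl0 _
  have hinj : ∀ k, Function.Injective (u k) := fun k => (hsep k).injective (by linarith)
  have hstep : ∀ a : Fin 3, |Ex (step n m) T F (u a) - Ex (step n m) T F (u (a + 1))| ≤ η := by
    intro a
    refine hreg a _ _ (hinj _) (hinj _) ?_ ?_ fun b hb => hsep _ a b hb.symm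
    · intro b hb
      simp only [hu]
      have : (b : ℕ) ≠ a := fun h => hb (Fin.ext h)
      by_cases h : (b : ℕ) < a
      · rw [if_pos h, if_pos (by omega)]
      · rw [if_neg h, if_neg (by omega)]
    · simp only [hu]
      rw [if_neg (lt_irrefl _), if_pos (by omega)]
      exact hw a
  have h0 := hstep 0
  have h1 := hstep 1
  have h2 := hstep 2
  have e0 : u 0 = z := by funext a; simp [hu]
  have e3 : u 3 = w := by funext a; simp [hu, a.2]
  simp only [Fin.val_zero, Fin.val_one, Fin.val_two, Nat.zero_add, Nat.reduceAdd] at h0 h1 h2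
  rw [e0] at h0
  rw [e3] at h2
  rw [abs_le] at *
  constructor <;> linarith [h0.1, h0.2, h1.1, h1.2, h2.1, h2.2]

/-- The probability to get from `x` to `y` in `t` rounds. -/
noncomputable def tr (n m t : ℕ) (x y : Fin 3 → Fin n) : ℝ :=
  Ex (step n m) t (fun z => if z = y then (1 : ℝ) else 0) x

theorem tr_nonneg (t : ℕ) (x y : Fin 3 → Fin n) : 0 ≤ tr n m t x y :=
  Ex_nonneg _ (fun z => by split_ifs <;> norm_num) t x

theorem tr_reverse (hm2 : 2 ≤ m) (hm : m < n) (t : ℕ) (x y : Fin 3 → Fin n) :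
    tr n m t x y = tr n m t (fun a => sig n m (y a)) (fun a => sig n m (x a)) :=
  Ex_step_reverse hm2 hm t x y

theorem sum_tr (t : ℕ) (S : Finset (Fin 3 → Fin n)) (x : Fin 3 → Fin n) :
    ∑ y ∈ S, tr n m t x y = Ex (step n m) t (fun z => if z ∈ S then (1 : ℝ) else 0) x := by
  unfold tr
  rw [← Ex_sum]
  congr 1
  funext z
  simp

theorem sum_tr_mul_le (s t : ℕ) (S : Finset (Fin 3 → Fin n)) (x f : Fin 3 → Fin n) :
    ∑ y ∈ S, tr n m s x y * tr n m t y f ≤ tr n m (s + t) x f := by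
  have : tr n m (s + t) x f = ∑ y, tr n m s x y * tr n m t y f := by
    unfold tr
    rw [Ex_add_time, Ex_point]
  rw [this]
  exact Finset.sum_le_sum_of_subset_of_nonneg (Finset.subset_univ _)
    fun y _ _ => mul_nonneg (tr_nonneg _ _ _) (tr_nonneg _ _ _)

/-- The triples of positions near the expected positions of three cards. -/
noncomputable def nbh3 (n m : ℕ) (t : ℤ) (ρ : ℝ) (x : Fin 3 → Fin n) : Finset (Fin 3 → Fin n) :=
  Fintype.piFinset fun a => nbh n m t ρ (x a)

theorem mem_nbh3 {t : ℤ} {ρ : ℝ} {x y : Fin 3 → Fin n} :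
    y ∈ nbh3 n m t ρ x ↔ ∀ a, Near n m t ρ (x a) (y a) := by
  unfold nbh3; simp [mem_nbh]

open Classical in
-- Two bounds for the sum of `tr n m T₁ z y` over `z` near the expected place at time `T₂` and `y`
-- in `Bad`. For fixed `y`, the sum over `z` is at least `3 / 4`. For fixed `z`, the sum over `y` is
-- at most `#Bad * θ / c + 3 η`. The choice of `θ` makes the term with `θ` at most `#Bad / 4`, and
-- the rest gives the claim.
theorem card_filter_tr_lt_le (hm2 : 2 ≤ m) (hm : m < n) {l r η c θ : ℝ} (hl : 0 ≤ l)
    (hln : √(n : ℝ) + 1 ≤ l) (hr0 : 0 ≤ r) (hr : r ≤ 1) (hc : 0 < c) {T₁ T₂ : ℕ}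
    {x : Fin 3 → Fin n} (hx : Sep n m (16 * l) x)
    (hsteer : ∀ z : Fin 3 → Fin n, (∀ a, Near n m T₂ (3 * l) (x a) (z a)) →
      c ≤ Ex (step n m) T₂ (fun w => if ∀ a, Near n m 0 (r * l) (z a) (w a) then (1 : ℝ) else 0) x)
    (hreg : ∀ (a : Fin 3) (x y : Fin 3 → Fin n), Function.Injective x → Function.Injective y →
      (∀ b, b ≠ a → y b = x b) → Near n m 0 (r * l) (x a) (y a) →
      (∀ b, b ≠ a → ¬ Near n m 0 (4 * l) (x a) (x b)) →
      ∀ F : (Fin 3 → Fin n) → ℝ, (∀ z, 0 ≤ F z) → (∀ z, F z ≤ 1) →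
      |Ex (step n m) T₁ F x - Ex (step n m) T₁ F y| ≤ η)
    (htight : ∀ y : Fin 3 → Fin n, 3 / 4 ≤
      Ex (step n m) T₁ (fun w => if ∀ a, Near n m T₁ l (y a) (w a) then 1 else 0) y)
    {Y : Finset (Fin 3 → Fin n)} (hY : ∀ y ∈ Y, ∀ a, Near n m ((T₂ + T₁ : ℕ) : ℤ) l (x a) (y a))
    (hθ : 4 * (#(nbh3 n m T₂ (3 * l) x) : ℝ) * θ ≤ c) :
    (#(Y.filter fun y => tr n m (T₂ + T₁) x y < θ) : ℝ) ≤ 6 * η * #(nbh3 n m T₂ (3 * l) x) := by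
  set Bad := Y.filter fun y => tr n m (T₂ + T₁) x y < θ with hBad
  set Z := nbh3 n m T₂ (3 * l) x with hZ
  set F : (Fin 3 → Fin n) → ℝ := fun z => if z ∈ Bad then (1 : ℝ) else 0 with hF
  have hF0 : ∀ z, 0 ≤ F z := fun z => by simp only [hF]; split_ifs <;> norm_num
  have hF1 : ∀ z, F z ≤ 1 := fun z => by simp only [hF]; split_ifs <;> norm_num
  -- If `Bad` were likely from `z`, then by regularity it would be almost as likely from all triples
  -- within `r l` of `z`. These are reached from `x` with probability `c`, while the total
  -- probability to hit `Bad` is at most `#Bad * θ`.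
  have h1 : ∀ z ∈ Z, c * (∑ y ∈ Bad, tr n m T₁ z y) ≤ #Bad * θ + c * (3 * η) := by
    intro z hz
    have hz' := mem_nbh3.1 hz
    rw [sum_tr]
    have hzs : Sep n m (6 * l) z := hx.of_near (by linarith) hz'
    have k1 : ∑ y ∈ Bad, tr n m (T₂ + T₁) x y ≤ #Bad * θ := by
      rw [← nsmul_eq_mul]
      exact Finset.sum_le_card_nsmul _ _ _ fun y hy => (Finset.mem_filter.1 hy).2.le
    rw [sum_tr, Ex_add_time] at k1
    change c * Ex (step n m) T₁ F z ≤ _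
    change Ex (step n m) T₂ (Ex (step n m) T₁ F) x ≤ _ at k1
    by_cases hneg : Ex (step n m) T₁ F z - 3 * η ≤ 0
    · have k2 : 0 ≤ Ex (step n m) T₂ (Ex (step n m) T₁ F) x :=
        Ex_nonneg _ (fun w => Ex_nonneg _ hF0 _ w) _ _
      nlinarith
    · push Not at hneg
      have k2 := Ex_mono (step n m) (F := fun w => (Ex (step n m) T₁ F z - 3 * η) *
        (if ∀ a, Near n m 0 (r * l) (z a) (w a) then (1 : ℝ) else 0)) (G := Ex (step n m) T₁ F) (fun w => by
          split_ifs with hw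
          · have := (abs_le.1 (abs_Ex_sub_le_of_cards hl hr0 hr
              (fun a x y h1 h2 h3 h4 h5 => hreg a x y h1 h2 h3 h4 h5 F hF0 hF1) hzs hw)).2
            linarith
          · rw [mul_zero]; exact Ex_nonneg _ hF0 _ w) T₂ x
      rw [Ex_mul] at k2
      have k3 := mul_le_mul_of_nonneg_left (hsteer z hz') hneg.le
      linarith
  -- Time reversal turns the sum over starting points into the probability that the reflected deck
  -- stays within `l` of its expected place; these places lie in `Z`.
  have h2 : ∀ y ∈ Bad, 3 / 4 ≤ ∑ z ∈ Z, tr n m T₁ z y := by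
    intro y hy
    have hy' := hY y (Finset.mem_filter.1 hy).1
    have e : ∑ z ∈ Z, tr n m T₁ z y =
        ∑ w ∈ Z.image fun z a => sig n m (z a), tr n m T₁ (fun a => sig n m (y a)) w := by
      rw [Finset.sum_image]
      · exact Finset.sum_congr rfl fun z _ => tr_reverse hm2 hm T₁ z y
      · intro z _ z' _ h
        funext a
        have := congrFun h a
        dsimp only at this
        rw [← sig_sig hm2 hm (z a), this, sig_sig hm2 hm]
    rw [e, sum_tr]
    refine (htight _).trans (Ex_mono _ (fun w => ?_) _ _)
    by_cases hw : ∀ a, Near n m T₁ l (sig n m (y a)) (w a)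
    · have : w ∈ Z.image fun z a => sig n m (z a) := by
        rw [Finset.mem_image]
        refine ⟨fun a => sig n m (w a), mem_nbh3.2 fun a => ?_, funext fun a => sig_sig hm2 hm _⟩
        have k1 := near_sig hm2 hm (t := -T₁) (by rw [neg_neg]; exact hw a)
        rw [sig_sig hm2 hm] at k1
        have k2 := (hy' a).trans k1
        rw [show ((T₂ + T₁ : ℕ) : ℤ) + -T₁ = T₂ by push_cast; ring] at k2
        exact k2.mono (by linarith)
      rw [if_pos hw, if_pos this]
    · rw [if_neg hw]; split_ifs <;> norm_num
  have h3 : (#Bad : ℝ) * (3 / 4) ≤ ∑ z ∈ Z, ∑ y ∈ Bad, tr n m T₁ z y := by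
    rw [Finset.sum_comm, ← nsmul_eq_mul]
    exact Finset.card_nsmul_le_sum _ _ _ h2
  have h4 := Finset.sum_le_sum h1
  rw [← Finset.mul_sum, Finset.sum_const, nsmul_eq_mul] at h4
  have h5 := mul_le_mul_of_nonneg_left h3 hc.le
  have h6 := mul_le_mul_of_nonneg_left hθ (by positivity : (0 : ℝ) ≤ #Bad)
  have h7 : c * (#Bad : ℝ) ≤ c * (6 * η * #Z) := by linarith
  exact le_of_mul_le_mul_left h7 hc

theorem card_nbh3_le (hm : m < n) (t : ℤ) {ρ : ℝ} (hρ : ρ ≤ n) (x : Fin 3 → Fin n) :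
    #(nbh3 n m t ρ x) ≤ #(Box n m (2 * ρ + 5 * √(n : ℝ))) ^ 3 := by
  unfold nbh3
  rw [Fintype.card_piFinset]
  refine (Finset.prod_le_prod' fun a _ => card_nbh_le hm t hρ (x a)).trans (le_of_eq ?_)
  simp

theorem le_card_nbh3 (hm2 : 2 ≤ m) (hm : m < n) (t : ℤ) {ρ : ℝ} (hρ : ρ + 1 ≤ n)
    (x : Fin 3 → Fin n) :
    #(Box n m ρ) ^ 3 ≤ 8 * #(nbh3 n m t (2 * (ρ + 1) + 6 * √(n : ℝ)) x) := by
  unfold nbh3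
  rw [Fintype.card_piFinset]
  have := Finset.prod_le_prod' (s := (Finset.univ : Finset (Fin 3)))
    fun a _ => le_card_nbh hm2 hm t hρ (x a)
  rw [Finset.prod_mul_distrib] at this
  simpa using this

theorem nbh3_mono {t : ℤ} {ρ ρ' : ℝ} (h : ρ ≤ ρ') (x : Fin 3 → Fin n) :
    nbh3 n m t ρ x ⊆ nbh3 n m t ρ' x := fun _ hy =>
  mem_nbh3.2 fun a => (mem_nbh3.1 hy a).mono h

end Ergodic
end OverlappingCycles

/-! ### From the norm to neighbourhoods, and the meeting in the middle -/

namespace OverlappingCycles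

open Finset

section Assembly

variable {n m : ℕ}

theorem drift_zero : drift n m 0 = 0 := by simp [drift]

theorem Near.wdist_le (hm : m < n) {ρ : ℝ} (hρ : ρ ≤ n) {x y : Fin n} (h : Near n m 0 ρ x y) :
    wdist n m x y ≤ 4 * ρ + 10 * √(n : ℝ) := by
  have h1 := h.mem_Box hm hρ
  rw [drift_zero, sub_zero] at h1
  linarith [wdist_le_of_mem_Box hm h1]

theorem sep_of_lt_wdist (hm : m < n) {ρ : ℝ} (hρ : ρ ≤ n) {x₀ x₁ x₂ : Fin n}
    (h₀₁ : 4 * ρ + 10 * √(n : ℝ) < wdist n m x₀ x₁) (h₀₂ : 4 * ρ + 10 * √(n : ℝ) < wdist n m x₀ x₂)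
    (h₁₂ : 4 * ρ + 10 * √(n : ℝ) < wdist n m x₁ x₂) : Sep n m ρ ![x₀, x₁, x₂] := by
  have key : ∀ {x y : Fin n}, 4 * ρ + 10 * √(n : ℝ) < wdist n m x y → ¬ Near n m 0 ρ x y :=
    fun h h' => absurd (h'.wdist_le hm hρ) (not_le.2 h)
  have key' : ∀ {x y : Fin n}, 4 * ρ + 10 * √(n : ℝ) < wdist n m x y → ¬ Near n m 0 ρ y x :=
    fun h h' => key h (by simpa using h'.symm)
  intro a b hab
  fin_cases a <;> fin_cases b <;> first | exact absurd rfl hab | skip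
  · exact key h₀₁
  · exact key h₀₂
  · exact key' h₀₁
  · exact key h₁₂
  · exact key' h₀₂
  · exact key' h₁₂

theorem Sep.sig (hm2 : 2 ≤ m) (hm : m < n) {ρ ρ' : ℝ} {x : Fin 3 → Fin n} (h : Sep n m ρ' x)
    (hρ : ρ + √(n : ℝ) + 1 ≤ ρ') : Sep n m ρ fun a => sig n m (x a) := by
  intro a b hab hn
  have h1 := near_sig hm2 hm (t := 0) (by rw [neg_zero]; exact hn)
  rw [sig_sig hm2 hm, sig_sig hm2 hm] at h1
  exact h a b hab (h1.mono hρ)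

/-- With `q = T / (2 n)` and `q' = 2 T / (2 n)`, which is `2 q` or `2 q + 1`, the congruence reduces
the drift of `2 T` rounds to `q' - (q' - 2 q) m`. Here `q' ≤ T / n` is small against `l` because `99
l ≤ n`, and the coefficient of `m` is at most 1. -/
theorem near_two_mul (hm : m < n) {l : ℝ} (hl : 200 * √(n : ℝ) ≤ l) (hln : 99 * l ≤ n) {T : ℕ}
    (hT : (T : ℝ) ≤ l ^ 2 + 4 * n)
    (hTm : (T : ℤ) - ((T / (2 * n) : ℕ) : ℤ) * m ≡ 0 [ZMOD (2 * (n : ℤ) - m + 1)]) {x y : Fin n}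
    (h : wdist n m x y < l / 10) : Near n m (2 * T) (l / 2) x y := by
  have hn1 : (1 : ℝ) ≤ n := by exact_mod_cast (by omega : 1 ≤ n)
  have h0 : 1 ≤ √(n : ℝ) := by rwa [Real.one_le_sqrt]
  have h1 := mem_Box_of_wdist_lt hm h
  rw [intCast_mem_Box hm] at h1
  obtain ⟨a, b, j, h1, h2, h3⟩ := h1
  obtain ⟨e, he⟩ := (Int.modEq_zero_iff_dvd).1 hTm
  push_cast at he
  have hn2 : (0 : ℤ) < 2 * n := by omega
  set q : ℤ := (T : ℤ) / (2 * n) with hq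
  set q' : ℤ := (2 * T : ℤ) / (2 * n) with hq'
  have e1 := Int.emod_add_mul_ediv (T : ℤ) (2 * n)
  have e2 := Int.emod_nonneg (T : ℤ) hn2.ne'
  have e3 := Int.emod_lt_of_pos (T : ℤ) hn2
  have e4 := Int.emod_add_mul_ediv (2 * T : ℤ) (2 * n)
  have e5 := Int.emod_nonneg (2 * T : ℤ) hn2.ne'
  have e6 := Int.emod_lt_of_pos (2 * T : ℤ) hn2
  rw [← hq] at e1
  rw [← hq'] at e4
  have q1 : 2 * q ≤ q' := by
    rw [hq', Int.le_ediv_iff_mul_le hn2]; linarith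
  have q2 : q' ≤ 2 * q + 1 := by
    apply Int.le_of_lt_add_one
    rw [hq', Int.ediv_lt_iff_lt_mul hn2]; linarith
  have q0 : 0 ≤ q' := Int.ediv_nonneg (by omega) hn2.le
  have q0' : (0 : ℝ) ≤ q' := by exact_mod_cast q0
  have q3 : (q' : ℝ) ≤ l / 99 + 4 := by
    have h4 : (n : ℤ) * q' ≤ T := by linarith
    have h5 : (n : ℝ) * q' ≤ T := by exact_mod_cast h4
    have h6 : l ^ 2 ≤ n * (l / 99) := by nlinarith
    have h7 : (n : ℝ) * q' ≤ n * (l / 99 + 4) := by linarith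
    exact le_of_mul_le_mul_left h7 (by linarith)
  have hB : ((g n m y - g n m x - drift n m (2 * T) : ℤ) : ZMod (md n m)) ∈ Box n m (l / 5) := by
    rw [intCast_mem_Box hm]
    refine ⟨a - q', b + (q' - 2 * q), j - 2 * e, ?_, ?_, ?_⟩
    · push_cast
      have := abs_sub (a : ℝ) q'
      rw [abs_of_nonneg q0'] at this
      linarith
    · have h8 : |((q' - 2 * q : ℤ) : ℝ)| ≤ 1 := by
        have : |q' - 2 * q| ≤ 1 := by rw [abs_le]; constructor <;> omega
        exact_mod_cast this
      have h9 : |((b + (q' - 2 * q) : ℤ) : ℝ)| ≤ |(b : ℝ)| + 1 := by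
        have := abs_add_le (b : ℝ) ((q' - 2 * q : ℤ) : ℝ)
        push_cast at *; linarith
      have := mul_le_mul_of_nonneg_right h9 (by linarith : 0 ≤ √(n : ℝ))
      linarith
    · unfold drift
      rw [← hq']
      linarith
  exact (near_of_mem_Box hm (by linarith) hB).mono (by linarith)

/-- The first `k t₀` rounds are for steering in `k` stages. The last `T₁` rounds have the length
required by regularity and absorb the remainder of the division by `k`. -/
theorem exists_round_split {κ l : ℝ} {n k T : ℕ} (hκ : 0 < κ) (hκ1 : κ ≤ 1 / 4) (hk : 0 < k)
    (hn : 0 < n) (hl : (k + 1 : ℝ) ≤ κ * l ^ 2) (hln : 10 * k * n ≤ l ^ 2) (hT : l ^ 2 < T) :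
    ∃ t₀ T₁ : ℕ, k * t₀ + T₁ = T ∧ κ * l ^ 2 ≤ T₁ ∧ T₁ ≤ 2 * κ * l ^ 2 ∧ 5 * n ≤ t₀ ∧
      l ^ 2 / 2 ≤ k * t₀ := by
  have hk' : (0 : ℝ) < k := by exact_mod_cast hk
  have hn' : (0 : ℝ) < n := by exact_mod_cast hn
  have hl2 : 0 < l ^ 2 := lt_of_lt_of_le (by positivity) hln
  set c := ⌈κ * l ^ 2⌉₊
  have c1 : κ * l ^ 2 ≤ c := Nat.le_ceil _
  have c2 : (c : ℝ) < κ * l ^ 2 + 1 := Nat.ceil_lt_add_one (by positivity)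
  have hκl : κ * l ^ 2 ≤ l ^ 2 / 4 := by
    have := mul_le_mul_of_nonneg_right hκ1 hl2.le; linarith
  have c3 : c ≤ T := by
    have : (c : ℝ) ≤ T := by linarith
    exact_mod_cast this
  have d1 := Nat.mul_div_le (T - c) k
  have d2 := Nat.lt_mul_div_succ (T - c) hk
  set t₀ := (T - c) / k
  have d3 : k * t₀ + c ≤ T := by omega
  have d4 : T < k * t₀ + k + c := by rw [mul_add, mul_one] at d2; omega
  have d3' : (k * t₀ + c : ℝ) ≤ T := by exact_mod_cast d3
  have d4' : (T : ℝ) < k * t₀ + k + c := by exact_mod_cast d4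
  have h5 : l ^ 2 / 2 ≤ k * t₀ := by linarith
  refine ⟨t₀, T - k * t₀, by omega, ?_, ?_, ?_, h5⟩
  · rw [Nat.cast_sub (by omega)]; push_cast; linarith
  · rw [Nat.cast_sub (by omega)]; push_cast; linarith
  · have : (k : ℝ) * (5 * n) ≤ k * t₀ := by linarith
    have := le_of_mul_le_mul_left this hk'
    exact_mod_cast this

open Classical in
-- Only the intermediate triples that are good for both halves are kept; each contributes at least
-- `θ ^ 2`. The second half is read backwards from the reflection of `f`.
theorem le_tr_of_bad (hm2 : 2 ≤ m) (hm : m < n) {T : ℕ} {x f : Fin 3 → Fin n} {θ β : ℝ}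
    (hθ : 0 ≤ θ) {Y : Finset (Fin 3 → Fin n)}
    (hx : (#(Y.filter fun y => tr n m T x y < θ) : ℝ) ≤ β)
    (hf : (#((Y.image fun y a => sig n m (y a)).filter
      fun y => tr n m T (fun a => sig n m (f a)) y < θ) : ℝ) ≤ β) :
    (#Y - 2 * β) * θ ^ 2 ≤ tr n m (2 * T) x f := by
  set G := Y.filter fun y => ¬ (tr n m T x y < θ ∨ tr n m T y f < θ) with hG
  have h1 : ∑ y ∈ G, tr n m T x y * tr n m T y f ≤ tr n m (2 * T) x f := by
    rw [two_mul]; exact sum_tr_mul_le T T G x f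
  have h2 : (#G : ℝ) * θ ^ 2 ≤ ∑ y ∈ G, tr n m T x y * tr n m T y f := by
    rw [← nsmul_eq_mul]
    refine Finset.card_nsmul_le_sum _ _ _ fun y hy => ?_
    have h3 := (Finset.mem_filter.1 hy).2
    push Not at h3
    rw [sq]
    exact mul_le_mul h3.1 h3.2 hθ (tr_nonneg _ _ _)
  have h3 : #(Y.filter fun y => tr n m T y f < θ) ≤ #((Y.image fun y a => sig n m (y a)).filter
      fun y => tr n m T (fun a => sig n m (f a)) y < θ) := by
    apply Finset.card_le_card_of_injOn (fun y a => sig n m (y a))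
    · intro y hy
      have hy := Finset.mem_filter.1 (Finset.mem_coe.1 hy)
      exact Finset.mem_coe.2 (Finset.mem_filter.2 ⟨Finset.mem_image_of_mem _ hy.1,
        (tr_reverse hm2 hm T y f) ▸ hy.2⟩)
    · intro y _ y' _ h
      funext a
      have := congrFun h a
      dsimp only at this
      rw [← sig_sig hm2 hm (y a), this, sig_sig hm2 hm]
  have h4 : #Y ≤ #G + (#(Y.filter fun y => tr n m T x y < θ) + #(Y.filter fun y => tr n m T y f < θ)) := by
    rw [← Finset.card_filter_add_card_filter_not (s := Y)
      (fun y => ¬ (tr n m T x y < θ ∨ tr n m T y f < θ))]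
    refine Nat.add_le_add le_rfl ?_
    refine le_trans (Finset.card_le_card ?_) (Finset.card_union_le _ _)
    intro y hy
    rw [Finset.mem_filter, not_not] at hy
    rw [Finset.mem_union, Finset.mem_filter, Finset.mem_filter]
    tauto
  have h3' : (#(Y.filter fun y => tr n m T y f < θ) : ℝ) ≤ β := le_trans (by exact_mod_cast h3) hf
  have h4' : (#Y : ℝ) ≤ #G + (#(Y.filter fun y => tr n m T x y < θ) +
    #(Y.filter fun y => tr n m T y f < θ)) := by exact_mod_cast h4
  refine le_trans (mul_le_mul_of_nonneg_right ?_ (by positivity)) (h2.trans h1)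
  linarith

theorem card_Box_pow_mul_gam_le (hm : m < n) {l : ℝ} (hl : √(n : ℝ) ≤ l) :
    (#(Box n m (7 * l)) : ℝ) ^ 3 * ((gam l n m : ℝ) ^ 3 * (n : ℝ) ^ (3 / 2 : ℝ)) ≤
      1225 ^ 3 * l ^ 6 := by
  have hn : 0 < n := by omega
  have hs : 0 < √(n : ℝ) := Real.sqrt_pos.2 (by exact_mod_cast hn)
  have h := card_Box_mul_gam_le (m := m) hn hm hl (by linarith : l ≤ 7 * l)
  have e : (n : ℝ) ^ (3 / 2 : ℝ) = √(n : ℝ) ^ 3 := by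
    rw [Real.sqrt_eq_rpow, ← Real.rpow_natCast, ← Real.rpow_mul (by positivity)]
    norm_num
  rw [le_div_iff₀ hs] at h
  have h2 := pow_le_pow_left₀ (by positivity) h 3
  rw [e]
  calc _ = ((#(Box n m (7 * l)) : ℝ) * gam l n m * √(n : ℝ)) ^ 3 := by ring
    _ ≤ (25 * (7 * l) ^ 2) ^ 3 := h2
    _ = _ := by ring

end Assembly
end OverlappingCycles

namespace OverlappingCycles

open Finset

/-- The box of radius `7 l` serves as the unit of volume: it bounds the number of intermediate
triples within `3 l`, and up to the factor `Λ` also the number of those within `l / 4`. -/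
theorem exists_le_tr {ε : ℝ} (hε : 0 < ε) (hε1 : ε ≤ 1 / 2) : ∃ C D : ℝ, 200 ≤ C ∧ 0 < D ∧
    ∀ n m : ℕ, 2 ≤ m → m < n → ε * n ≤ m → ε * n ≤ n - m → ∀ l : ℝ, C * √(n : ℝ) ≤ l → 99 * l ≤ n →
    ∀ T : ℕ, l ^ 2 < T → (T : ℝ) ≤ l ^ 2 + 4 * n → ∀ x f : Fin 3 → Fin n,
    Sep n m (16 * l) x → Sep n m (18 * l) f → (∀ a, Near n m (2 * T) (l / 2) (x a) (f a)) →
    D ≤ #(Box n m (7 * l)) ^ 3 * tr n m (2 * T) x f := by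
  classical
  obtain ⟨K, p, hK, hp, N, hsteer⟩ := exists_near_steer hε
  -- The box of radius `7 l` is covered by `281 ^ 2` translates of that of radius `l / 10`, as `281
  -- = 4 * 70 + 1`. This is cubed for three cards, and `8 = 2 ^ 3` comes from the residues that are
  -- no positions.
  obtain ⟨Λ, hΛ⟩ : ∃ Λ : ℝ, Λ = 8 * 281 ^ 6 := ⟨_, rfl⟩
  have hΛ0 : 1 ≤ Λ := by rw [hΛ]; norm_num
  have hΛpos : 0 < Λ := by linarith
  -- With this `η` each of the two bad sets has at most `β / (4 Λ)` elements, at most a quarter of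
  -- `Y`. The bound `ε / 72` on `κ` makes the cards stay within `l` during `T₁` rounds with
  -- probability `3 / 4`.
  obtain ⟨κ, r, C₁, hκ, hκε, hr, hr1, hC₁, hreg⟩ := exists_regularity hε hε1
    (η := 1 / (24 * Λ)) (by positivity) (by rw [div_le_one (by positivity)]; linarith)
    (κ₀ := ε / 72) (by positivity)
  -- So many stages that a single one is short enough for the final error `K √t₀` of the steering to
  -- be at most `r l`.
  obtain ⟨k, hk⟩ := exists_nat_ge (2 * K ^ 2 / r ^ 2)
  have hk0 : 0 < k := by
    have : (0 : ℝ) < k := lt_of_lt_of_le (by positivity) hk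
    exact_mod_cast this
  have hk0' : (0 : ℝ) < k := by exact_mod_cast hk0
  rw [div_le_iff₀ (by positivity)] at hk
  have hc : 0 < p ^ k := by positivity
  have hkκ : 0 < (k + 1) / κ := by positivity
  refine ⟨C₁ + N + 200 + 10 * k + (k + 1) / κ, (p ^ k) ^ 2 / (32 * Λ), by
    have : (0 : ℝ) ≤ N := by positivity
    linarith, by positivity, ?_⟩
  intro n m hm2 hm hm3 hm4 l hl hln T hT1 hT2 x f hx hf hxf
  set C : ℝ := C₁ + N + 200 + 10 * k + (k + 1) / κ with hC
  have hN0 : (0 : ℝ) ≤ N := by positivity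
  have hC200 : 200 ≤ C := by linarith
  have hn : 0 < n := by omega
  have hn1 : (1 : ℝ) ≤ n := by exact_mod_cast hn
  have hn0 : (0 : ℝ) < n := by linarith
  have hm0 : (0 : ℝ) < m := by exact_mod_cast (by omega : 0 < m)
  have hs1 : 1 ≤ √(n : ℝ) := by rwa [Real.one_le_sqrt]
  have hs0 : 0 < √(n : ℝ) := by linarith
  have hsq : √(n : ℝ) ^ 2 = n := Real.sq_sqrt hn0.le
  have hl200 : 200 * √(n : ℝ) ≤ l := (mul_le_mul_of_nonneg_right hC200 hs0.le).trans hl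
  have hCl : C ≤ l := (le_mul_of_one_le_right (by linarith) hs1).trans hl
  have hl0 : 0 < l := by linarith
  have hl2 : 0 < l ^ 2 := by positivity
  have hCn : C * n ≤ l ^ 2 := by
    have h1 : (C * √(n : ℝ)) ^ 2 ≤ l ^ 2 := pow_le_pow_left₀ (by positivity) hl 2
    rw [mul_pow, hsq] at h1
    have h2 : C * n ≤ C ^ 2 * n :=
      mul_le_mul_of_nonneg_right (le_self_pow₀ (by linarith) (by norm_num)) hn0.le
    linarith
  have hCK : ∀ {B : ℝ}, B ≤ C → B * n ≤ l ^ 2 := fun h =>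
    (mul_le_mul_of_nonneg_right h hn0.le).trans hCn
  have h200n : 200 * (n : ℝ) ≤ l ^ 2 := hCK hC200
  have hnN : N ≤ n := by
    have : (N : ℝ) ≤ n := by linarith
    exact_mod_cast this
  have hκl : (k + 1 : ℝ) ≤ κ * l ^ 2 := by
    have h1 : (k + 1) / κ ≤ l ^ 2 := by
      have h2 : (k + 1) / κ * 1 ≤ (k + 1) / κ * n := by gcongr
      linarith [hCK (by linarith : (k + 1) / κ ≤ C)]
    rw [div_le_iff₀ hκ] at h1
    linarith
  obtain ⟨t₀, T₁, hTT, hT₁1, hT₁2, ht₀, ht₀2⟩ := exists_round_split hκ (by linarith) hk0 hn hκl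
    (hCK (by linarith)) hT1
  have hTT' : (k * t₀ + T₁ : ℝ) = T := by exact_mod_cast hTT
  have hrl : K ^ 2 * t₀ ≤ (r * l) ^ 2 := by
    have h1 : (k : ℝ) * t₀ ≤ 2 * l ^ 2 := by
      have : (0 : ℝ) ≤ T₁ := by positivity
      linarith
    have h2 := mul_le_mul_of_nonneg_left h1 (by positivity : 0 ≤ K ^ 2)
    have h3 := mul_le_mul_of_nonneg_right hk hl2.le
    have h4 : (k : ℝ) * (K ^ 2 * t₀) ≤ k * (r * l) ^ 2 := by
      calc (k : ℝ) * (K ^ 2 * t₀) = K ^ 2 * (k * t₀) := by ring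
        _ ≤ _ := h2
        _ = 2 * K ^ 2 * l ^ 2 := by ring
        _ ≤ _ := h3
        _ = _ := by ring
    exact le_of_mul_le_mul_left h4 hk0'
  have htight : ∀ y : Fin 3 → Fin n, 3 / 4 ≤
      Ex (step n m) T₁ (fun w => if ∀ a, Near n m T₁ l (y a) (w a) then 1 else 0) y := by
    intro y
    refine le_trans ?_ (one_sub_le_Ex_near hm2 hm hl0 T₁ y)
    have h1 : (T₁ : ℝ) ≤ ε * l ^ 2 / 36 := by
      have := mul_le_mul_of_nonneg_right hκε hl2.le
      linarith
    have h2 : (n : ℝ) * (T₁ / m) ≤ l ^ 2 / 36 := by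
      rw [mul_div_assoc', div_le_iff₀ hm0]
      have h3 := mul_le_mul_of_nonneg_left h1 hn0.le
      have h4 := mul_le_mul_of_nonneg_left hm3 hl2.le
      linarith
    have h3 : ε * l ^ 2 ≤ l ^ 2 / 2 := by
      have := mul_le_mul_of_nonneg_right hε1 hl2.le; linarith
    have h4 : 3 * ((T₁ : ℝ) + n * (T₁ / m + 1)) / l ^ 2 ≤ 1 / 4 := by
      rw [div_le_iff₀ hl2]; linarith
    linarith
  set β : ℝ := (#(Box n m (7 * l)) : ℝ) ^ 3 with hβ
  have hβ0 : 0 < β := by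
    have : 0 < #(Box n m (7 * l)) := Finset.card_pos.2
      ⟨_, (mem_Box hn).2 ⟨0, 0, by simp; linarith, by simp; linarith, rfl⟩⟩
    have h : (0 : ℝ) < #(Box n m (7 * l)) := by exact_mod_cast this
    positivity
  have hZ : ∀ (t : ℤ) (x : Fin 3 → Fin n), (#(nbh3 n m t (3 * l) x) : ℝ) ≤ β := by
    intro t x
    have h1 := card_nbh3_le hm t (by linarith : 3 * l ≤ n) x
    have h2 := Finset.card_le_card (Box_mono (m := m) hn
      (by linarith : 2 * (3 * l) + 5 * √(n : ℝ) ≤ 7 * l))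
    have h3 : #(nbh3 n m t (3 * l) x) ≤ #(Box n m (7 * l)) ^ 3 :=
      h1.trans (Nat.pow_le_pow_left h2 3)
    rw [hβ]
    exact_mod_cast h3
  set Y := nbh3 n m (T : ℤ) (l / 4) x with hY
  have hYβ : β ≤ Λ * #Y := by
    have h1 := le_card_nbh3 hm2 hm (T : ℤ) (by linarith : l / 10 + 1 ≤ n) x
    have h2 := Finset.card_le_card (nbh3_mono (m := m) (t := (T : ℤ))
      (by linarith : 2 * (l / 10 + 1) + 6 * √(n : ℝ) ≤ l / 4) x)
    have h3 := card_Box_mul_le (m := m) hn 70 (by linarith : √(n : ℝ) ≤ l / 10)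
    rw [show ((70 : ℕ) : ℝ) * (l / 10) = 7 * l by push_cast; ring] at h3
    have h4 : #(Box n m (7 * l)) ^ 3 ≤ (8 * 281 ^ 6) * #Y := by
      calc _ ≤ ((4 * 70 + 1) ^ 2 * #(Box n m (l / 10))) ^ 3 := Nat.pow_le_pow_left h3 3
        _ = 281 ^ 6 * #(Box n m (l / 10)) ^ 3 := by ring
        _ ≤ 281 ^ 6 * (8 * #Y) := by gcongr; exact h1.trans (by gcongr)
        _ = _ := by ring
    rw [hβ, hΛ]
    exact_mod_cast h4
  set θ : ℝ := p ^ k / (4 * β) with hθ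
  have hθ0 : 0 ≤ θ := by positivity
  have hbad : ∀ (x : Fin 3 → Fin n), Sep n m (16 * l) x → ∀ Y : Finset (Fin 3 → Fin n),
      (∀ y ∈ Y, ∀ a, Near n m T l (x a) (y a)) →
      (#(Y.filter fun y => tr n m T x y < θ) : ℝ) ≤ 6 * (1 / (24 * Λ)) * β := by
    intro x hx Y hY
    rw [← hTT]
    refine (card_filter_tr_lt_le hm2 hm (T₁ := T₁) (T₂ := k * t₀) (η := 1 / (24 * Λ)) hl0.le
      (by linarith) hr.le hr1 hc hx ?_ ?_ htight ?_ ?_).trans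
      (mul_le_mul_of_nonneg_left (hZ _ _) (by positivity))
    · intro z hz
      exact hsteer n m hnN hm2 hm hm3 hm4 t₀ k (3 * l) (r * l) x z ht₀ (hx.injective (by linarith)) hz
        (by linarith) (by positivity) hrl
    · intro a x y h1 h2 h3 h4 h5 F hF0 hF1
      have hkκ' : C₁ ≤ C := by linarith
      exact hreg n m hm2 hm hm3 hm4 l ((mul_le_mul_of_nonneg_right hkκ' hs0.le).trans hl) hln T₁
        hT₁1 hT₁2 a x y h1 h2 h3 h4 h5 F hF0 hF1
    · rw [hTT]; exact hY
    · rw [hθ, mul_div_assoc', div_le_iff₀ (by positivity)]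
      have := mul_le_mul_of_nonneg_right (hZ (k * t₀ : ℕ) x) hc.le
      linarith
  have hb1 := hbad x hx Y fun y hy a => (mem_nbh3.1 hy a).mono (by linarith)
  have hb2 := hbad (fun a => sig n m (f a)) (hf.sig hm2 hm (by linarith))
    (Y.image fun y a => sig n m (y a)) (by
      intro z hz a
      obtain ⟨y, hy, rfl⟩ := Finset.mem_image.1 hz
      have h1 := (hxf a).symm.trans (mem_nbh3.1 hy a)
      rw [show -(2 * (T : ℤ)) + T = -T by ring] at h1
      exact (near_sig hm2 hm h1).mono (by linarith))
  have h1 := le_tr_of_bad hm2 hm hθ0 hb1 hb2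
  have h2 : 1 / (2 * Λ) * β ≤ #Y - 2 * (6 * (1 / (24 * Λ)) * β) := by
    have h3 : β / Λ ≤ #Y := by rw [div_le_iff₀ hΛpos]; linarith
    have e1 : 1 / (2 * Λ) * β = β / Λ / 2 := by field_simp
    have e2 : 2 * (6 * (1 / (24 * Λ)) * β) = β / Λ / 2 := by field_simp; norm_num
    rw [e1, e2]; linarith
  have h3 := mul_le_mul_of_nonneg_left
    ((mul_le_mul_of_nonneg_right h2 (by positivity : 0 ≤ θ ^ 2)).trans h1) hβ0.le
  refine le_trans (le_of_eq ?_) h3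
  rw [hθ]
  field_simp
  norm_num

end OverlappingCycles

theorem mainTheorem5 (ε : ℝ) (hε0 : 0 < ε) (hε1 : ε < 1 / 2) :
    ∃ C D : ℝ, 0 < C ∧ 0 < D ∧
      ∀ n m : ℕ, 2 ≤ m → m < n → ε < (m : ℝ) / n → (m : ℝ) / n < 1 - ε →
      ∀ l : ℝ, C * √(n : ℝ) < l →
      ∀ i j k : Fin n,
        199 * l < OverlappingCycles.wdist n m i j →
        199 * l < OverlappingCycles.wdist n m i k →
        199 * l < OverlappingCycles.wdist n m j k →
      ∀ fi fj fk : Fin n,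
        OverlappingCycles.wdist n m i fi < l / 10 →
        OverlappingCycles.wdist n m j fj < l / 10 →
        OverlappingCycles.wdist n m k fk < l / 10 →
        199 * l < OverlappingCycles.wdist n m fi fj →
        199 * l < OverlappingCycles.wdist n m fi fk →
        199 * l < OverlappingCycles.wdist n m fj fk →
      ∀ T : ℕ, l ^ 2 < (T : ℝ) → (T : ℝ) < l ^ 2 + 4 * n →
        (T : ℤ) - ((T / (2 * n) : ℕ) : ℤ) * m ≡ 0 [ZMOD (2 * (n : ℤ) - m + 1)] →
        D * (OverlappingCycles.gam l n m : ℝ) ^ 3 * (n : ℝ) ^ (3 / 2 : ℝ) / l ^ 6 ≤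
          OverlappingCycles.hitProb n m (2 * T) i j k fi fj fk := by
  obtain ⟨C, D, hC, hD, key⟩ := OverlappingCycles.exists_le_tr hε0 hε1.le
  refine ⟨C, D / 1225 ^ 3, by linarith, by positivity, ?_⟩
  intro n m hm2 hm hm3 hm4 l hl i j k hij hik hjk fi fj fk hi hj hk fij fik fjk T hT1 hT2 hT
  have hn1 : (1 : ℝ) ≤ n := by exact_mod_cast (by omega : 1 ≤ n)
  have hn0 : (0 : ℝ) < n := by linarith
  rw [lt_div_iff₀ hn0] at hm3
  rw [div_lt_iff₀ hn0] at hm4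
  have hs1 : 1 ≤ √(n : ℝ) := by rwa [Real.one_le_sqrt]
  have hl200 : 200 * √(n : ℝ) ≤ l :=
    (mul_le_mul_of_nonneg_right hC (by linarith)).trans hl.le
  have hl0 : 0 < l := by linarith
  -- No distance exceeds `2 n`, so the separation of the cards `i` and `j` forces `l` to be small
  -- against `n`.
  have hln : 99 * l ≤ n := by linarith [OverlappingCycles.wdist_le hm i j]
  have h := key n m hm2 hm hm3.le (by linarith) l hl.le hln T hT1 hT2.le ![i, j, k] ![fi, fj, fk]
    (OverlappingCycles.sep_of_lt_wdist hm (by linarith) (by linarith) (by linarith) (by linarith))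
    (OverlappingCycles.sep_of_lt_wdist hm (by linarith) (by linarith) (by linarith) (by linarith)) ?_
  · have e : OverlappingCycles.tr n m (2 * T) ![i, j, k] ![fi, fj, fk] =
        OverlappingCycles.hitProb n m (2 * T) i j k fi fj fk :=
      (OverlappingCycles.hitProb_eq n m (2 * T) i j k fi fj fk).symm
    rw [e] at h
    have h0 : 0 ≤ OverlappingCycles.hitProb n m (2 * T) i j k fi fj fk :=
      MeasureTheory.measureReal_nonneg
    have hB := OverlappingCycles.card_Box_pow_mul_gam_le (m := m) hm (by linarith : √(n : ℝ) ≤ l)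
    set G : ℝ := (OverlappingCycles.gam l n m : ℝ) ^ 3 * (n : ℝ) ^ (3 / 2 : ℝ) with hG
    have hG0 : 0 ≤ G := by positivity
    rw [mul_assoc, ← hG, div_mul_eq_mul_div, div_div, div_le_iff₀ (by positivity)]
    have h1 := mul_le_mul_of_nonneg_right h hG0
    have h2 := mul_le_mul_of_nonneg_right hB h0
    linarith
  · intro a
    fin_cases a
    · exact OverlappingCycles.near_two_mul hm hl200 hln hT2.le hT hi
    · exact OverlappingCycles.near_two_mul hm hl200 hln hT2.le hT hj
    · exact OverlappingCycles.near_two_mul hm hl200 hln hT2.le hT hk
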